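/- **Setting.** Let $N\ge 1$ and let $\mathbf v_1,\dots,\mathbf v_N\in\mathbb R^d\setminus\{O\}$, where $O=0$, be such that $\mathbf v_i,\mathbf v_j$ are linearly independent for $i\neq j$. Put $E_i=\{t\mathbf v_i:0<t<1\}$, $\ell_i=|\mathbf v_i|$, $\Gamma=\bigcup_{i}\bar E_i$ and $\mathbf V_b=\{\mathbf v_1,\dots,\mathbf v_N\}$. For $u:\Gamma\to\mathbb R$ let $u_i(t)=u(t\mathbf v_i/\ell_i)$, $t\in[0,\ell_i]$; for $x\in\bar E_i$ write $u_{x_i}(x)=u_i'(|x|)$ and $u_{x_ix_i}(x)=u_i''(|x|)$ (one-sided at the endpoints). $C^2(\Gamma)$ is the set of continuous $u$ on $\Gamma$ with all $u_i\in C^2([0,\ell_i])$. Consider the problem $$\lambda u-a_i(x)u_{xx}+H_i(x,u_x)=0\ \text{ on }E_i,\qquad F(u(O),u_{x_1}(O),\dots,u_{x_N}(O))=0,\qquad u(\mathbf v_i)=h_i,\qquad 1\le i\le N. \tag{P}$$ **Solutions.** Write $G_i(r,p,X,x)=\lambda r-a_i(x)X+H_i(x,p)$. An upper semicontinuous $u:\Gamma\to\mathbb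 R$ is a subsolution of (P) if for every $\varphi\in C^2(\Gamma)$ and every local maximum point $x\in\Gamma$ of $u-\varphi$: * if $x\in E_i$, then $G_i(u(x),\varphi_{x_i}(x),\varphi_{x_ix_i}(x),x)\le 0$; * if $x=O$, then $\min\{\min_i G_i(u(O),\varphi_{x_i}(O),\varphi_{x_ix_i}(O),O),\,F(u(O),\varphi_{x_1}(O),\dots,\varphi_{x_N}(O))\}\le 0$; * if $x=\mathbf v_i$, then $\min\{G_i(u(x),\varphi_{x_i}(x),\varphi_{x_ix_i}(x),x),\,u(x)-h_i\}\le 0$. A lower semicontinuous $v$ is a supersolution if the same holds at local minimum points of $v-\varphi$ with $\min,\le$ replaced by $\max,\ge$. A solution is a locally bounded $u:\Gamma\to\mathbb R$ (possibly discontinuous) whose upper semicontinuous envelope is a subsolution and whose lower semicontinuous envelope is a supersolution. **Assumptions.** $\lambda>0$ and $h_i\in\mathbb R$. There is a constant $C>0$ such that, for all $i$: * for all $x,y\in\bar E_i$ and $p,q\in\mathbb R$, $|H_i(x,p)-H_i(y,p)|\le C(1+|p|)|x-y|$ and $|H_i(x,p)-H_i(x,q)|\le C|p-q|$; * $a_i=\sigma_i^2$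 on $\bar E_i$ with $|\sigma_i(x)-\sigma_i(y)|\le C|x-y|$; * if $a_i(O)=0$, then $H_i(x,p)\ge C^{-1}|p|-C$ for all $x\in\bar E_i$, $p\in\mathbb R$; * either $a_i(\mathbf v_i)>0$, or $H_i(x,p)\ge C^{-1}|p|-C$ for all $p\in\mathbb R$ and all $x\in \bar E_i$ in a neighborhood of $\mathbf v_i$. $F:\mathbb R\times\mathbb R^N\to\mathbb R$ is continuous; if $r\ge s$ and $p_i\le q_i$ for all $i$, then $F(r,p)\ge F(s,q)$, with strict inequality if moreover $p_j<q_j$ for some $j$; and $F(r,p_1,\dots,p_N)\to+\infty$ as $p_i\to-\infty$ with $r$ and the other $p_j$ fixed, for each $i$. **Proposition 5.3 (vanishing viscosity).** Under these assumptions, let $\varepsilon_0>0$ and, for every $\varepsilon\in(0,\varepsilon_0)$, let $u^\varepsilon$ be a solution of (P) with $a_i$ replaced by $\varepsilon+a_i$. Then (P) has a unique continuous solution $u:\Gamma\to\mathbb R$, every solution of (P) coincides with $u$ on $\Gamma\setminus\mathbf V_b$, and $u^\varepsilon\to u$ as $\varepsilon\to0$, uniformly on every compact subset of $\Gamma\setminus\mathbf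 V_b$. -/

import Mathlib

open Set Filter Topology

/-- A junction (star-shaped network) in `ℝ^d`: the interior vertex is `O = 0` and the `N` boundary
vertices are the points `vert i`, which are nonzero and pairwise not collinear with `O`. -/
structure Junction (d N : ℕ) where
  vert : Fin N → EuclideanSpace ℝ (Fin d)
  vert_ne_zero : ∀ i, vert i ≠ 0
  not_collinear : ∀ i j, i ≠ j → LinearIndependent ℝ ![vert i, vert j]

namespace Junction

variable {d N : ℕ} (J : Junction d N)

/-- The open edge `E_i = {t v_i : 0 < t < 1}`. -/
def edge (i : Fin N) : Set (EuclideanSpace ℝ (Fin d)) := openSegment ℝ 0 (J.vert i)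

/-- The closed edge: the segment from `O` to `v_i`. -/
def closedEdge (i : Fin N) : Set (EuclideanSpace ℝ (Fin d)) := segment ℝ 0 (J.vert i)

/-- The junction `Γ`, the union of the closed edges. Functions on `Γ` are represented by functions
on `ℝ^d`; every notion below depends only on their restriction to `Γ`. -/
def carrier : Set (EuclideanSpace ℝ (Fin d)) := ⋃ i, J.closedEdge i

/-- The set of boundary vertices. -/
def boundary : Set (EuclideanSpace ℝ (Fin d)) := Set.range J.vert

/-- The length `ℓ_i` of the `i`-th edge. -/
noncomputable def len (i : Fin N) : ℝ := ‖J.vert i‖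

/-- The arc-length parametrization `[0, ℓ_i] → closedEdge i`, starting at `O`. -/
noncomputable def param (i : Fin N) (t : ℝ) : EuclideanSpace ℝ (Fin d) :=
  (t / J.len i) • J.vert i

/-- The function `u_i = u ∘ γ_i`, considered on `[0, ℓ_i]`. -/
noncomputable def onEdge (u : EuclideanSpace ℝ (Fin d) → ℝ) (i : Fin N) (t : ℝ) : ℝ :=
  u (J.param i t)

/-- The class `C²(Γ)`: continuous on `Γ`, and every `u_i` is `C²` on `[0, ℓ_i]` up to the
endpoints. -/
def IsC2 (φ : EuclideanSpace ℝ (Fin d) → ℝ) : Prop :=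
  ContinuousOn φ J.carrier ∧ ∀ i, ContDiffOn ℝ 2 (J.onEdge φ i) (Icc 0 (J.len i))

/-- The first derivative `φ_{x_i}(x)` at a point `x` of the `i`-th closed edge, whose arc-length
coordinate is `‖x‖` (one-sided at the endpoints). -/
noncomputable def dx (φ : EuclideanSpace ℝ (Fin d) → ℝ) (i : Fin N)
    (x : EuclideanSpace ℝ (Fin d)) : ℝ :=
  derivWithin (J.onEdge φ i) (Icc 0 (J.len i)) ‖x‖

/-- The second derivative `φ_{x_i x_i}(x)` at a point `x` of the `i`-th closed edge. -/
noncomputable def dxx (φ : EuclideanSpace ℝ (Fin d) → ℝ) (i : Fin N)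
    (x : EuclideanSpace ℝ (Fin d)) : ℝ :=
  iteratedDerivWithin 2 (J.onEdge φ i) (Icc 0 (J.len i)) ‖x‖

/-- `u` is locally bounded on `Γ`. -/
def IsLocallyBdd (u : EuclideanSpace ℝ (Fin d) → ℝ) : Prop :=
  ∀ x ∈ J.carrier, ∃ C : ℝ, ∀ᶠ y in 𝓝[J.carrier] x, |u y| ≤ C

/-- The upper-semicontinuous envelope `u^*` on `Γ` (used for locally bounded `u` only);
the point `x` itself is not excluded in the upper limit. -/
noncomputable def uscEnvelope (u : EuclideanSpace ℝ (Fin d) → ℝ)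
    (x : EuclideanSpace ℝ (Fin d)) : ℝ :=
  limsup u (𝓝[J.carrier] x)

/-- The lower-semicontinuous envelope `u_*` on `Γ` (used for locally bounded `u` only). -/
noncomputable def lscEnvelope (u : EuclideanSpace ℝ (Fin d) → ℝ)
    (x : EuclideanSpace ℝ (Fin d)) : ℝ :=
  liminf u (𝓝[J.carrier] x)

end Junction

/-- The data of the Kirchhoff-Dirichlet problem on a junction:
`λ u - a_i(x) u_xx + H_i(x, u_x) = 0` on each edge, `F(u(O), u_{x_1}(O), …, u_{x_N}(O)) = 0` at the
junction point and `u(v_i) = h_i` at the boundary vertices. Only the values of `a i` and `H i` on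
the `i`-th closed edge matter. -/
structure KirchhoffProblem (d N : ℕ) where
  lam : ℝ
  a : Fin N → EuclideanSpace ℝ (Fin d) → ℝ
  H : Fin N → EuclideanSpace ℝ (Fin d) → ℝ → ℝ
  F : ℝ → (Fin N → ℝ) → ℝ
  h : Fin N → ℝ

namespace KirchhoffProblem

variable {d N : ℕ}

/-- The same problem with the diffusions `a_i` replaced by `ε + a_i`. -/
def addViscosity (P : KirchhoffProblem d N) (ε : ℝ) : KirchhoffProblem d N :=
  { P with a := fun i x => ε + P.a i x }

/-- `λ r - a_i(x) X + H_i(x, p)`. -/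
def G (P : KirchhoffProblem d N) (i : Fin N) (r p X : ℝ) (x : EuclideanSpace ℝ (Fin d)) : ℝ :=
  P.lam * r - P.a i x * X + P.H i x p

/-- Viscosity subsolutions, with the junction condition and the Dirichlet conditions in the
viscosity sense. An inequality `min {A, B} ≤ 0` is written `A ≤ 0 ∨ B ≤ 0`. -/
structure IsSubsolution (P : KirchhoffProblem d N) (J : Junction d N)
    (u : EuclideanSpace ℝ (Fin d) → ℝ) : Prop where
  usc : UpperSemicontinuousOn u J.carrier
  on_edge : ∀ φ, J.IsC2 φ → ∀ i, ∀ x ∈ J.edge i,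
    IsLocalMaxOn (fun y => u y - φ y) J.carrier x →
      P.G i (u x) (J.dx φ i x) (J.dxx φ i x) x ≤ 0
  at_junction : ∀ φ, J.IsC2 φ → IsLocalMaxOn (fun y => u y - φ y) J.carrier 0 →
    (∃ i, P.G i (u 0) (J.dx φ i 0) (J.dxx φ i 0) 0 ≤ 0) ∨
      P.F (u 0) (fun i => J.dx φ i 0) ≤ 0
  at_boundary : ∀ φ, J.IsC2 φ → ∀ i,
    IsLocalMaxOn (fun y => u y - φ y) J.carrier (J.vert i) →
      P.G i (u (J.vert i)) (J.dx φ i (J.vert i)) (J.dxx φ i (J.vert i)) (J.vert i) ≤ 0 ∨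
        u (J.vert i) - P.h i ≤ 0

/-- Viscosity supersolutions. An inequality `max {A, B} ≥ 0` is written `0 ≤ A ∨ 0 ≤ B`. -/
structure IsSupersolution (P : KirchhoffProblem d N) (J : Junction d N)
    (v : EuclideanSpace ℝ (Fin d) → ℝ) : Prop where
  lsc : LowerSemicontinuousOn v J.carrier
  on_edge : ∀ φ, J.IsC2 φ → ∀ i, ∀ x ∈ J.edge i,
    IsLocalMinOn (fun y => v y - φ y) J.carrier x →
      0 ≤ P.G i (v x) (J.dx φ i x) (J.dxx φ i x) x
  at_junction : ∀ φ, J.IsC2 φ → IsLocalMinOn (fun y => v y - φ y) J.carrier 0 →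
    (∃ i, 0 ≤ P.G i (v 0) (J.dx φ i 0) (J.dxx φ i 0) 0) ∨
      0 ≤ P.F (v 0) (fun i => J.dx φ i 0)
  at_boundary : ∀ φ, J.IsC2 φ → ∀ i,
    IsLocalMinOn (fun y => v y - φ y) J.carrier (J.vert i) →
      0 ≤ P.G i (v (J.vert i)) (J.dx φ i (J.vert i)) (J.dxx φ i (J.vert i)) (J.vert i) ∨
        0 ≤ v (J.vert i) - P.h i

/-- Viscosity solutions (possibly discontinuous). -/
structure IsSolution (P : KirchhoffProblem d N) (J : Junction d N)
    (u : EuclideanSpace ℝ (Fin d) → ℝ) : Prop where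
  locallyBdd : J.IsLocallyBdd u
  sub : P.IsSubsolution J (J.uscEnvelope u)
  super : P.IsSupersolution J (J.lscEnvelope u)

/-- `H_i` is Lipschitz continuous in `p`, and in `x` with a constant growing linearly in `p`. -/
def HamiltonianRegular (P : KirchhoffProblem d N) (J : Junction d N) (i : Fin N) : Prop :=
  ∃ C : ℝ, (∀ x ∈ J.closedEdge i, ∀ y ∈ J.closedEdge i, ∀ p : ℝ,
      |P.H i x p - P.H i y p| ≤ C * (1 + |p|) * ‖x - y‖) ∧
    (∀ x ∈ J.closedEdge i, ∀ p q : ℝ, |P.H i x p - P.H i x q| ≤ C * |p - q|)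

/-- `H_i` is coercive on the closed edge. -/
def Coercive (P : KirchhoffProblem d N) (J : Junction d N) (i : Fin N) : Prop :=
  ∃ C : ℝ, 0 < C ∧ ∀ x ∈ J.closedEdge i, ∀ p : ℝ, C⁻¹ * |p| - C ≤ P.H i x p

/-- `H_i` is coercive in a neighborhood of the boundary vertex `v_i` in the closed edge. -/
def CoerciveNearBoundary (P : KirchhoffProblem d N) (J : Junction d N) (i : Fin N) : Prop :=
  ∃ C : ℝ, 0 < C ∧ ∀ᶠ x in 𝓝[J.closedEdge i] (J.vert i), ∀ p : ℝ,
    C⁻¹ * |p| - C ≤ P.H i x p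

/-- `a_i = σ_i²` with `σ_i` Lipschitz continuous on the closed edge. -/
def DiffusionRegular (P : KirchhoffProblem d N) (J : Junction d N) (i : Fin N) : Prop :=
  ∃ (σ : EuclideanSpace ℝ (Fin d) → ℝ) (C : ℝ),
    (∀ x ∈ J.closedEdge i, P.a i x = σ x ^ 2) ∧
    (∀ x ∈ J.closedEdge i, ∀ y ∈ J.closedEdge i, |σ x - σ y| ≤ C * ‖x - y‖)

/-- Continuity, monotonicity and coercivity of the nonlinear Kirchhoff condition. -/
structure KirchhoffRegular (P : KirchhoffProblem d N) : Prop where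
  continuous : Continuous (fun z : ℝ × (Fin N → ℝ) => P.F z.1 z.2)
  monotone : ∀ (r s : ℝ) (p q : Fin N → ℝ), s ≤ r → (∀ i, p i ≤ q i) → P.F s q ≤ P.F r p
  strict_monotone : ∀ (r s : ℝ) (p q : Fin N → ℝ), s ≤ r → (∀ i, p i ≤ q i) →
    (∃ j, p j < q j) → P.F s q < P.F r p
  coercive : ∀ (i : Fin N) (r : ℝ) (p : Fin N → ℝ),
    Tendsto (fun t : ℝ => P.F r (Function.update p i t)) atBot atTop

/-- The standing assumptions: `λ > 0`, regular Hamiltonians and diffusions, coercivity of the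
Hamiltonians on the edges whose diffusion vanishes at `O`, and the assumptions on `F`. -/
structure StandingAssumptions (P : KirchhoffProblem d N) (J : Junction d N) : Prop where
  lam_pos : 0 < P.lam
  hamiltonian : ∀ i, P.HamiltonianRegular J i
  diffusion : ∀ i, P.DiffusionRegular J i
  coercive : ∀ i, P.a i 0 = 0 → P.Coercive J i
  kirchhoff : P.KirchhoffRegular

/-- At every boundary vertex, either the diffusion is positive or the Hamiltonian is coercive in a
neighborhood. -/
def DirichletAssumption (P : KirchhoffProblem d N) (J : Junction d N) : Prop :=
  ∀ i, 0 < P.a i (J.vert i) ∨ P.CoerciveNearBoundary J i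

end KirchhoffProblem

/-! The proof is the method of half-relaxed limits, with a comparison principle doing the work.
Supersolutions are handled as subsolutions of the problem satisfied by `-u`
(`KirchhoffProblem.dual`). A test function of constant slope `β` along every edge does not feel the
added viscosity, so it bounds the `u^ε` uniformly (`exists_forall_isSubsolution_le`). For the bound
from below `F` has to take a negative value; coercivity does not provide one, but the existence of a
single `u^ε` does (`exists_dual_pos`). The upper relaxed limits `U` of `u^ε` and `W` of `-u^ε` are
then a subsolution and a dual subsolution of the limit problem (`isSubsolution_relaxedLimsup`), with
`U + W ≥ 0` by construction. Comparison gives `U + W ≤ 0` off the boundary vertices. Hence `U = -W`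
is continuous there, and compactness turns this equality into uniform convergence.

Comparison (`NetSub.add_nonpos`) studies a maximum point of `U + W + κ|x|` and lets `κ → 0`.

At `O`, let `P` be the upper limit of the difference quotients of `U` along an edge. If `a_i(O) >
0`, the difference quotients of `U` converge to `P`, and the term `κ|x|` separates the slopes of `U`
from those of `-W`. If `a_i(O) = 0`, the equation persists at `O` for limiting slopes, and
coercivity of `H_i` gives two slopes above `P` at which the equations for `U` and for `W` fail
strictly (`exists_separating_slopes`). Only the Kirchhoff inequalities can then hold at these
slopes, and strict monotonicity of `F` makes them incompatible.

At an interior point, variables are doubled and the one-dimensional theorem on sums is applied. It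
is proved here from Alexandrov's theorem, which in dimension one is differentiability of monotone
functions, and from Jensen's lemma in the plane.

At a boundary vertex, a barrier shows that `U ≤ h_i`. If `W ≤ -h_i` there as well, nothing is left
to prove. Otherwise `W` satisfies the equation up to the vertex, and Soner's shifted penalization
keeps the point attached to `U` off the vertex (`le_of_isMax_vertex`). The shift needs values of `U`
at the vertex that are approached from inside the edge, so these are first replaced by upper limits.
This is why comparison omits the boundary vertices.

The continuous solution is `U` off the vertices, extended by its limits along the edges
(`exists_isSolution`). These limits exist because either `U` and `-W` both equal `h_i` at the
vertex, or coercivity prevents `U` from oscillating near it. -/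

/-! ### Second-order properties of convex and semiconvex functions -/

open MeasureTheory in
/-- A convex function on the line has a second-order Taylor expansion almost everywhere. -/
theorem ConvexOn.ae_exists_taylor_two {c : ℝ → ℝ} (hc : ConvexOn ℝ univ c) :
    ∀ᵐ x : ℝ, ∃ p D : ℝ, ∀ η > 0, ∀ᶠ h in 𝓝 (0 : ℝ),
      |c (x + h) - c x - p * h - D / 2 * h ^ 2| ≤ η * h ^ 2 := by
  set r : ℝ → ℝ := fun x => derivWithin c (Ioi x) x with hr
  -- Monotone functions are differentiable almost everywhere. At such a point, a first-order
  -- expansion of the right derivative integrates to a second-order expansion of `c`.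
  have hmono : Monotone r := by
    have := hc.monotoneOn_rightDeriv
    rw [interior_univ] at this
    exact fun x y hxy => this (mem_univ x) (mem_univ y) hxy
  have hder : ∀ x, HasDerivWithinAt c (r x) (Ioi x) x := fun x =>
    hc.hasDerivWithinAt_rightDeriv_of_mem_interior (by simp)
  have hcont : Continuous c := by
    rw [← continuousOn_univ]
    exact hc.continuousOn isOpen_univ
  filter_upwards [hmono.ae_differentiableAt] with x hx
  refine ⟨r x, deriv r x, fun η hη => ?_⟩
  have hlo := (hasDerivAt_iff_isLittleO_nhds_zero.1 hx.hasDerivAt).def hη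
  obtain ⟨δ, hδ, hball⟩ := Metric.eventually_nhds_iff.1 hlo
  set k : ℝ → ℝ := fun h => c (x + h) - c x - r x * h - deriv r x / 2 * h ^ 2 with hk
  have hkcont : Continuous k := by fun_prop
  have hkder : ∀ h, HasDerivWithinAt k (r (x + h) - r x - deriv r x * h) (Ici h) h := by
    intro h
    have h1 : HasDerivWithinAt (fun h => c (x + h)) (r (x + h)) (Ici h) h := by
      have h0 := (hder (x + h)).Ici_of_Ioi
      have := HasDerivWithinAt.comp (h := fun h => x + h) (h' := 1) (s := Ici h) h h0
        (((hasDerivAt_id h).const_add x).hasDerivWithinAt)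
        (fun y hy => by simpa using hy)
      rwa [mul_one] at this
    have h2 : HasDerivWithinAt (fun h => r x * h) (r x) (Ici h) h := by
      simpa using ((hasDerivAt_id h).const_mul (r x)).hasDerivWithinAt
    have h3 : HasDerivWithinAt (fun h : ℝ => deriv r x / 2 * h ^ 2) (deriv r x * h) (Ici h) h := by
      have := ((hasDerivAt_pow 2 h).const_mul (deriv r x / 2)).hasDerivWithinAt (s := Ici h)
      exact this.congr_deriv (by push_cast; ring)
    exact ((h1.sub_const (c x)).sub h2).sub h3
  have hb : ∀ h, |h| < δ → |r (x + h) - r x - deriv r x * h| ≤ η * |h| := by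
    intro h hh
    have := hball (y := h) (by simpa using hh)
    simpa [mul_comm] using this
  filter_upwards [Metric.ball_mem_nhds (0 : ℝ) hδ] with h hh
  have hh' : |h| < δ := by simpa using hh
  have hk0 : k 0 = 0 := by simp [hk]
  -- Mean value inequality on the segment between `0` and `h`: the right derivative of the remainder
  -- `k` is at most `η|h|` there, over a length `|h|`.
  have key : |k h| ≤ η * |h| * |h| := by
    rcases le_total 0 h with h0 | h0
    · have := norm_image_sub_le_of_norm_deriv_right_le_segment (f := k) (a := 0) (b := h)
        (C := η * |h|) hkcont.continuousOn (fun y _ => hkder y) (fun y hy => by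
          have hy' : |y| ≤ |h| := by rw [abs_of_nonneg hy.1, abs_of_nonneg h0]; exact hy.2.le
          exact (hb y (hy'.trans_lt hh')).trans (by gcongr)) h (right_mem_Icc.2 h0)
      rw [hk0, sub_zero, sub_zero, Real.norm_eq_abs] at this
      rwa [abs_of_nonneg h0] at this ⊢
    · have := norm_image_sub_le_of_norm_deriv_right_le_segment (f := k) (a := h) (b := 0)
        (C := η * |h|) hkcont.continuousOn (fun y _ => hkder y) (fun y hy => by
          have hy' : |y| ≤ |h| := by
            rw [abs_of_nonpos hy.2.le, abs_of_nonpos h0]; linarith [hy.1]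
          exact (hb y (hy'.trans_lt hh')).trans (by gcongr)) 0 (right_mem_Icc.2 h0)
      rw [hk0, zero_sub, norm_neg, Real.norm_eq_abs, zero_sub] at this
      rwa [abs_of_nonpos h0] at this ⊢
  calc |c (x + h) - c x - r x * h - deriv r x / 2 * h ^ 2| = |k h| := rfl
    _ ≤ η * |h| * |h| := key
    _ = η * h ^ 2 := by rw [mul_assoc, ← sq, sq_abs]

/-- The slope of an affine function supporting a semiconvex function from above is a Lipschitz
function of the contact point. -/
theorem slope_lipschitz_of_semiconvex {W : ℝ × ℝ → ℝ} {Λ : ℝ} (hΛ : 0 < Λ)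
    (hW : ∀ x y a b, -Λ * (a ^ 2 + b ^ 2) ≤ W (x + a, y + b) + W (x - a, y - b) - 2 * W (x, y))
    {z z' q q' : ℝ × ℝ}
    (hz : ∀ x, W x - q.1 * x.1 - q.2 * x.2 ≤ W z - q.1 * z.1 - q.2 * z.2)
    (hz' : ∀ x, W x - q'.1 * x.1 - q'.2 * x.2 ≤ W z' - q'.1 * z'.1 - q'.2 * z'.2) :
    dist q q' ≤ 8 * Λ * dist z z' := by
  -- Semiconvexity at `z` with increments `±(a, b)`: the point `z - (a, b)` is controlled by the
  -- maximality of `z`, and `z + (a, b)` by that of `z'`.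
  have key : ∀ a b : ℝ, (q.1 - q'.1) * a + (q.2 - q'.2) * b ≤
      Λ * (a ^ 2 + b ^ 2) + ((q.1 - q'.1) * (z'.1 - z.1) + (q.2 - q'.2) * (z'.2 - z.2)) := by
    intro a b
    have h1 := hW z.1 z.2 a b
    have h2 := hz (z.1 - a, z.2 - b)
    have h3 := hz' (z.1 + a, z.2 + b)
    have h4 := hz z'
    simp only [Prod.mk.eta] at h1 h2 h3 h4
    nlinarith
  set Q1 := q.1 - q'.1
  set Q2 := q.2 - q'.2
  set d1 := z'.1 - z.1
  set d2 := z'.2 - z.2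
  -- The optimal increment is `(q - q') / (2Λ)`. A further factor `2` is lost below because the
  -- product carries the sup norm.
  have h5 : Q1 ^ 2 + Q2 ^ 2 ≤ 4 * Λ * (Q1 * d1 + Q2 * d2) := by
    have h := key (Q1 / (2 * Λ)) (Q2 / (2 * Λ))
    have e1 : Q1 * (Q1 / (2 * Λ)) + Q2 * (Q2 / (2 * Λ)) = (Q1 ^ 2 + Q2 ^ 2) / (2 * Λ) := by
      field_simp
    have e2 : Λ * ((Q1 / (2 * Λ)) ^ 2 + (Q2 / (2 * Λ)) ^ 2) = (Q1 ^ 2 + Q2 ^ 2) / (4 * Λ) := by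
      field_simp; ring
    rw [e1, e2] at h
    have e3 : (Q1 ^ 2 + Q2 ^ 2) / (2 * Λ) = 2 * ((Q1 ^ 2 + Q2 ^ 2) / (4 * Λ)) := by
      field_simp; ring
    have e4 : (Q1 ^ 2 + Q2 ^ 2) / (4 * Λ) ≤ Q1 * d1 + Q2 * d2 := by linarith
    rw [div_le_iff₀ (by positivity)] at e4
    linarith
  rw [Prod.dist_eq, Prod.dist_eq, Real.dist_eq, Real.dist_eq, Real.dist_eq, Real.dist_eq]
  set m := max |z.1 - z'.1| |z.2 - z'.2|
  have hd1 : |d1| ≤ m := by rw [abs_sub_comm]; exact le_max_left _ _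
  have hd2 : |d2| ≤ m := by rw [abs_sub_comm]; exact le_max_right _ _
  have hm : 0 ≤ m := (abs_nonneg _).trans hd1
  set M := max |Q1| |Q2| with hM
  have hQ1 : |Q1| ≤ M := le_max_left _ _
  have hQ2 : |Q2| ≤ M := le_max_right _ _
  have hM0 : 0 ≤ M := (abs_nonneg _).trans hQ1
  have h6 : M ^ 2 ≤ Q1 ^ 2 + Q2 ^ 2 := by
    rcases max_choice |Q1| |Q2| with h | h <;> rw [hM, h, sq_abs] <;> nlinarith
  have h7 : Q1 * d1 ≤ M * m := (le_abs_self _).trans (by rw [abs_mul]; gcongr)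
  have h8 : Q2 * d2 ≤ M * m := (le_abs_self _).trans (by rw [abs_mul]; gcongr)
  have h9 : M * M ≤ M * (8 * Λ * m) := by nlinarith
  rcases hM0.eq_or_lt with h | h
  · rw [← h]; positivity
  · exact le_of_mul_le_mul_left h9 h

open MeasureTheory in
/-- Jensen's lemma in the plane: near a strict maximum point of a semiconvex function, the maximum
points of its small affine perturbations meet every set of full measure. -/
theorem exists_mem_isMax_sub_affine {W : ℝ × ℝ → ℝ} {Λ μ r : ℝ} (hΛ : 0 < Λ) (hμ : 0 < μ)
    (hr : 0 < r) (hcont : Continuous W)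
    (hW : ∀ x y a b, -Λ * (a ^ 2 + b ^ 2) ≤ W (x + a, y + b) + W (x - a, y - b) - 2 * W (x, y))
    (hmax : ∀ x y, W (x, y) ≤ W (0, 0) - μ * (x ^ 2 + y ^ 2))
    {E : Set (ℝ × ℝ)} (hE : volume Eᶜ = 0) :
    ∃ x y q₁ q₂, (x, y) ∈ E ∧ |q₁| ≤ r ∧ |q₂| ≤ r ∧ |x| ≤ 2 * r / μ ∧ |y| ≤ 2 * r / μ ∧
      ∀ x' y', W (x', y') - q₁ * x' - q₂ * y' ≤ W (x, y) - q₁ * x - q₂ * y := by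
  -- Beyond distance `2r/μ` the gain `r(|x| + |y|)` of the linear perturbation is at most the loss
  -- `μ(x² + y²)`, so maximizing over the compact ball is maximizing globally.
  have hex : ∀ q : ℝ × ℝ, q ∈ Metric.closedBall (0 : ℝ × ℝ) r →
      ∃ z ∈ Metric.closedBall (0 : ℝ × ℝ) (2 * r / μ),
      ∀ x, W x - q.1 * x.1 - q.2 * x.2 ≤ W z - q.1 * z.1 - q.2 * z.2 := by
    intro q hq
    have hq1 : |q.1| ≤ r := (norm_fst_le q).trans (by simpa using hq)
    have hq2 : |q.2| ≤ r := (norm_snd_le q).trans (by simpa using hq)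
    have h0 : (0 : ℝ × ℝ) ∈ Metric.closedBall (0 : ℝ × ℝ) (2 * r / μ) :=
      Metric.mem_closedBall_self (by positivity)
    obtain ⟨z, hz, hzmax⟩ := (isCompact_closedBall (0 : ℝ × ℝ) (2 * r / μ)).exists_isMaxOn ⟨0, h0⟩
      (f := fun x => W x - q.1 * x.1 - q.2 * x.2) (by fun_prop)
    refine ⟨z, hz, fun x => ?_⟩
    by_cases hx : x ∈ Metric.closedBall (0 : ℝ × ℝ) (2 * r / μ)
    · exact hzmax hx
    · have hz0 := hzmax h0
      refine le_trans ?_ hz0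
      have hm := hmax x.1 x.2
      simp only [Prod.mk.eta, Prod.fst_zero, Prod.snd_zero, mul_zero, sub_zero] at hm ⊢
      change W x ≤ W 0 - _ at hm
      have hx' : 2 * r / μ < max |x.1| |x.2| := by
        have : 2 * r / μ < ‖x‖ := by simpa using hx
        simpa [Prod.norm_def] using this
      have b1 : -(q.1 * x.1) ≤ r * |x.1| := (neg_le_abs _).trans (by rw [abs_mul]; gcongr)
      have b2 : -(q.2 * x.2) ≤ r * |x.2| := (neg_le_abs _).trans (by rw [abs_mul]; gcongr)
      have s1 := sq_abs x.1
      have s2 := sq_abs x.2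
      have aux : ∀ s t : ℝ, 0 ≤ t → 2 * r / μ < s →
          r * s + r * t ≤ μ * (s ^ 2 + t ^ 2) := by
        intro s t ht hs
        rw [div_lt_iff₀ hμ] at hs
        have hs0 : 0 < s := by nlinarith
        rcases le_total s t with hst | hst
        · have h1 : 0 ≤ t * (t * μ - 2 * r) := mul_nonneg ht (by nlinarith)
          have h2 : 0 ≤ μ * s ^ 2 := by positivity
          nlinarith
        · have h1 : 0 ≤ s * (s * μ - 2 * r) := mul_nonneg hs0.le (by linarith)
          have h2 : 0 ≤ μ * t ^ 2 := by positivity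
          nlinarith
      rcases lt_max_iff.1 hx' with h | h
      · have := aux |x.1| |x.2| (abs_nonneg _) h
        nlinarith
      · have := aux |x.2| |x.1| (abs_nonneg _) h
        nlinarith
  -- Otherwise all the chosen maximizers lie in the null set `Eᶜ`. The slope is a Lipschitz function
  -- of the maximizer, so the whole ball of slopes would be a Lipschitz image of a null set.
  -- Two-dimensional Hausdorff measure is Lebesgue measure here, so the ball would be null.
  by_contra hcon
  push Not at hcon
  choose! Z hZball hZ using hex
  set B := Metric.closedBall (0 : ℝ × ℝ) r
  set K := Z '' B
  have hKE : K ⊆ Eᶜ := by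
    rintro _ ⟨q, hq, rfl⟩ hmem
    have hqr : ‖q‖ ≤ r := mem_closedBall_zero_iff.1 hq
    have hq1 : |q.1| ≤ r := (norm_fst_le q).trans hqr
    have hq2 : |q.2| ≤ r := (norm_snd_le q).trans hqr
    have hz : ‖Z q‖ ≤ 2 * r / μ := by simpa using hZball q hq
    obtain ⟨x', y', h⟩ := hcon (Z q).1 (Z q).2 q.1 q.2 hmem hq1 hq2
      ((norm_fst_le _).trans hz) ((norm_snd_le _).trans hz)
    have := hZ q hq (x', y')
    simp only at this
    linarith
  have hK0 : volume K = 0 := measure_mono_null hKE hE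
  have hinv : ∀ z ∈ K, ∃ q ∈ B, Z q = z := fun z hz => hz
  choose! g hgB hg using hinv
  have hgL : LipschitzOnWith (Real.toNNReal (8 * Λ)) g K := by
    refine LipschitzOnWith.of_dist_le_mul fun z hz z' hz' => ?_
    rw [Real.coe_toNNReal _ (by positivity)]
    refine slope_lipschitz_of_semiconvex hΛ hW ?_ ?_
    · simpa only [hg z hz] using hZ (g z) (hgB z hz)
    · simpa only [hg z' hz'] using hZ (g z') (hgB z' hz')
  have hgK : g '' K = B := by
    apply subset_antisymm
    · rintro _ ⟨z, hz, rfl⟩; exact hgB z hz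
    · intro q hq
      refine ⟨Z q, ⟨q, hq, rfl⟩, ?_⟩
      have hmem : Z q ∈ K := ⟨q, hq, rfl⟩
      have := slope_lipschitz_of_semiconvex hΛ hW (hZ (g (Z q)) (hgB _ hmem)) (hZ q hq)
      rw [hg _ hmem, dist_self, mul_zero] at this
      exact dist_le_zero.1 this
  have h1 := hgL.hausdorffMeasure_image_le (d := 2) (by norm_num)
  rw [hausdorffMeasure_prod_real, hK0, mul_zero, hgK] at h1
  have h2 : 0 < volume B :=
    (Metric.measure_ball_pos volume (0 : ℝ × ℝ) hr).trans_le
      (measure_mono Metric.ball_subset_closedBall)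
  exact absurd h1 (not_le.2 h2)

/-! ### Sup-convolutions and the theorem on sums in dimension one -/

/-- The sup-convolution `x ↦ sup_{z ∈ S} (u z - A (x - z)²)`. -/
noncomputable def supConv (S : Set ℝ) (u : ℝ → ℝ) (A x : ℝ) : ℝ :=
  sSup ((fun z => u z - A * (x - z) ^ 2) '' S)

section SupConv

variable {S : Set ℝ} {u : ℝ → ℝ} {A : ℝ}

theorem isGreatest_supConv (hS : IsCompact S) (hne : S.Nonempty) (hu : UpperSemicontinuousOn u S)
    (A x : ℝ) : IsGreatest ((fun z => u z - A * (x - z) ^ 2) '' S) (supConv S u A x) := by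
  have husc : UpperSemicontinuousOn (fun z => u z - A * (x - z) ^ 2) S := by
    simp only [sub_eq_add_neg]
    exact hu.add (Continuous.upperSemicontinuous (by fun_prop) |>.upperSemicontinuousOn S)
  obtain ⟨z, hz, hmax⟩ := husc.exists_isMaxOn hne hS
  have : IsGreatest ((fun z => u z - A * (x - z) ^ 2) '' S) (u z - A * (x - z) ^ 2) :=
    ⟨⟨z, hz, rfl⟩, by rintro _ ⟨w, hw, rfl⟩; exact hmax hw⟩
  rw [supConv, this.csSup_eq]
  exact this

theorem exists_supConv_eq (hS : IsCompact S) (hne : S.Nonempty) (hu : UpperSemicontinuousOn u S)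
    (A x : ℝ) : ∃ z ∈ S, supConv S u A x = u z - A * (x - z) ^ 2 := by
  obtain ⟨z, hz, h⟩ := (isGreatest_supConv hS hne hu A x).1
  exact ⟨z, hz, h.symm⟩

theorem le_supConv (hS : IsCompact S) (hu : UpperSemicontinuousOn u S)
    (A x : ℝ) {z : ℝ} (hz : z ∈ S) : u z - A * (x - z) ^ 2 ≤ supConv S u A x :=
  (isGreatest_supConv hS ⟨z, hz⟩ hu A x).2 ⟨z, hz, rfl⟩

/-- Expanding the square leaves a supremum of the functions `u z - A z² + 2 A x z`, which are affine
in `x`. -/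
theorem convexOn_supConv_add_sq (hS : IsCompact S) (hne : S.Nonempty)
    (hu : UpperSemicontinuousOn u S) (A : ℝ) :
    ConvexOn ℝ univ (fun x => supConv S u A x + A * x ^ 2) := by
  refine ⟨convex_univ, fun x _ y _ s t hs ht hst => ?_⟩
  simp only [smul_eq_mul]
  obtain ⟨z, hz, h⟩ := exists_supConv_eq hS hne hu A (s * x + t * y)
  have h1 := le_supConv hS hu A x hz
  have h2 := le_supConv hS hu A y hz
  rw [h]
  have h3 := mul_le_mul_of_nonneg_left h1 hs
  have h4 := mul_le_mul_of_nonneg_left h2 ht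
  have e : t = 1 - s := by linarith
  subst e
  nlinarith

theorem continuous_supConv (hS : IsCompact S) (hne : S.Nonempty)
    (hu : UpperSemicontinuousOn u S) (A : ℝ) : Continuous (supConv S u A) := by
  have h := (convexOn_supConv_add_sq hS hne hu A).continuousOn isOpen_univ
  rw [continuousOn_univ] at h
  have : supConv S u A = fun x => (supConv S u A x + A * x ^ 2) - A * x ^ 2 := by
    ext x; ring
  rw [this]
  fun_prop

/-- A point optimal for `x` is admissible for `x ± a`. -/
theorem supConv_semiconvex (hS : IsCompact S) (hne : S.Nonempty)
    (hu : UpperSemicontinuousOn u S) (A x a : ℝ) :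
    -(2 * A * a ^ 2) ≤ supConv S u A (x + a) + supConv S u A (x - a) - 2 * supConv S u A x := by
  obtain ⟨z, hz, h⟩ := exists_supConv_eq hS hne hu A x
  have h1 := le_supConv hS hu A (x + a) hz
  have h2 := le_supConv hS hu A (x - a) hz
  rw [h]
  nlinarith

open MeasureTheory in
theorem ae_exists_taylor_two_supConv (hS : IsCompact S) (hne : S.Nonempty)
    (hu : UpperSemicontinuousOn u S) (A : ℝ) :
    ∀ᵐ x : ℝ, ∃ p D : ℝ, ∀ η > 0, ∀ᶠ h in 𝓝 (0 : ℝ),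
      |supConv S u A (x + h) - supConv S u A x - p * h - D / 2 * h ^ 2| ≤ η * h ^ 2 := by
  filter_upwards [(convexOn_supConv_add_sq hS hne hu A).ae_exists_taylor_two] with x hx
  obtain ⟨p, D, h⟩ := hx
  refine ⟨p - 2 * A * x, D - 2 * A, fun η hη => ?_⟩
  filter_upwards [h η hη] with k hk
  convert hk using 2
  ring

end SupConv

/-- First- and second-order conditions at a maximum point of a function that is known only through a
second-order expansion at that point. -/
theorem eq_zero_and_nonpos_of_quadratic_le {α γ : ℝ}
    (h : ∀ η > 0, ∀ᶠ t in 𝓝 (0 : ℝ), α * t + γ * t ^ 2 ≤ η * t ^ 2) : α = 0 ∧ γ ≤ 0 := by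
  have hα : α = 0 := by
    by_contra hne
    have h1 := h 1 one_pos
    -- With `t = α s` the linear term becomes `α² s`, which is positive and dominates as `s → 0⁺`.
    have h2 : ∀ᶠ s in 𝓝[>] (0 : ℝ), α * (α * s) + γ * (α * s) ^ 2 ≤ 1 * (α * s) ^ 2 := by
      have : Tendsto (fun s : ℝ => α * s) (𝓝[>] 0) (𝓝 0) := by
        have : Tendsto (fun s : ℝ => α * s) (𝓝 0) (𝓝 (α * 0)) := by
          apply Continuous.tendsto; fun_prop
        rw [mul_zero] at this
        exact this.mono_left nhdsWithin_le_nhds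
      exact this.eventually h1
    have h3 : ∀ᶠ s in 𝓝[>] (0 : ℝ), 1 + (γ - 1) * s ≤ 0 := by
      filter_upwards [h2, self_mem_nhdsWithin] with s hs hs0
      have hs0 : 0 < s := hs0
      have hα2 : 0 < α ^ 2 := by positivity
      by_contra hc
      push Not at hc
      have : 0 < α ^ 2 * s * (1 + (γ - 1) * s) := by positivity
      nlinarith
    have h4 : Tendsto (fun s : ℝ => 1 + (γ - 1) * s) (𝓝[>] 0) (𝓝 (1 + (γ - 1) * 0)) := by
      have : Continuous (fun s : ℝ => 1 + (γ - 1) * s) := by fun_prop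
      exact (this.tendsto 0).mono_left nhdsWithin_le_nhds
    have := le_of_tendsto h4 h3
    linarith
  refine ⟨hα, ?_⟩
  subst hα
  refine le_of_forall_pos_le_add fun η hη => ?_
  have h1 := (h η hη).filter_mono (nhdsWithin_le_nhds (s := Ioi 0))
  obtain ⟨t, ht, ht0⟩ := (h1.and self_mem_nhdsWithin).exists
  have ht0 : 0 < t := ht0
  have : 0 < t ^ 2 := by positivity
  nlinarith

/-- A second-order expansion of the sup-convolution yields a second-order superjet of the
function at a nearby point. -/
theorem exists_jet_of_supConv {S : Set ℝ} {u : ℝ → ℝ} {A η x p X d ρ P : ℝ} (hA0 : 0 < A)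
    (hη : 0 < η) (hr2 : P / (2 * A) + ρ < η) (hr3 : A * (P / (2 * A)) ^ 2 < η / 2)
    (hS : IsCompact S) (hS0 : (0 : ℝ) ∈ S)
    (hu : UpperSemicontinuousOn u S) (hu0 : supConv S u A 0 = 0) (hx : |x| ≤ ρ) (hρd : ρ < d)
    (hd : ∀ ⦃x⦄, dist x 0 < d → dist (supConv S u A x) (supConv S u A 0) < η / 2)
    (hp : |p| ≤ P)
    (hX : ∀ η > 0, ∀ᶠ h in 𝓝 (0 : ℝ),
      |supConv S u A (x + h) - supConv S u A x - p * h - X / 2 * h ^ 2| ≤ η * h ^ 2) :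
    ∃ z ∈ S, |z| < η ∧ |u z| < η ∧
      ∀ᶠ s in 𝓝[S] z, u s ≤ u z + p * (s - z) + (X + η / 2) / 2 * (s - z) ^ 2 := by
  obtain ⟨z, hz, hzx⟩ := exists_supConv_eq hS ⟨0, hS0⟩ hu A x
  -- With `z` frozen, the parabola `u z - A(· - z)²` touches the sup-convolution from below at `x`,
  -- so the slopes agree. This locates `z` at distance `|p| / (2A)` from `x`.
  have hpz : p + 2 * A * (x - z) = 0 := by
    have h := eq_zero_and_nonpos_of_quadratic_le
      (α := -(p + 2 * A * (x - z))) (γ := - (X / 2) - A) ?_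
    · linarith [h.1]
    · intro e he
      filter_upwards [hX e he] with h hh
      have h1 := le_supConv hS hu A (x + h) hz
      have h2 := (abs_le.1 hh).2
      rw [hzx] at h2
      linarith
  have hzx' : z - x = p / (2 * A) := by
    field_simp; linarith
  have hzx2 : |z - x| ≤ P / (2 * A) := by
    rw [hzx', abs_div, abs_of_pos (by positivity : 0 < 2 * A)]
    gcongr
  refine ⟨z, hz, ?_, ?_, ?_⟩
  · calc |z| = |(z - x) + x| := by ring_nf
      _ ≤ |z - x| + |x| := abs_add_le _ _
      _ < η := by linarith
  · have h1 : |supConv S u A x| < η / 2 := by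
      have := hd (x := x) (by rw [Real.dist_0_eq_abs]; linarith)
      rwa [hu0, Real.dist_0_eq_abs] at this
    have h2 : u z = supConv S u A x + A * (z - x) ^ 2 := by rw [hzx]; ring
    have h3 : A * (z - x) ^ 2 < η / 2 := by
      refine lt_of_le_of_lt ?_ hr3
      rw [← sq_abs]
      gcongr
    have h4 : 0 ≤ A * (z - x) ^ 2 := by positivity
    rw [h2, abs_lt]
    constructor
    · linarith [(abs_lt.1 h1).1]
    · linarith [(abs_lt.1 h1).2]
  · have hlim : Tendsto (fun s : ℝ => s - z) (𝓝[S] z) (𝓝 0) := by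
      have : Tendsto (fun s : ℝ => s - z) (𝓝 z) (𝓝 (z - z)) := by
        apply Continuous.tendsto; fun_prop
      rw [sub_self] at this
      exact this.mono_left nhdsWithin_le_nhds
    filter_upwards [hlim.eventually (hX (η / 4) (by positivity)), self_mem_nhdsWithin] with s h1 hs
    -- Moving `x` together with `s` keeps the penalty `A(x - z)²` fixed, so the expansion of the
    -- sup-convolution at `x` bounds `u` near `z` with the same coefficients.
    have h2 := le_supConv hS hu A (x + (s - z)) hs
    have h3 := (abs_le.1 h1).2
    have h4 : x + (s - z) - s = x - z := by ring
    rw [h4] at h2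
    rw [hzx] at h3
    linarith

open MeasureTheory in
/-- The theorem on sums in dimension one, normalized at the origin. -/
theorem exists_jets_of_le_sq {S T : Set ℝ} {u w : ℝ → ℝ} {β : ℝ} (hβ : 0 < β)
    (hS : IsCompact S) (hT : IsCompact T) (hS0 : (0 : ℝ) ∈ S) (hT0 : (0 : ℝ) ∈ T)
    (hu : UpperSemicontinuousOn u S) (hw : UpperSemicontinuousOn w T)
    (hu0 : u 0 = 0) (hw0 : w 0 = 0)
    (hle : ∀ x ∈ S, ∀ y ∈ T, u x + w y ≤ (x - y) ^ 2 / (2 * β)) {η : ℝ} (hη : 0 < η) :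
    ∃ x ∈ S, ∃ y ∈ T, ∃ p q X Y : ℝ, |x| < η ∧ |y| < η ∧ |u x| < η ∧ |w y| < η ∧
      |p| < η ∧ |q| < η ∧
      (∀ᶠ s in 𝓝[S] x, u s ≤ u x + p * (s - x) + X / 2 * (s - x) ^ 2) ∧
      (∀ᶠ s in 𝓝[T] y, w s ≤ w y + q * (s - y) + Y / 2 * (s - y) ^ 2) ∧
      ∀ ξ ζ : ℝ, X * ξ ^ 2 + Y * ζ ^ 2 ≤ 2 / β * (ξ - ζ) ^ 2 + η * (ξ ^ 2 + ζ ^ 2) := by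
  -- With this parameter, sup-convolution in each variable turns the bound `A/4 (x - y)²` into
  -- exactly twice itself, and the second derivative of `A/2 (x - y)²` is the `2/β` of the
  -- conclusion.
  set A : ℝ := 2 / β with hA
  have hA0 : 0 < A := by positivity
  set f := supConv S u A with hf
  set g := supConv T w A with hg
  have hfc : Continuous f := continuous_supConv hS ⟨0, hS0⟩ hu A
  have hgc : Continuous g := continuous_supConv hT ⟨0, hT0⟩ hw A
  have hfg : ∀ x y, f x + g y ≤ A / 2 * (x - y) ^ 2 := by
    intro x y
    obtain ⟨z, hz, h1⟩ := exists_supConv_eq hS ⟨0, hS0⟩ hu A x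
    obtain ⟨z', hz', h2⟩ := exists_supConv_eq hT ⟨0, hT0⟩ hw A y
    have h3 := hle z hz z' hz'
    have e : (z - z') ^ 2 / (2 * β) = A / 4 * (z - z') ^ 2 := by rw [hA]; field_simp; ring
    rw [hf, hg, h1, h2]
    rw [e] at h3
    nlinarith [mul_nonneg hA0.le (sq_nonneg ((z - z') + 2 * (x - z - (y - z')))),
      mul_nonneg hA0.le (sq_nonneg ((x - z) + (y - z')))]
  have hf0' : 0 ≤ f 0 := by
    have := le_supConv hS hu A 0 hS0
    simpa [hu0] using this
  have hg0' : 0 ≤ g 0 := by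
    have := le_supConv hT hw A 0 hT0
    simpa [hw0] using this
  have hfg0 : f 0 + g 0 ≤ 0 := by simpa using hfg 0 0
  have hf0 : f 0 = 0 := by linarith
  have hg0 : g 0 = 0 := by linarith
  set μ : ℝ := η / 8 with hμdef
  have hμ : 0 < μ := by positivity
  -- The term in `μ` makes the maximum at the origin strict, as Jensen's lemma requires. Its second
  -- derivative `2μ = η/4` and the `η/2` added to each of `X` and `Y` when passing to jets stay
  -- within the error `η`.
  set W : ℝ × ℝ → ℝ := fun z => f z.1 + g z.2 - A / 2 * (z.1 - z.2) ^ 2 -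
    μ * (z.1 ^ 2 + z.2 ^ 2) with hW
  have hWc : Continuous W := by fun_prop
  have hsemi : ∀ x y a b, -(6 * A + 2 * μ) * (a ^ 2 + b ^ 2) ≤
      W (x + a, y + b) + W (x - a, y - b) - 2 * W (x, y) := by
    intro x y a b
    have h1 := supConv_semiconvex hS ⟨0, hS0⟩ hu A x a
    have h2 := supConv_semiconvex hT ⟨0, hT0⟩ hw A y b
    rw [← hf] at h1
    rw [← hg] at h2
    simp only [hW]
    nlinarith [mul_nonneg hA0.le (sq_nonneg (a + b)), mul_nonneg hA0.le (sq_nonneg a),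
      mul_nonneg hA0.le (sq_nonneg b)]
  have hWmax : ∀ x y, W (x, y) ≤ W (0, 0) - μ * (x ^ 2 + y ^ 2) := by
    intro x y
    have := hfg x y
    simp only [hW, hf0, hg0]
    linarith
  -- choice of the size of the perturbation
  obtain ⟨d, hd, hfd⟩ := Metric.continuousAt_iff.1 hfc.continuousAt (η / 2) (half_pos hη)
  obtain ⟨d', hd', hgd⟩ := Metric.continuousAt_iff.1 hgc.continuousAt (η / 2) (half_pos hη)
  have hev : ∀ᶠ r in 𝓝[>] (0 : ℝ),
      (2 * A + 2 * μ) * (2 * r / μ) + r < η ∧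
      ((2 * A + 2 * μ) * (2 * r / μ) + r) / (2 * A) + 2 * r / μ < η ∧
      A * (((2 * A + 2 * μ) * (2 * r / μ) + r) / (2 * A)) ^ 2 < η / 2 ∧
      2 * r / μ < d ∧ 2 * r / μ < d' := by
    have aux : ∀ F : ℝ → ℝ, Continuous F → ∀ c, F 0 < c → ∀ᶠ r in 𝓝[>] (0 : ℝ), F r < c :=
      fun F hF c hc => ((hF.tendsto 0).mono_left nhdsWithin_le_nhds).eventually_lt_const hc
    refine (aux _ (by fun_prop) _ (by simpa)).and ((aux _ (by fun_prop) _ (by simpa)).and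
      ((aux _ (by fun_prop) _ (by simpa)).and ((aux _ (by fun_prop) _ (by simpa)).and
      (aux _ (by fun_prop) _ (by simpa)))))
  obtain ⟨r, ⟨hr1, hr2, hr3, hr4, hr5⟩, hr0⟩ := (hev.and self_mem_nhdsWithin).exists
  have hr0 : 0 < r := hr0
  set ρ := 2 * r / μ with hρ
  set Ef := {x : ℝ | ∃ p D : ℝ, ∀ η > 0, ∀ᶠ h in 𝓝 (0 : ℝ),
      |f (x + h) - f x - p * h - D / 2 * h ^ 2| ≤ η * h ^ 2} with hEf
  set Eg := {x : ℝ | ∃ p D : ℝ, ∀ η > 0, ∀ᶠ h in 𝓝 (0 : ℝ),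
      |g (x + h) - g x - p * h - D / 2 * h ^ 2| ≤ η * h ^ 2} with hEg
  have hEf0 : volume Efᶜ = 0 := ae_exists_taylor_two_supConv hS ⟨0, hS0⟩ hu A
  have hEg0 : volume Egᶜ = 0 := ae_exists_taylor_two_supConv hT ⟨0, hT0⟩ hw A
  have hE : volume (Ef ×ˢ Eg)ᶜ = 0 := by
    rw [compl_prod_eq_union, measure_union_null_iff, Measure.volume_eq_prod, Measure.prod_prod,
      Measure.prod_prod, hEf0, hEg0]
    simp
  obtain ⟨x, y, q₁, q₂, ⟨hxE, hyE⟩, hq₁, hq₂, hx, hy, hmax⟩ :=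
    exists_mem_isMax_sub_affine (by positivity) hμ hr0 hWc hsemi hWmax hE
  obtain ⟨p, X, hpX⟩ := hxE
  obtain ⟨q, Y, hqY⟩ := hyE
  -- First- and second-order conditions at the perturbed maximum point along the line of direction
  -- `(ξ, ζ)`.
  have hquad : ∀ ξ ζ : ℝ,
      p * ξ + q * ζ = A * (x - y) * (ξ - ζ) + 2 * μ * (x * ξ + y * ζ) + q₁ * ξ + q₂ * ζ ∧
      X * ξ ^ 2 + Y * ζ ^ 2 ≤ A * (ξ - ζ) ^ 2 + 2 * μ * (ξ ^ 2 + ζ ^ 2) := by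
    intro ξ ζ
    have h := eq_zero_and_nonpos_of_quadratic_le
      (α := p * ξ + q * ζ - (A * (x - y) * (ξ - ζ) + 2 * μ * (x * ξ + y * ζ) + q₁ * ξ + q₂ * ζ))
      (γ := 1 / 2 * (X * ξ ^ 2 + Y * ζ ^ 2) - A / 2 * (ξ - ζ) ^ 2 - μ * (ξ ^ 2 + ζ ^ 2)) ?_
    · constructor
      · linarith [h.1]
      · linarith [h.2]
    · intro e he
      have hlim : ∀ c : ℝ, Tendsto (fun t : ℝ => t * c) (𝓝 0) (𝓝 0) := by
        intro c
        have : Tendsto (fun t : ℝ => t * c) (𝓝 0) (𝓝 (0 * c)) := by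
          apply Continuous.tendsto; fun_prop
        rwa [zero_mul] at this
      set e' := e / (ξ ^ 2 + ζ ^ 2 + 1)
      have he' : 0 < e' := by positivity
      filter_upwards [(hlim ξ).eventually (hpX e' he'), (hlim ζ).eventually (hqY e' he')]
        with t h1 h2
      have h3 := hmax (x + t * ξ) (y + t * ζ)
      simp only [hW] at h3
      have h4 := (abs_le.1 h1).1
      have h5 := (abs_le.1 h2).1
      have h6 : e' * (ξ ^ 2 + ζ ^ 2 + 1) = e := by
        simp only [e']; field_simp
      have h7 : e' * (t * ξ) ^ 2 + e' * (t * ζ) ^ 2 ≤ e * t ^ 2 := by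
        have h8 : 0 ≤ e' * t ^ 2 := by positivity
        calc e' * (t * ξ) ^ 2 + e' * (t * ζ) ^ 2
            = e' * (ξ ^ 2 + ζ ^ 2 + 1) * t ^ 2 - e' * t ^ 2 := by ring
          _ ≤ e * t ^ 2 := by rw [h6]; linarith
      linarith
  have hp := (hquad 1 0).1
  have hq := (hquad 0 1).1
  simp only [mul_one, mul_zero, add_zero, zero_add, sub_zero, zero_sub, mul_neg] at hp hq
  have hxy : |x - y| ≤ 2 * ρ := (abs_sub _ _).trans (by linarith)
  have hbound : ∀ a b c d : ℝ, |a| ≤ 2 * ρ → |b| ≤ ρ → |c| ≤ r → d = A * a + 2 * μ * b + c →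
      |d| ≤ (2 * A + 2 * μ) * ρ + r := by
    intro a b c d ha hb hc hd
    rw [hd]
    calc |A * a + 2 * μ * b + c| ≤ |A * a| + |2 * μ * b| + |c| := abs_add_three _ _ _
      _ = A * |a| + 2 * μ * |b| + |c| := by
        rw [abs_mul, abs_mul, abs_of_pos hA0, abs_of_pos (by positivity : 0 < 2 * μ)]
      _ ≤ A * (2 * ρ) + 2 * μ * ρ + r := by gcongr
      _ = _ := by ring
  have hpb := hbound (x - y) x q₁ p hxy hx hq₁ hp
  have hqb := hbound (-(x - y)) y q₂ q (by rwa [abs_neg]) hy hq₂ (by linarith)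
  obtain ⟨z, hzS, hz1, hz2, hz3⟩ :=
    exists_jet_of_supConv hA0 hη hr2 hr3 hS hS0 hu hf0 hx hr4 hfd hpb hpX
  obtain ⟨z', hzT, hz1', hz2', hz3'⟩ :=
    exists_jet_of_supConv hA0 hη hr2 hr3 hT hT0 hw hg0 hy hr5 hgd hqb hqY
  refine ⟨z, hzS, z', hzT, p, q, X + η / 2, Y + η / 2, hz1, hz1', hz2, hz2',
    hpb.trans_lt hr1, hqb.trans_lt hr1, hz3, hz3', fun ξ ζ => ?_⟩
  have h1 := (hquad ξ ζ).2
  have h2 : 2 * μ = η / 4 := by rw [hμdef]; ring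
  rw [h2] at h1
  nlinarith [sq_nonneg ξ, sq_nonneg ζ]

/-- The theorem on sums in dimension one for the penalization `(x - y + τ)² / (2β)`. -/
theorem exists_jets_of_isMax {S T : Set ℝ} {u w : ℝ → ℝ} {β τ x₀ y₀ : ℝ} (hβ : 0 < β)
    (hS : IsCompact S) (hT : IsCompact T) (hx₀ : x₀ ∈ S) (hy₀ : y₀ ∈ T)
    (hu : UpperSemicontinuousOn u S) (hw : UpperSemicontinuousOn w T)
    (hle : ∀ x ∈ S, ∀ y ∈ T, u x + w y - (x - y + τ) ^ 2 / (2 * β) ≤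
      u x₀ + w y₀ - (x₀ - y₀ + τ) ^ 2 / (2 * β)) {η : ℝ} (hη : 0 < η) :
    ∃ x ∈ S, ∃ y ∈ T, ∃ p q X Y : ℝ, |x - x₀| < η ∧ |y - y₀| < η ∧ |u x - u x₀| < η ∧
      |w y - w y₀| < η ∧ |p - (x₀ - y₀ + τ) / β| < η ∧ |q + (x₀ - y₀ + τ) / β| < η ∧
      (∀ᶠ s in 𝓝[S] x, u s ≤ u x + p * (s - x) + X / 2 * (s - x) ^ 2) ∧
      (∀ᶠ s in 𝓝[T] y, w s ≤ w y + q * (s - y) + Y / 2 * (s - y) ^ 2) ∧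
      ∀ ξ ζ : ℝ, X * ξ ^ 2 + Y * ζ ^ 2 ≤ 2 / β * (ξ - ζ) ^ 2 + η * (ξ ^ 2 + ζ ^ 2) := by
  set P := (x₀ - y₀ + τ) / β with hP
  -- work in coordinates centred at the maximum point, after subtracting affine functions
  have hcomp : ∀ (S : Set ℝ) (u : ℝ → ℝ) (x₀ P : ℝ), UpperSemicontinuousOn u S →
      UpperSemicontinuousOn (fun h => u (x₀ + h) - u x₀ - P * h) ((fun h => x₀ + h) ⁻¹' S) := by
    intro S u x₀ P hu
    have h1 : UpperSemicontinuousOn (fun h => u (x₀ + h)) ((fun h => x₀ + h) ⁻¹' S) :=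
      hu.comp (g := fun h => x₀ + h) (by fun_prop) (fun x hx => hx)
    have h2 : UpperSemicontinuousOn (fun h => - u x₀ - P * h) ((fun h => x₀ + h) ⁻¹' S) :=
      (Continuous.upperSemicontinuous (by fun_prop)).upperSemicontinuousOn _
    have e : (fun h => u (x₀ + h) - u x₀ - P * h) = fun h => u (x₀ + h) + (-u x₀ - P * h) := by
      ext h; ring
    rw [e]
    exact h1.add h2
  have hcpt : ∀ (S : Set ℝ) (x₀ : ℝ), IsCompact S → IsCompact ((fun h => x₀ + h) ⁻¹' S) :=
    fun S x₀ hS => (Homeomorph.addLeft x₀).isCompact_preimage.2 hS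
  have hev : ∀ (S : Set ℝ) (u : ℝ → ℝ) (x₀ P x p X : ℝ),
      (∀ᶠ s in 𝓝[(fun h => x₀ + h) ⁻¹' S] x, u (x₀ + s) - u x₀ - P * s ≤
        u (x₀ + x) - u x₀ - P * x + p * (s - x) + X / 2 * (s - x) ^ 2) →
      ∀ᶠ s in 𝓝[S] (x₀ + x), u s ≤
        u (x₀ + x) + (p + P) * (s - (x₀ + x)) + X / 2 * (s - (x₀ + x)) ^ 2 := by
    intro S u x₀ P x p X h
    have hlim : Tendsto (fun s => s - x₀) (𝓝[S] (x₀ + x)) (𝓝[(fun h => x₀ + h) ⁻¹' S] x) := by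
      refine tendsto_nhdsWithin_iff.2 ⟨?_, ?_⟩
      · have : Tendsto (fun s : ℝ => s - x₀) (𝓝 (x₀ + x)) (𝓝 (x₀ + x - x₀)) := by
          apply Continuous.tendsto; fun_prop
        rw [add_sub_cancel_left] at this
        exact this.mono_left nhdsWithin_le_nhds
      · filter_upwards [self_mem_nhdsWithin] with s hs
        simpa using hs
    filter_upwards [hlim.eventually h] with s hs
    rw [add_sub_cancel] at hs
    linarith
  obtain ⟨x, hx, y, hy, p, q, X, Y, h1, h2, h3, h4, h5, h6, h7, h8, h9⟩ :=
    exists_jets_of_le_sq (u := fun h => u (x₀ + h) - u x₀ - P * h)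
      (w := fun h => w (y₀ + h) - w y₀ - (-P) * h) hβ (hcpt S x₀ hS) (hcpt T y₀ hT)
      (by simpa) (by simpa) (hcomp S u x₀ P hu) (hcomp T w y₀ (-P) hw) (by simp) (by simp)
      (by
        intro x hx y hy
        have h := hle _ hx _ hy
        have e : (x₀ + x - (y₀ + y) + τ) ^ 2 / (2 * β) - (x₀ - y₀ + τ) ^ 2 / (2 * β) =
            (x - y) ^ 2 / (2 * β) + P * (x - y) := by
          rw [hP]; field_simp; ring
        linarith) (η := η / (2 + |P|)) (by positivity)
  -- Undoing the affine normalization changes values by `P` times a displacement; accuracy `η / (2 +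
  -- |P|)` absorbs this.
  have hle : η / (2 + |P|) ≤ η / 2 := by gcongr; linarith [abs_nonneg P]
  have hle2 : η / (2 + |P|) ≤ η := hle.trans (by linarith)
  have hle3 : η / (2 + |P|) + |P| * (η / (2 + |P|)) ≤ η := by
    have : η / (2 + |P|) * (2 + |P|) = η := by field_simp
    nlinarith [abs_nonneg P, div_pos hη (by positivity : 0 < 2 + |P|)]
  have haux : ∀ a x P' : ℝ, |P'| = |P| → |a - P' * x| < η / (2 + |P|) → |x| < η / (2 + |P|) →
      |a| < η := by
    intro a x P' hP' ha hx
    calc |a| = |(a - P' * x) + P' * x| := by ring_nf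
      _ ≤ |a - P' * x| + |P' * x| := abs_add_le _ _
      _ = |a - P' * x| + |P| * |x| := by rw [abs_mul, hP']
      _ < η / (2 + |P|) + |P| * |x| := by linarith
      _ ≤ η / (2 + |P|) + |P| * (η / (2 + |P|)) := by gcongr
      _ ≤ η := hle3
  refine ⟨x₀ + x, hx, y₀ + y, hy, p + P, q + -P, X, Y, ?_, ?_, ?_, ?_, ?_, ?_,
    hev _ _ _ _ _ _ _ h7, hev _ _ _ _ _ _ _ h8, fun ξ ζ => (h9 ξ ζ).trans ?_⟩
  · rw [add_sub_cancel_left]; linarith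
  · rw [add_sub_cancel_left]; linarith
  · exact haux _ x P rfl h3 h1
  · exact haux _ y (-P) (abs_neg P) h4 h2
  · rw [add_sub_cancel_right]; linarith
  · rw [neg_add_cancel_right]; linarith
  · gcongr

/-! ### Equations on a single edge -/

/-- Viscosity subsolutions of `λ U - a U'' + H(t, U') = 0` at the points of `S ⊆ ℝ`, tested with
quadratic polynomials. -/
def SubOn (lam : ℝ) (a : ℝ → ℝ) (H : ℝ → ℝ → ℝ) (U : ℝ → ℝ) (S : Set ℝ) : Prop :=
  ∀ t ∈ S, ∀ p X : ℝ, (∀ᶠ s in 𝓝 t, U s ≤ U t + p * (s - t) + X / 2 * (s - t) ^ 2) →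
    lam * U t - a t * X + H t p ≤ 0

/-- Regularity of the coefficients along an edge of length `ℓ`. -/
structure EdgeRegular (a : ℝ → ℝ) (H : ℝ → ℝ → ℝ) (ℓ C : ℝ) : Prop where
  nonneg : 0 ≤ C
  lip_x : ∀ s ∈ Icc 0 ℓ, ∀ t ∈ Icc 0 ℓ, ∀ p, |H s p - H t p| ≤ C * (1 + |p|) * |s - t|
  lip_p : ∀ t ∈ Icc 0 ℓ, ∀ p q, |H t p - H t q| ≤ C * |p - q|
  sq : ∃ σ : ℝ → ℝ, (∀ t ∈ Icc 0 ℓ, a t = σ t ^ 2) ∧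
    ∀ s ∈ Icc 0 ℓ, ∀ t ∈ Icc 0 ℓ, |σ s - σ t| ≤ C * |s - t|

namespace EdgeRegular

variable {a : ℝ → ℝ} {H : ℝ → ℝ → ℝ} {ℓ C : ℝ}

theorem a_nonneg (h : EdgeRegular a H ℓ C) {t : ℝ} (ht : t ∈ Icc 0 ℓ) : 0 ≤ a t := by
  obtain ⟨σ, hσ, -⟩ := h.sq
  rw [hσ t ht]; positivity

/-- Since `σ` is Lipschitz, the diffusion vanishes to second order at its zeros. A second derivative
of order `1/x` at distance `x` from a degenerate endpoint therefore contributes only `O(x)`. -/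
theorem a_le (h : EdgeRegular a H ℓ C) {s t : ℝ} (hs : s ∈ Icc 0 ℓ) (ht : t ∈ Icc 0 ℓ)
    (h0 : a t = 0) : a s ≤ C ^ 2 * (s - t) ^ 2 := by
  obtain ⟨σ, hσ, hL⟩ := h.sq
  rw [hσ t ht] at h0
  have h0 : σ t = 0 := by simpa using h0
  have h1 := hL s hs t ht
  rw [h0, sub_zero] at h1
  rw [hσ s hs, ← mul_pow, ← sq_abs (σ s), ← sq_abs (C * (s - t)), abs_mul, abs_of_nonneg h.nonneg]
  gcongr

theorem continuousOn_a (h : EdgeRegular a H ℓ C) : ContinuousOn a (Icc 0 ℓ) := by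
  obtain ⟨σ, hσ, hL⟩ := h.sq
  have : ContinuousOn σ (Icc 0 ℓ) := by
    have : LipschitzOnWith (Real.toNNReal C) σ (Icc 0 ℓ) :=
      LipschitzOnWith.of_dist_le_mul fun s hs t ht => by
        rw [Real.coe_toNNReal _ h.nonneg]; exact hL s hs t ht
    exact this.continuousOn
  exact (this.pow 2).congr hσ

theorem exists_a_le (h : EdgeRegular a H ℓ C) : ∃ A, 0 ≤ A ∧ ∀ t ∈ Icc 0 ℓ, a t ≤ A := by
  obtain ⟨A, hA⟩ := (isCompact_Icc (a := (0 : ℝ)) (b := ℓ)).exists_bound_of_continuousOn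
    h.continuousOn_a
  exact ⟨|A|, abs_nonneg A, fun t ht => (le_abs_self _).trans ((hA t ht).trans (le_abs_self _))⟩

theorem abs_H_sub_le (h : EdgeRegular a H ℓ C) {s t : ℝ} (hs : s ∈ Icc 0 ℓ) (ht : t ∈ Icc 0 ℓ)
    (p q : ℝ) : |H s p - H t q| ≤ C * |p - q| + C * (1 + |q|) * |s - t| := by
  calc |H s p - H t q| = |(H s p - H s q) + (H s q - H t q)| := by ring_nf
    _ ≤ |H s p - H s q| + |H s q - H t q| := abs_add_le _ _
    _ ≤ _ := add_le_add (h.lip_p s hs p q) (h.lip_x s hs t ht q)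

theorem tendsto_H (h : EdgeRegular a H ℓ C) {t : ℝ} (ht : t ∈ Icc 0 ℓ) (p : ℝ) :
    Tendsto (fun z : ℝ × ℝ => H z.1 z.2) (𝓝[Icc 0 ℓ] t ×ˢ 𝓝 p) (𝓝 (H t p)) := by
  rw [tendsto_iff_dist_tendsto_zero]
  have hlim : Tendsto (fun z : ℝ × ℝ => C * |z.2 - p| + C * (1 + |p|) * |z.1 - t|)
      (𝓝[Icc 0 ℓ] t ×ˢ 𝓝 p) (𝓝 0) := by
    have hc : Continuous (fun z : ℝ × ℝ => C * |z.2 - p| + C * (1 + |p|) * |z.1 - t|) := by fun_prop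
    have := hc.tendsto (t, p)
    simp only [sub_self, abs_zero, mul_zero, add_zero, nhds_prod_eq] at this
    exact this.mono_left (prod_mono_left _ nhdsWithin_le_nhds)
  refine squeeze_zero' (Eventually.of_forall fun _ => dist_nonneg) ?_ hlim
  have : ∀ᶠ z : ℝ × ℝ in 𝓝[Icc 0 ℓ] t ×ˢ 𝓝 p, z.1 ∈ Icc 0 ℓ :=
    tendsto_fst.eventually self_mem_nhdsWithin
  filter_upwards [this] with z hz
  exact h.abs_H_sub_le hz ht _ _

/-- Reversal of the orientation of an edge. -/
theorem reverse (h : EdgeRegular a H ℓ C) :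
    EdgeRegular (fun t => a (ℓ - t)) (fun t p => H (ℓ - t) (-p)) ℓ C := by
  have hmem : ∀ t ∈ Icc 0 ℓ, ℓ - t ∈ Icc 0 ℓ := fun t ht => ⟨by linarith [ht.2], by linarith [ht.1]⟩
  have hsub : ∀ s t : ℝ, |ℓ - s - (ℓ - t)| = |s - t| := fun s t => by
    rw [abs_sub_comm]; ring_nf
  refine ⟨h.nonneg, fun s hs t ht p => ?_, fun t ht p q => ?_, ?_⟩
  · have := h.lip_x _ (hmem s hs) _ (hmem t ht) (-p)
    rwa [abs_neg, hsub] at this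
  · have := h.lip_p _ (hmem t ht) (-p) (-q)
    rwa [← neg_add', abs_neg, ← sub_eq_add_neg] at this
  · obtain ⟨σ, hσ, hL⟩ := h.sq
    refine ⟨fun t => σ (ℓ - t), fun t ht => hσ _ (hmem t ht), fun s hs t ht => ?_⟩
    rw [← hsub s t]
    exact hL _ (hmem s hs) _ (hmem t ht)

/-- Change of sign of the unknown. -/
theorem dual (h : EdgeRegular a H ℓ C) : EdgeRegular a (fun t p => -H t (-p)) ℓ C := by
  refine ⟨h.nonneg, fun s hs t ht p => ?_, fun t ht p q => ?_, h.sq⟩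
  · have := h.lip_x s hs t ht (-p)
    rwa [abs_neg, abs_sub_comm, ← neg_sub_neg] at this
  · have := h.lip_p t ht (-p) (-q)
    rwa [neg_sub_neg, abs_sub_comm q p, abs_sub_comm (H t (-p)), ← neg_sub_neg] at this

end EdgeRegular

theorem exists_forall_of_eventually_nhdsWithin_Icc {ℓ : ℝ} {Q : ℝ → Prop}
    (h : ∀ᶠ s in 𝓝[Icc 0 ℓ] (0 : ℝ), Q s) : ∃ δ > 0, ∀ s ∈ Icc 0 ℓ, s < δ → Q s := by
  rw [eventually_nhdsWithin_iff] at h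
  obtain ⟨δ, hδ, hb⟩ := Metric.eventually_nhds_iff.1 h
  refine ⟨δ, hδ, fun s hs hsδ => hb ?_ hs⟩
  rw [Real.dist_0_eq_abs, abs_of_nonneg hs.1]
  exact hsδ

theorem eventually_lt_nhdsGT_zero {δ : ℝ} (hδ : 0 < δ) : ∀ᶠ s in 𝓝[>] (0 : ℝ), s < δ :=
  (eventually_lt_nhds hδ).filter_mono nhdsWithin_le_nhds

/-! ### Barriers and difference quotients at an endpoint -/

namespace SubOn

variable {lam : ℝ} {a : ℝ → ℝ} {H : ℝ → ℝ → ℝ} {U : ℝ → ℝ}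

/-- If `U - φ`, for a quadratic polynomial `φ`, is larger somewhere inside `[c, d]` than at the
endpoints, then the equation can be tested at some interior point. -/
theorem exists_le {S : Set ℝ} (h : SubOn lam a H U S) {c d y b X : ℝ}
    (hS : Ioo c d ⊆ S) (husc : UpperSemicontinuousOn U (Icc c d)) (hy : y ∈ Ioo c d) (m : ℝ)
    (hc : U c - (b * (c - m) + X / 2 * (c - m) ^ 2) < U y - (b * (y - m) + X / 2 * (y - m) ^ 2))
    (hd : U d - (b * (d - m) + X / 2 * (d - m) ^ 2) < U y - (b * (y - m) + X / 2 * (y - m) ^ 2)) :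
    ∃ t ∈ Ioo c d, U y - (b * (y - m) + X / 2 * (y - m) ^ 2) ≤
      U t - (b * (t - m) + X / 2 * (t - m) ^ 2) ∧
      lam * U t - a t * X + H t (b + X * (t - m)) ≤ 0 := by
  have husc' : UpperSemicontinuousOn (fun s => U s - (b * (s - m) + X / 2 * (s - m) ^ 2))
      (Icc c d) := by
    simp only [sub_eq_add_neg (U _)]
    exact husc.add (Continuous.upperSemicontinuous (by fun_prop) |>.upperSemicontinuousOn _)
  have hy' : y ∈ Icc c d := Ioo_subset_Icc_self hy
  obtain ⟨t, ht, hmax⟩ := husc'.exists_isMaxOn ⟨y, hy'⟩ isCompact_Icc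
  have hyt := hmax hy'
  have htc : t ≠ c := by rintro rfl; exact absurd hyt (not_le.2 hc)
  have htd : t ≠ d := by rintro rfl; exact absurd hyt (not_le.2 hd)
  have hto : t ∈ Ioo c d := ⟨lt_of_le_of_ne ht.1 htc.symm, lt_of_le_of_ne ht.2 htd⟩
  refine ⟨t, hto, hyt, h t (hS hto) _ X ?_⟩
  filter_upwards [Icc_mem_nhds hto.1 hto.2] with s hs
  have := hmax hs
  simp only [mem_ofPred_eq] at this
  nlinarith

variable {ℓ C : ℝ}

theorem reverse (h : SubOn lam a H U (Ioo 0 ℓ)) :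
    SubOn lam (fun t => a (ℓ - t)) (fun t p => H (ℓ - t) (-p)) (fun t => U (ℓ - t)) (Ioo 0 ℓ) := by
  intro t ht p X hev
  refine h (ℓ - t) ⟨by linarith [ht.2], by linarith [ht.1]⟩ (-p) X ?_
  have hlim : Tendsto (fun s => ℓ - s) (𝓝 (ℓ - t)) (𝓝 t) := by
    have : Continuous (fun s : ℝ => ℓ - s) := by fun_prop
    have := this.tendsto (ℓ - t)
    rwa [sub_sub_cancel] at this
  filter_upwards [hlim.eventually hev] with s hs
  rw [sub_sub_cancel] at hs
  linarith

/-- The barrier is `M s - K s²/2`: a strict supersolution at every level `≥ -B`, rising by more than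
`2B` over `[0, s₀]`. In the nondegenerate case `K = M / s₀`, so the slopes stay in `[0, M]`, and `s₀
(C + 1) ≤ a 0 / 2` makes the diffusion term at least `(C + 1) M`, more than the loss `C M` in the
Hamiltonian. In the coercive case a linear barrier of large slope suffices. -/
theorem exists_barrier_data (hreg : EdgeRegular a H ℓ C) (hℓ : 0 < ℓ) (B : ℝ) (hB : 0 ≤ B)
    (hcase : 0 < a 0 ∨ ∃ c > 0, ∀ᶠ s in 𝓝[Icc 0 ℓ] (0 : ℝ), ∀ p, c⁻¹ * |p| - c ≤ H s p) :
    ∃ M K s₀ : ℝ, 0 < s₀ ∧ s₀ ≤ ℓ ∧ 0 ≤ K ∧ 2 * B < M * s₀ - K / 2 * s₀ ^ 2 ∧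
      ∀ s ∈ Icc 0 s₀, 0 < -(lam * B) + a s * K + H s (M - K * s) := by
  have h0 : (0 : ℝ) ∈ Icc 0 ℓ := left_mem_Icc.2 hℓ.le
  rcases hcase with ha | ⟨c, hc, hco⟩
  · have hev : ∀ᶠ s in 𝓝[Icc 0 ℓ] (0 : ℝ), a 0 / 2 < a s :=
      (hreg.continuousOn_a 0 h0).eventually_const_lt (by linarith)
    obtain ⟨δ, hδ, hδa⟩ := exists_forall_of_eventually_nhdsWithin_Icc hev
    have hC := hreg.nonneg
    set s₀ := min (min (δ / 2) ℓ) (a 0 / 2 / (C + 1)) with hs₀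
    have hs₀0 : 0 < s₀ := by positivity
    have hs₀δ : s₀ ≤ δ / 2 := (min_le_left _ _).trans (min_le_left _ _)
    have hs₀ℓ : s₀ ≤ ℓ := (min_le_left _ _).trans (min_le_right _ _)
    have hs₀a : s₀ * (C + 1) ≤ a 0 / 2 := (le_div_iff₀ (by positivity)).1 (min_le_right _ _)
    set M := |lam * B| + |H 0 0| + C * ℓ + 1 + 4 * (B + 1) / s₀ with hM
    have hM4 : 4 * (B + 1) / s₀ ≤ M := by
      have : 0 ≤ |lam * B| + |H 0 0| + C * ℓ + 1 := by positivity
      linarith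
    have hM0 : 0 < M := lt_of_lt_of_le (by positivity) hM4
    have hKs : M / s₀ * s₀ = M := by field_simp
    refine ⟨M, M / s₀, s₀, hs₀0, hs₀ℓ, by positivity, ?_, fun s hs => ?_⟩
    · have e : M * s₀ - M / s₀ / 2 * s₀ ^ 2 = M * s₀ / 2 := by field_simp; ring
      rw [e]
      rw [div_le_iff₀ hs₀0] at hM4
      linarith
    · have hsℓ : s ∈ Icc 0 ℓ := ⟨hs.1, hs.2.trans hs₀ℓ⟩
      have ha1 := hδa s hsℓ (by linarith [hs.2])
      have hq : |M - M / s₀ * s| ≤ M := by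
        have h1 : 0 ≤ M / s₀ * s := mul_nonneg (by positivity) hs.1
        have h2 : M / s₀ * s ≤ M / s₀ * s₀ := by gcongr; exact hs.2
        rw [abs_of_nonneg (by linarith)]
        linarith
      have hH := (abs_le.1 (hreg.abs_H_sub_le hsℓ h0 (M - M / s₀ * s) 0)).1
      rw [sub_zero, sub_zero, abs_zero, add_zero, mul_one, abs_of_nonneg hs.1] at hH
      have h3 : C * |M - M / s₀ * s| ≤ C * M := by gcongr
      have h4 : C * s ≤ C * ℓ := by gcongr; exact hsℓ.2
      have h5 : (C + 1) * M ≤ a s * (M / s₀) := by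
        have : s₀ * (C + 1) * (M / s₀) ≤ a s * (M / s₀) := by gcongr; linarith
        calc (C + 1) * M = s₀ * (C + 1) * (M / s₀) := by field_simp
          _ ≤ _ := this
      have h6 : |lam * B| + |H 0 0| + C * ℓ + 1 ≤ M := by
        have : 0 ≤ 4 * (B + 1) / s₀ := by positivity
        linarith
      have h7 := le_abs_self (lam * B)
      have h8 := neg_abs_le (H 0 0)
      nlinarith
  · obtain ⟨δ, hδ, hδH⟩ := exists_forall_of_eventually_nhdsWithin_Icc hco
    set s₀ := min (δ / 2) ℓ with hs₀
    have hs₀0 : 0 < s₀ := by positivity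
    have hs₀δ : s₀ ≤ δ / 2 := min_le_left _ _
    have hs₀ℓ : s₀ ≤ ℓ := min_le_right _ _
    set M := c * (c + |lam * B| + 1) + 2 * (B + 1) / s₀ with hM
    have hM0 : 0 < M := by positivity
    refine ⟨M, 0, s₀, hs₀0, hs₀ℓ, le_rfl, ?_, fun s hs => ?_⟩
    · have : 2 * (B + 1) / s₀ ≤ M := by
        have : 0 ≤ c * (c + |lam * B| + 1) := by positivity
        linarith
      rw [div_le_iff₀ hs₀0] at this
      linarith
    · have hsℓ : s ∈ Icc 0 ℓ := ⟨hs.1, hs.2.trans hs₀ℓ⟩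
      have h1 := hδH s hsℓ (by linarith [hs.2]) M
      rw [abs_of_pos hM0] at h1
      have h2 : c⁻¹ * (c * (c + |lam * B| + 1)) ≤ c⁻¹ * M := by
        gcongr
        have : 0 ≤ 2 * (B + 1) / s₀ := by positivity
        linarith
      rw [inv_mul_cancel_left₀ hc.ne'] at h2
      have h7 := le_abs_self (lam * B)
      rw [mul_zero, zero_mul, sub_zero]
      linarith

/-- A barrier from above at the left endpoint, when the equation is nondegenerate or coercive
there. -/
theorem exists_barrier (hreg : EdgeRegular a H ℓ C) (hℓ : 0 < ℓ) (hlam : 0 < lam)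
    (hU : SubOn lam a H U (Ioo 0 ℓ)) (husc : UpperSemicontinuousOn U (Icc 0 ℓ)) {B : ℝ}
    (hB : ∀ t ∈ Icc 0 ℓ, |U t| ≤ B)
    (hcase : 0 < a 0 ∨ ∃ c > 0, ∀ᶠ s in 𝓝[Icc 0 ℓ] (0 : ℝ), ∀ p, c⁻¹ * |p| - c ≤ H s p) :
    ∃ M K s₀ : ℝ, 0 < s₀ ∧ s₀ ≤ ℓ ∧ 0 ≤ K ∧
      (∀ s ∈ Icc 0 s₀, U s ≤ U 0 + M * s - K / 2 * s ^ 2) ∧ 0 < lam * U 0 + a 0 * K + H 0 M := by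
  have h0 : (0 : ℝ) ∈ Icc 0 ℓ := left_mem_Icc.2 hℓ.le
  have hB0 : 0 ≤ B := (abs_nonneg _).trans (hB 0 h0)
  obtain ⟨M, K, s₀, hs₀, hs₀ℓ, hK, hφ, hG⟩ :=
    exists_barrier_data (lam := lam) hreg hℓ B hB0 hcase
  have hGU : ∀ s ∈ Icc 0 s₀, 0 < lam * U s + a s * K + H s (M - K * s) := by
    intro s hs
    have h1 := hG s hs
    have h2 := (abs_le.1 (hB s ⟨hs.1, hs.2.trans hs₀ℓ⟩)).1
    nlinarith
  refine ⟨M, K, s₀, hs₀, hs₀ℓ, hK, fun s hs => ?_, ?_⟩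
  -- If `U` crossed the barrier, their difference would have an interior maximum: at `s₀` the
  -- barrier has gained more than `2B`, which bounds the oscillation of `U`. The equation fails at
  -- such a point.
  · by_contra hcon
    push Not at hcon
    have hs0 : 0 ≠ s := by
      rintro rfl
      simp at hcon
    have hUs₀ := (abs_le.1 (hB s₀ ⟨hs₀.le, hs₀ℓ⟩)).2
    have hU0 := (abs_le.1 (hB 0 h0)).1
    have hss₀ : s ≠ s₀ := by
      rintro rfl
      linarith
    obtain ⟨t, ht, -, hGt⟩ := hU.exists_le (c := 0) (d := s₀) (b := M) (X := -K)
      (Ioo_subset_Ioo_right hs₀ℓ) (husc.mono (Icc_subset_Icc_right hs₀ℓ))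
      ⟨lt_of_le_of_ne hs.1 hs0, lt_of_le_of_ne hs.2 hss₀⟩ 0
      (by simp only [sub_zero]; nlinarith) (by simp only [sub_zero]; nlinarith)
    have := hGU t (Ioo_subset_Icc_self ht)
    have e : M + -K * (t - 0) = M - K * t := by ring
    rw [e] at hGt
    linarith
  · have := hGU 0 ⟨le_rfl, hs₀.le⟩
    simpa using this

/-- If the difference quotients at `0` oscillate across `c₁`, the equation holds at `0` with slope
`c₁` and arbitrarily negative second derivative. -/
theorem le_zero_of_oscillation (hreg : EdgeRegular a H ℓ C) (hℓ : 0 < ℓ) (hlam : 0 < lam)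
    (hU : SubOn lam a H U (Ioo 0 ℓ)) (husc : UpperSemicontinuousOn U (Icc 0 ℓ)) {c₁ c₂ K : ℝ}
    (hc : c₁ < c₂) (h₁ : ∃ᶠ s in 𝓝[>] (0 : ℝ), U s < U 0 + c₁ * s)
    (h₂ : ∃ᶠ s in 𝓝[>] (0 : ℝ), U 0 + c₂ * s < U s) (hK : 0 ≤ K) :
    lam * U 0 + a 0 * K + H 0 c₁ ≤ 0 := by
  have h0 : (0 : ℝ) ∈ Icc 0 ℓ := left_mem_Icc.2 hℓ.le
  by_contra! hcon
  have hev : ∀ᶠ z : ℝ × ℝ in 𝓝[Icc 0 ℓ] (0 : ℝ) ×ˢ 𝓝 c₁,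
      0 < lam * (U 0 + c₁ * z.1) + a z.1 * K + H z.1 z.2 := by
    have h1 : Tendsto (fun z : ℝ => lam * (U 0 + c₁ * z)) (𝓝[Icc 0 ℓ] 0) (𝓝 (lam * U 0)) := by
      have : Continuous (fun z : ℝ => lam * (U 0 + c₁ * z)) := by fun_prop
      have := this.tendsto 0
      rw [mul_zero, add_zero] at this
      exact this.mono_left nhdsWithin_le_nhds
    have h2 : Tendsto (fun z : ℝ => a z * K) (𝓝[Icc 0 ℓ] 0) (𝓝 (a 0 * K)) :=
      (hreg.continuousOn_a 0 h0).tendsto.mul_const K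
    have := ((h1.add h2).comp (tendsto_fst (g := 𝓝 c₁))).add (hreg.tendsto_H h0 c₁)
    exact this.eventually_const_lt hcon
  obtain ⟨pa, hpa, pb, hpb, hab⟩ := eventually_prod_iff.1 hev
  obtain ⟨δ, hδ, hδa⟩ := exists_forall_of_eventually_nhdsWithin_Icc hpa
  obtain ⟨e, he, heb⟩ := Metric.eventually_nhds_iff.1 hpb
  obtain ⟨x, hx, hx0, hxδ, hxℓ, hxe, hxc⟩ := (h₁.and_eventually
    ((eventually_mem_nhdsWithin).and ((eventually_lt_nhdsGT_zero hδ).and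
    ((eventually_lt_nhdsGT_zero hℓ).and
    ((eventually_lt_nhdsGT_zero (show 0 < e / (K + 1) by positivity)).and
    (eventually_lt_nhdsGT_zero (show 0 < (c₂ - c₁) / (K + 1) from
      div_pos (by linarith) (by positivity)))))))).exists
  have hx0 : 0 < x := hx0
  rw [lt_div_iff₀ (by positivity)] at hxe hxc
  obtain ⟨y, hy, hy0, hyx⟩ := (h₂.and_eventually
    ((eventually_mem_nhdsWithin).and (eventually_lt_nhdsGT_zero hx0))).exists
  have hy0 : 0 < y := hy0
  have hKx : 0 ≤ K * x := by positivity
  have hc1 : K / 2 * x ≤ c₂ - c₁ := by nlinarith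
  -- The test polynomial is `c₁ s + K/2 · s(x - s)`. It agrees with `c₁ s` at `0` and at `x`, where
  -- `U` is low, and for small `x` it lies below `c₂ s` at `y`, where `U` is high. Its slopes on
  -- `[0, x]` tend to `c₁` as `x → 0`.
  obtain ⟨t, ht, hval, hGt⟩ := hU.exists_le (c := 0) (d := x) (b := c₁ + K * x / 2) (X := -K)
    (Ioo_subset_Ioo_right hxℓ.le) (husc.mono (Icc_subset_Icc_right hxℓ.le)) ⟨hy0, hyx⟩ 0
    (by
      simp only [sub_zero]
      nlinarith [mul_nonneg hy0.le (sub_nonneg.2 hc1), mul_nonneg hK (sq_nonneg y)])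
    (by
      simp only [sub_zero]
      nlinarith [mul_nonneg hy0.le (sub_nonneg.2 hc1), mul_nonneg hK (sq_nonneg y)])
  have htℓ : t ∈ Icc 0 ℓ := ⟨ht.1.le, (ht.2.trans hxℓ).le⟩
  have hUt : U 0 + c₁ * t ≤ U t := by
    simp only [sub_zero] at hval
    have h1 : 0 ≤ K / 2 * (t * (x - t)) :=
      mul_nonneg (by positivity) (mul_nonneg ht.1.le (by linarith [ht.2]))
    nlinarith [mul_nonneg hy0.le (sub_nonneg.2 hc1), mul_nonneg hK (sq_nonneg y)]
  have hG := hab (hδa t htℓ (ht.2.trans hxδ)) (heb (y := c₁ + K * x / 2 + -K * (t - 0)) (by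
    rw [Real.dist_eq]
    have e1 : c₁ + K * x / 2 + -K * (t - 0) - c₁ = K * (x / 2 - t) := by ring
    rw [e1, abs_mul, abs_of_nonneg hK]
    have e2 : |x / 2 - t| ≤ x := by rw [abs_le]; constructor <;> linarith [ht.1, ht.2]
    calc K * |x / 2 - t| ≤ K * x := by gcongr
      _ < e := by nlinarith))
  simp only at hG
  have := mul_le_mul_of_nonneg_left hUt hlam.le
  linarith

/-- At a degenerate endpoint, the equation holds with slope the upper limit of the difference
quotients. -/
theorem le_zero_of_limsup_slope (hreg : EdgeRegular a H ℓ C) (hℓ : 0 < ℓ) (hlam : 0 < lam)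
    (hU : SubOn lam a H U (Ioo 0 ℓ)) (husc : UpperSemicontinuousOn U (Icc 0 ℓ)) (ha : a 0 = 0)
    {c : ℝ} (h₁ : ∀ η > 0, ∃ᶠ s in 𝓝[>] (0 : ℝ), U 0 + (c - η) * s ≤ U s)
    (h₂ : ∀ η > 0, ∀ᶠ s in 𝓝[>] (0 : ℝ), U s ≤ U 0 + (c + η) * s) :
    lam * U 0 + H 0 c ≤ 0 := by
  have h0 : (0 : ℝ) ∈ Icc 0 ℓ := left_mem_Icc.2 hℓ.le
  have hC := hreg.nonneg
  by_contra! hcon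
  have hev : ∀ᶠ z : ℝ × ℝ in 𝓝[Icc 0 ℓ] (0 : ℝ) ×ˢ 𝓝 c,
      (lam * U 0 + H 0 c) / 2 < lam * (U 0 + (c - 1) * z.1) - z.1 + H z.1 z.2 := by
    have h1 : Tendsto (fun z : ℝ => lam * (U 0 + (c - 1) * z) - z) (𝓝[Icc 0 ℓ] 0)
        (𝓝 (lam * U 0)) := by
      have : Continuous (fun z : ℝ => lam * (U 0 + (c - 1) * z) - z) := by fun_prop
      have := this.tendsto 0
      rw [mul_zero, add_zero, sub_zero] at this
      exact this.mono_left nhdsWithin_le_nhds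
    have := (h1.comp (tendsto_fst (g := 𝓝 c))).add (hreg.tendsto_H h0 c)
    exact this.eventually_const_lt (by linarith)
  obtain ⟨pa, hpa, pb, hpb, hab⟩ := eventually_prod_iff.1 hev
  obtain ⟨δ, hδ, hδa⟩ := exists_forall_of_eventually_nhdsWithin_Icc hpa
  obtain ⟨e, he, heb⟩ := Metric.eventually_nhds_iff.1 hpb
  set γ := (lam * U 0 + H 0 c) / 2 with hγ
  have hγ0 : 0 < γ := by positivity
  -- the size of the correction
  obtain ⟨η, hη0, hη1, hηe, hηδ, hηγ⟩ : ∃ η : ℝ, 0 < η ∧ η ≤ 1 ∧ 8 * η < e ∧ True ∧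
      lam * η * (2 * δ) + C ^ 2 * 32 * η * δ < γ := by
    have aux : ∀ F : ℝ → ℝ, Continuous F → ∀ c, F 0 < c → ∀ᶠ r in 𝓝[>] (0 : ℝ), F r < c :=
      fun F hF c hc => ((hF.tendsto 0).mono_left nhdsWithin_le_nhds).eventually_lt_const hc
    obtain ⟨η, h1, h2, h3, h4⟩ := ((aux (fun η => η) (by fun_prop) 1 one_pos).and
      ((aux (fun η => 8 * η) (by fun_prop) e (by simpa)).and
      ((aux (fun η => lam * η * (2 * δ) + C ^ 2 * 32 * η * δ) (by fun_prop) γ (by simpa)).and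
      eventually_mem_nhdsWithin))).exists
    exact ⟨η, h4, h1.le, h2, trivial, h3⟩
  obtain ⟨δ', hδ', hδ'U⟩ : ∃ δ' > 0, ∀ s, 0 < s → s < δ' → U s ≤ U 0 + (c + η) * s := by
    have := h₂ η hη0
    rw [eventually_nhdsWithin_iff] at this
    obtain ⟨δ', hδ', hb⟩ := Metric.eventually_nhds_iff.1 this
    exact ⟨δ', hδ', fun s hs hs' => hb (by rwa [Real.dist_0_eq_abs, abs_of_pos hs]) hs⟩
  obtain ⟨x, hx, hx0, hxδ, hxℓ, hxδ'⟩ := ((h₁ η hη0).and_eventually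
    ((eventually_mem_nhdsWithin).and ((eventually_lt_nhdsGT_zero (half_pos hδ)).and
    ((eventually_lt_nhdsGT_zero (half_pos hℓ)).and
    (eventually_lt_nhdsGT_zero (half_pos hδ')))))).exists
  have hx0 : 0 < x := hx0
  have hU2x := hδ'U (2 * x) (by linarith) (by linarith)
  have hXx : 8 * η / x * x = 8 * η := by field_simp
  have hXx2 : 8 * η / x / 2 * x ^ 2 = 4 * η * x := by field_simp; ring
  have hηx : 0 < η * x := by positivity
  -- The correction `(4η/x)(s - x)²` equals `4ηx` at `0` and at `2x`, enough to beat the errors of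
  -- size `η` in the slope bounds at `x` and `2x`. It changes the slope by at most `8η`, and its
  -- second derivative `8η/x` meets a diffusion at most `C²(2x)²`.
  obtain ⟨t, ht, hval, hGt⟩ := hU.exists_le (c := 0) (d := 2 * x) (y := x) (b := c)
    (X := 8 * η / x) (Ioo_subset_Ioo_right (by linarith))
    (husc.mono (Icc_subset_Icc_right (by linarith))) ⟨hx0, by linarith⟩ x
    (by
      rw [zero_sub, neg_sq, hXx2, sub_self]
      nlinarith)
    (by
      have : 2 * x - x = x := by ring
      rw [this, hXx2, sub_self]
      nlinarith)
  have htℓ : t ∈ Icc 0 ℓ := ⟨ht.1.le, by linarith [ht.2]⟩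
  have htx : |t - x| ≤ x := by rw [abs_le]; constructor <;> linarith [ht.1, ht.2]
  have hX0 : 0 < 8 * η / x := by positivity
  have hUt : U 0 + c * t - η * x ≤ U t := by
    rw [sub_self] at hval
    have : 0 ≤ 8 * η / x / 2 * (t - x) ^ 2 := by positivity
    nlinarith
  have hat : a t * (8 * η / x) ≤ C ^ 2 * 32 * η * x := by
    have h1 := hreg.a_le htℓ h0 ha
    rw [sub_zero] at h1
    have h2 : a t ≤ C ^ 2 * (2 * x) ^ 2 :=
      h1.trans (by have := ht.1; have := ht.2; gcongr)
    calc a t * (8 * η / x) ≤ C ^ 2 * (2 * x) ^ 2 * (8 * η / x) := by gcongr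
      _ = C ^ 2 * 32 * η * x := by field_simp; ring
  have hG := hab (hδa t htℓ (by linarith [ht.2])) (heb (y := c + 8 * η / x * (t - x)) (by
    rw [Real.dist_eq, add_sub_cancel_left, abs_mul, abs_of_pos hX0]
    calc 8 * η / x * |t - x| ≤ 8 * η / x * x := by gcongr
      _ < e := by rw [hXx]; exact hηe))
  simp only at hG
  have h1 := mul_le_mul_of_nonneg_left hUt hlam.le
  have h2 : lam * (η * x) ≤ lam * η * (2 * δ) := by
    rw [← mul_assoc]
    gcongr
    linarith
  have h3 : C ^ 2 * 32 * η * x ≤ C ^ 2 * 32 * η * δ := by gcongr; linarith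
  have h4 : lam * t ≥ 0 := by have := ht.1; positivity
  nlinarith [ht.1]

/-- At a degenerate endpoint, the equation holds with any slope between the lower and the upper
limit of the difference quotients. -/
theorem le_zero_of_slope (hreg : EdgeRegular a H ℓ C) (hℓ : 0 < ℓ) (hlam : 0 < lam)
    (hU : SubOn lam a H U (Ioo 0 ℓ)) (husc : UpperSemicontinuousOn U (Icc 0 ℓ)) (ha : a 0 = 0)
    {c : ℝ} (h₁ : ∀ η > 0, ∃ᶠ s in 𝓝[>] (0 : ℝ), U 0 + (c - η) * s ≤ U s)
    (h₂ : ∀ η > 0, ∃ᶠ s in 𝓝[>] (0 : ℝ), U s ≤ U 0 + (c + η) * s) :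
    lam * U 0 + H 0 c ≤ 0 := by
  have h0 : (0 : ℝ) ∈ Icc 0 ℓ := left_mem_Icc.2 hℓ.le
  by_cases h : ∀ η > 0, ∀ᶠ s in 𝓝[>] (0 : ℝ), U s ≤ U 0 + (c + η) * s
  · exact hU.le_zero_of_limsup_slope hreg hℓ hlam husc ha h₁ h
  · push Not at h
    obtain ⟨η₀, hη₀, hfr⟩ := h
    -- Here the quotients oscillate across every small interval above `c`, so the equation holds at
    -- slopes `c + η`, and `η → 0`.
    have key : ∀ᶠ η in 𝓝[>] (0 : ℝ), lam * U 0 + H 0 (c + η) ≤ 0 := by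
      filter_upwards [eventually_mem_nhdsWithin, eventually_lt_nhdsGT_zero hη₀] with η hη hηη
      have hη : 0 < η := hη
      have := hU.le_zero_of_oscillation hreg hℓ hlam husc (c₁ := c + η) (c₂ := c + η₀) (K := 0)
        (by linarith) ?_ hfr le_rfl
      · simpa using this
      · refine ((h₂ (η / 2) (half_pos hη)).and_eventually eventually_mem_nhdsWithin).mono ?_
        rintro s ⟨hs, hs0⟩
        have hs0 : 0 < s := hs0
        nlinarith
    have hlim : Tendsto (fun η => lam * U 0 + H 0 (c + η)) (𝓝[>] 0) (𝓝 (lam * U 0 + H 0 c)) := by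
      apply Tendsto.const_add
      have h1 : Tendsto (fun η : ℝ => ((0 : ℝ), c + η)) (𝓝[>] 0) (𝓝[Icc 0 ℓ] 0 ×ˢ 𝓝 c) := by
        refine Tendsto.prodMk ?_ ?_
        · exact tendsto_nhdsWithin_iff.2 ⟨tendsto_const_nhds, Eventually.of_forall fun _ => h0⟩
        · have : Continuous (fun η : ℝ => c + η) := by fun_prop
          have := this.tendsto 0
          rw [add_zero] at this
          exact this.mono_left nhdsWithin_le_nhds
      exact (hreg.tendsto_H h0 c).comp h1
    exact le_of_tendsto hlim key

/-- A bounded subsolution has a limit at an endpoint near which the Hamiltonian is coercive. -/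
theorem exists_tendsto (hℓ : 0 < ℓ) (hlam : 0 < lam)
    (hU : SubOn lam a H U (Ioo 0 ℓ)) (husc : UpperSemicontinuousOn U (Icc 0 ℓ)) {B : ℝ}
    (hB : ∀ t ∈ Icc 0 ℓ, |U t| ≤ B)
    (hco : ∃ c > 0, ∀ᶠ s in 𝓝[Icc 0 ℓ] (0 : ℝ), ∀ p, c⁻¹ * |p| - c ≤ H s p) :
    ∃ L, Tendsto U (𝓝[>] 0) (𝓝 L) := by
  obtain ⟨c, hc, hco⟩ := hco
  obtain ⟨δ, hδ, hδH⟩ := exists_forall_of_eventually_nhdsWithin_Icc hco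
  have hmem : ∀ᶠ s in 𝓝[>] (0 : ℝ), s ∈ Icc 0 ℓ := by
    filter_upwards [eventually_mem_nhdsWithin, eventually_lt_nhdsGT_zero hℓ] with s hs hs'
    exact ⟨le_of_lt hs, hs'.le⟩
  have hbd : ∀ᶠ s in 𝓝[>] (0 : ℝ), |U s| ≤ B := hmem.mono fun s hs => hB s hs
  refine tendsto_of_no_upcrossings dense_univ ?_ ⟨B, ?_⟩ ⟨-B, ?_⟩
  · rintro α - β - hαβ ⟨h₁, h₂⟩
    -- Coercivity forbids the slope `M` for any subsolution bounded by `B`. An upcrossing followed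
    -- by a return, on a scale below `(β - α)/M`, would produce a contact point with exactly this
    -- slope.
    set M := c * (c + |lam * B| + 1) with hM
    have hM0 : 0 < M := by positivity
    obtain ⟨x, hx, hx0, hxδ, hxℓ, hxM⟩ := (h₁.and_eventually
      ((eventually_mem_nhdsWithin).and ((eventually_lt_nhdsGT_zero hδ).and
      ((eventually_lt_nhdsGT_zero hℓ).and
      (eventually_lt_nhdsGT_zero (show 0 < (β - α) / M from
        div_pos (by linarith) hM0)))))).exists
    have hx0 : 0 < x := hx0
    rw [lt_div_iff₀ hM0] at hxM
    obtain ⟨y, hy, hy0, hyx⟩ := (h₂.and_eventually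
      ((eventually_mem_nhdsWithin).and (eventually_lt_nhdsGT_zero hx0))).exists
    have hy0 : 0 < y := hy0
    obtain ⟨z, hz, hz0, hzy⟩ := (h₁.and_eventually
      ((eventually_mem_nhdsWithin).and (eventually_lt_nhdsGT_zero hy0))).exists
    have hz0 : 0 < z := hz0
    obtain ⟨t, ht, -, hGt⟩ := hU.exists_le (c := z) (d := x) (b := M) (X := 0)
      (Ioo_subset_Ioo hz0.le hxℓ.le) (husc.mono (Icc_subset_Icc hz0.le hxℓ.le)) ⟨hzy, hyx⟩ 0
      (by nlinarith) (by nlinarith)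
    have htℓ : t ∈ Icc 0 ℓ := ⟨hz0.le.trans ht.1.le, ht.2.le.trans hxℓ.le⟩
    have h1 := hδH t htℓ (ht.2.trans hxδ) M
    rw [abs_of_pos hM0, hM, inv_mul_cancel_left₀ hc.ne', ← hM] at h1
    have h2 := (abs_le.1 (hB t htℓ)).1
    have h3 := le_abs_self (lam * B)
    simp only [mul_zero, zero_mul, add_zero, sub_zero] at hGt
    nlinarith
  · rw [eventually_map]; exact hbd.mono fun s hs => (abs_le.1 hs).2
  · rw [eventually_map]; exact hbd.mono fun s hs => (abs_le.1 hs).1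

end SubOn

/-! ### Doubling of variables -/

/-- Penalized maxima of `u x + w y` concentrate at the strict maximum point of `u + w`. -/
theorem exists_doubling_max {S : Set ℝ} {u w : ℝ → ℝ} {x₀ : ℝ} (hS : IsCompact S) (hx₀ : x₀ ∈ S)
    (hu : UpperSemicontinuousOn u S) (hw : UpperSemicontinuousOn w S)
    (hstrict : ∀ s ∈ S, s ≠ x₀ → u s + w s < u x₀ + w x₀)
    {xs β : ℕ → ℝ} (hxs : ∀ n, xs n ∈ S) (hxs₀ : Tendsto xs atTop (𝓝 x₀))
    (huxs : Tendsto (fun n => u (xs n)) atTop (𝓝 (u x₀)))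
    (hβ : ∀ n, 0 < β n) (hβ0 : Tendsto β atTop (𝓝 0)) {r : ℝ} (hr : 0 < r) :
    ∃ n, ∃ x ∈ S, ∃ y ∈ S, (∀ x' ∈ S, ∀ y' ∈ S,
        u x' + w y' - (x' - y' + (x₀ - xs n)) ^ 2 / (2 * β n) ≤
          u x + w y - (x - y + (x₀ - xs n)) ^ 2 / (2 * β n)) ∧
      |x - x₀| < r ∧ |y - x₀| < r ∧ (x - y + (x₀ - xs n)) ^ 2 / (2 * β n) < r ∧
      u x₀ + w x₀ - r < u x + w y := by
  have hne : (S ×ˢ S).Nonempty := ⟨(x₀, x₀), hx₀, hx₀⟩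
  have husc : ∀ n, UpperSemicontinuousOn
      (fun z : ℝ × ℝ => u z.1 + w z.2 - (z.1 - z.2 + (x₀ - xs n)) ^ 2 / (2 * β n)) (S ×ˢ S) := by
    intro n
    simp only [sub_eq_add_neg (u _ + w _)]
    have h1 : UpperSemicontinuousOn (fun z : ℝ × ℝ => u z.1) (S ×ˢ S) :=
      hu.comp (g := Prod.fst) (by fun_prop) (fun z hz => hz.1)
    have h2 : UpperSemicontinuousOn (fun z : ℝ × ℝ => w z.2) (S ×ˢ S) :=
      hw.comp (g := Prod.snd) (by fun_prop) (fun z hz => hz.2)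
    exact (h1.add h2).add
      (Continuous.upperSemicontinuous (by fun_prop) |>.upperSemicontinuousOn _)
  choose Z hZS hZmax using fun n => (husc n).exists_isMaxOn hne (hS.prod hS)
  -- The shifted penalization vanishes at `(xs n, x₀)`, so the penalized maxima are asymptotically
  -- at least `u x₀ + w x₀`.
  have hval : ∀ n, u (xs n) + w x₀ ≤
      u (Z n).1 + w (Z n).2 - ((Z n).1 - (Z n).2 + (x₀ - xs n)) ^ 2 / (2 * β n) := by
    intro n
    have := hZmax n (show (xs n, x₀) ∈ S ×ˢ S from ⟨hxs n, hx₀⟩)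
    simpa using this
  obtain ⟨z, hzS, φ, hφ, hlim⟩ := (hS.prod hS).tendsto_subseq hZS
  have hφt := hφ.tendsto_atTop
  have hβφ := hβ0.comp hφt
  have hxsφ := hxs₀.comp hφt
  have huφ := huxs.comp hφt
  obtain ⟨Bu, hBu⟩ := hu.bddAbove_of_isCompact hS
  obtain ⟨Bw, hBw⟩ := hw.bddAbove_of_isCompact hS
  have hl1 : Tendsto (fun n => (Z (φ n)).1) atTop (𝓝 z.1) := (continuous_fst.tendsto z).comp hlim
  have hl2 : Tendsto (fun n => (Z (φ n)).2) atTop (𝓝 z.2) := (continuous_snd.tendsto z).comp hlim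
  have hz12 : z.1 = z.2 := by
    have h1 : ∀ n, ((Z (φ n)).1 - (Z (φ n)).2 + (x₀ - xs (φ n))) ^ 2 ≤
        2 * β (φ n) * (Bu + Bw - w x₀ - u (xs (φ n))) := by
      intro n
      have h2 := hval (φ n)
      have h3 := hBu ⟨_, (hZS (φ n)).1, rfl⟩
      have h4 := hBw ⟨_, (hZS (φ n)).2, rfl⟩
      have h5 : ((Z (φ n)).1 - (Z (φ n)).2 + (x₀ - xs (φ n))) ^ 2 / (2 * β (φ n)) ≤
        Bu + Bw - w x₀ - u (xs (φ n)) := by linarith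
      rw [div_le_iff₀ (by linarith [hβ (φ n)])] at h5
      linarith
    have h2 : Tendsto (fun n => ((Z (φ n)).1 - (Z (φ n)).2 + (x₀ - xs (φ n))) ^ 2) atTop
        (𝓝 ((z.1 - z.2 + (x₀ - x₀)) ^ 2)) :=
      ((hl1.sub hl2).add (hxsφ.const_sub x₀)).pow 2
    have h3 : Tendsto (fun n => 2 * β (φ n) * (Bu + Bw - w x₀ - u (xs (φ n)))) atTop
        (𝓝 (2 * 0 * (Bu + Bw - w x₀ - u x₀))) :=
      (hβφ.const_mul 2).mul (huφ.const_sub _)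
    have h4 := le_of_tendsto_of_tendsto' h2 h3 h1
    rw [sub_self, add_zero, mul_zero, zero_mul] at h4
    have : z.1 - z.2 = 0 := by
      have := le_antisymm h4 (sq_nonneg _)
      simpa using this
    linarith
  have hev : ∀ e > 0, ∀ᶠ n in atTop, u (Z (φ n)).1 < u z.1 + e ∧ w (Z (φ n)).2 < w z.2 + e := by
    intro e he
    have h1 : Tendsto (fun n => (Z (φ n)).1) atTop (𝓝[S] z.1) :=
      tendsto_nhdsWithin_iff.2 ⟨hl1, Eventually.of_forall fun n => (hZS _).1⟩
    have h2 : Tendsto (fun n => (Z (φ n)).2) atTop (𝓝[S] z.2) :=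
      tendsto_nhdsWithin_iff.2 ⟨hl2, Eventually.of_forall fun n => (hZS _).2⟩
    exact (h1.eventually (hu z.1 hzS.1 (u z.1 + e) (by linarith))).and
      (h2.eventually (hw z.2 hzS.2 (w z.2 + e) (by linarith)))
  have hz : z.1 = x₀ := by
    by_contra hne
    have h1 := hstrict z.1 hzS.1 hne
    set e := (u x₀ + w x₀ - (u z.1 + w z.1)) / 4 with he
    have he0 : 0 < e := by simp only [he]; linarith
    obtain ⟨n, ⟨h2, h3⟩, h4⟩ := ((hev e he0).and
      (huφ.eventually_const_lt (show u x₀ - e < u x₀ by linarith))).exists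
    have h5 := hval (φ n)
    have h6 : 0 ≤ ((Z (φ n)).1 - (Z (φ n)).2 + (x₀ - xs (φ n))) ^ 2 / (2 * β (φ n)) := by
      have := hβ (φ n); positivity
    rw [← hz12] at h3
    simp only [Function.comp] at h4
    linarith
  have hz2 : z.2 = x₀ := hz12 ▸ hz
  rw [hz] at hl1 hev
  rw [hz2] at hl2 hev
  obtain ⟨n, ⟨⟨h2, h3⟩, h4⟩, h5, h6⟩ := (((hev (r / 4) (by linarith)).and
      (huφ.eventually_const_lt (show u x₀ - r / 4 < u x₀ by linarith))).and
      ((hl1.eventually (Metric.ball_mem_nhds x₀ hr)).and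
        (hl2.eventually (Metric.ball_mem_nhds x₀ hr)))).exists
  simp only [Function.comp] at h4
  have h7 := hval (φ n)
  have h8 : 0 ≤ ((Z (φ n)).1 - (Z (φ n)).2 + (x₀ - xs (φ n))) ^ 2 / (2 * β (φ n)) := by
    have := hβ (φ n); positivity
  refine ⟨φ n, (Z (φ n)).1, (hZS _).1, (Z (φ n)).2, (hZS _).2, fun x' hx' y' hy' => ?_, h5, h6,
    by linarith, by linarith⟩
  exact hZmax (φ n) (show (x', y') ∈ S ×ˢ S from ⟨hx', hy'⟩)

/-- The viscosity inequalities at a maximum point of the doubled functional. -/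
theorem doubling_inequality {lam : ℝ} {a : ℝ → ℝ} {H : ℝ → ℝ → ℝ} {ℓ C A : ℝ} {U W : ℝ → ℝ}
    (hreg : EdgeRegular a H ℓ C) (hlam : 0 < lam) (hA : ∀ t ∈ Icc 0 ℓ, a t ≤ A)
    {c d x₀ κ ρ : ℝ} (hcd : Icc c d ⊆ Icc 0 ℓ) (hx₀ : x₀ ∈ Icc c d) (hκ : 0 ≤ κ)
    (hU : SubOn lam a H U (Ioo c d)) (hUusc : UpperSemicontinuousOn U (Icc c d))
    (hWusc : UpperSemicontinuousOn W (Icc c d))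
    (hW : ∀ y ∈ Icc c d, |y - x₀| < ρ → ∀ q Y : ℝ,
      (∀ᶠ s in 𝓝[Icc c d] y, W s ≤ W y + q * (s - y) + Y / 2 * (s - y) ^ 2) →
      lam * W y - a y * Y + -H y (-q) ≤ 0)
    {x y β τ : ℝ} (hβ : 0 < β) (hx : x ∈ Ioo c d) (hy : y ∈ Icc c d) (hyρ : |y - x₀| < ρ)
    (hmax : ∀ x' ∈ Icc c d, ∀ y' ∈ Icc c d,
      U x' + κ * x' - κ * (x' - x₀) ^ 2 + W y' - (x' - y' + τ) ^ 2 / (2 * β) ≤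
        U x + κ * x - κ * (x - x₀) ^ 2 + W y - (x - y + τ) ^ 2 / (2 * β)) :
    lam * (U x + κ * x - κ * (x - x₀) ^ 2 + W y - κ * ℓ) ≤
      2 / β * (C * |x - y|) ^ 2 + κ * (2 * A + C * (1 + 2 * ℓ)) +
        C * (1 + |(x - y + τ) / β| + κ * (1 + 2 * ℓ)) * |x - y| := by
  set P := (x - y + τ) / β with hP
  have hC := hreg.nonneg
  set U₁ : ℝ → ℝ := fun s => U s + κ * s - κ * (s - x₀) ^ 2 with hU₁
  have hU₁usc : UpperSemicontinuousOn U₁ (Icc c d) := by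
    have e : U₁ = fun s => U s + (κ * s - κ * (s - x₀) ^ 2) := by ext s; simp only [hU₁]; ring
    rw [e]
    exact hUusc.add (Continuous.upperSemicontinuous (by fun_prop) |>.upperSemicontinuousOn _)
  have key : ∀ᶠ η in 𝓝[>] (0 : ℝ), lam * (U₁ x + W y - κ * ℓ - 2 * η) ≤
      2 / β * (C * (|x - y| + 2 * η)) ^ 2 + η * (2 * A) + κ * (2 * A) +
        C * (2 * η + κ * (1 + 2 * ℓ)) +
        C * (1 + (|P| + η + κ * (1 + 2 * ℓ))) * (|x - y| + 2 * η) := by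
    have hsmall : ∀ᶠ η in 𝓝[>] (0 : ℝ), η < x - c ∧ η < d - x ∧ η < ρ - |y - x₀| :=
      (eventually_lt_nhdsGT_zero (by linarith [hx.1])).and
        ((eventually_lt_nhdsGT_zero (by linarith [hx.2])).and
        (eventually_lt_nhdsGT_zero (by linarith)))
    filter_upwards [hsmall, eventually_mem_nhdsWithin] with η ⟨hη1, hη2, hη3⟩ hη
    have hη : 0 < η := hη
    obtain ⟨x', hx', y', hy', p, q, X, Y, h1, h2, h3, h4, h5, h6, h7, h8, h9⟩ :=
      exists_jets_of_isMax hβ isCompact_Icc isCompact_Icc (Ioo_subset_Icc_self hx) hy hU₁usc hWusc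
        hmax hη
    have hx'o : x' ∈ Ioo c d := by
      have := abs_lt.1 h1
      constructor <;> linarith
    have hx'ℓ := hcd hx'
    have hy'ℓ := hcd hy'
    have hx₀ℓ := hcd hx₀
    have hy'ρ : |y' - x₀| < ρ := by
      calc |y' - x₀| = |(y' - y) + (y - x₀)| := by ring_nf
        _ ≤ |y' - y| + |y - x₀| := abs_add_le _ _
        _ < ρ := by linarith
    set pu := p - κ + 2 * κ * (x' - x₀) with hpu
    have i1 := hU x' hx'o pu (X + 2 * κ) (by
      rw [nhdsWithin_eq_nhds.2 (Icc_mem_nhds hx'o.1 hx'o.2)] at h7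
      filter_upwards [h7] with s hs
      simp only [hU₁] at hs
      rw [hpu]
      linarith)
    have i2 := hW y' hy' hy'ρ q Y h8
    obtain ⟨σ, hσ, hσL⟩ := hreg.sq
    have hxy' : |x' - y'| ≤ |x - y| + 2 * η := by
      calc |x' - y'| = |(x' - x) + (x - y) + (y - y')| := by ring_nf
        _ ≤ |x' - x| + |x - y| + |y - y'| := abs_add_three _ _ _
        _ ≤ |x - y| + 2 * η := by rw [abs_sub_comm y y']; linarith
    have i3 : a x' * X + a y' * Y ≤ 2 / β * (C * (|x - y| + 2 * η)) ^ 2 + η * (2 * A) := by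
      -- Testing the matrix inequality with `(σ x', σ y')` turns the diffusion terms into `(σ x' - σ
      -- y')²`, which Lipschitz continuity of `σ` controls.
      have j1 := h9 (σ x') (σ y')
      rw [← hσ x' hx'ℓ, ← hσ y' hy'ℓ] at j1
      have j2 : (σ x' - σ y') ^ 2 ≤ (C * (|x - y| + 2 * η)) ^ 2 := by
        rw [← sq_abs]
        have := (hσL x' hx'ℓ y' hy'ℓ).trans (mul_le_mul_of_nonneg_left hxy' hC)
        gcongr
      have j3 : 2 / β * (σ x' - σ y') ^ 2 ≤ 2 / β * (C * (|x - y| + 2 * η)) ^ 2 := by gcongr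
      have j4 : η * (a x' + a y') ≤ η * (2 * A) := by
        gcongr; linarith [hA x' hx'ℓ, hA y' hy'ℓ]
      linarith
    have hx'x₀ : |x' - x₀| ≤ ℓ := by
      rw [abs_le]; constructor <;> linarith [hx'ℓ.1, hx'ℓ.2, hx₀ℓ.1, hx₀ℓ.2]
    have hpuP : |pu - P| ≤ η + κ * (1 + 2 * ℓ) := by
      calc |pu - P| = |(p - P) + (-κ) + κ * (2 * (x' - x₀))| := by rw [hpu]; ring_nf
        _ ≤ |p - P| + |-κ| + |κ * (2 * (x' - x₀))| := abs_add_three _ _ _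
        _ = |p - P| + κ + κ * (2 * |x' - x₀|) := by
          rw [abs_neg, abs_mul, abs_mul, abs_of_nonneg hκ, abs_two]
        _ ≤ η + κ + κ * (2 * ℓ) := by gcongr
        _ = _ := by ring
    have i4 : H y' (-q) - H x' pu ≤ C * (2 * η + κ * (1 + 2 * ℓ)) +
        C * (1 + (|P| + η + κ * (1 + 2 * ℓ))) * (|x - y| + 2 * η) := by
      have j1 := (le_abs_self _).trans (hreg.abs_H_sub_le hy'ℓ hx'ℓ (-q) pu)
      have j2 : |-q - pu| ≤ 2 * η + κ * (1 + 2 * ℓ) := by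
        calc |-q - pu| = |-(q + P) + -(pu - P)| := by ring_nf
          _ ≤ |-(q + P)| + |-(pu - P)| := abs_add_le _ _
          _ ≤ _ := by rw [abs_neg, abs_neg]; linarith
      have j3 : |pu| ≤ |P| + η + κ * (1 + 2 * ℓ) := by
        calc |pu| = |P + (pu - P)| := by ring_nf
          _ ≤ |P| + |pu - P| := abs_add_le _ _
          _ ≤ _ := by linarith
      rw [abs_sub_comm y'] at j1
      have hℓ0 : 0 ≤ ℓ := hx₀ℓ.1.trans hx₀ℓ.2
      have j4 : 0 ≤ C * (1 + (|P| + η + κ * (1 + 2 * ℓ))) := by positivity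
      calc _ ≤ _ := j1
        _ ≤ _ := by gcongr
    have i5 : U₁ x + W y - κ * ℓ - 2 * η ≤ U x' + W y' := by
      have j1 := (abs_lt.1 h3).1
      have j2 := (abs_lt.1 h4).1
      have j3 : U₁ x' ≤ U x' + κ * ℓ := by
        have : κ * x' ≤ κ * ℓ := by gcongr; exact hx'ℓ.2
        have : 0 ≤ κ * (x' - x₀) ^ 2 := by positivity
        simp only [hU₁]; linarith
      linarith
    have i6 := mul_le_mul_of_nonneg_left i5 hlam.le
    have i7 : κ * a x' ≤ κ * A := by gcongr; exact hA x' hx'ℓ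
    linarith
  have hlim : ∀ F : ℝ → ℝ, Continuous F → Tendsto F (𝓝[>] 0) (𝓝 (F 0)) :=
    fun F hF => (hF.tendsto 0).mono_left nhdsWithin_le_nhds
  have := le_of_tendsto_of_tendsto (hlim _ (by fun_prop)) (hlim _ (by fun_prop)) key
  simp only [mul_zero, sub_zero, add_zero, zero_mul, zero_add] at this
  refine this.trans (le_of_eq ?_)
  ring

/-- Estimate of the maximum of `U + W`, for a subsolution `U` and a dual subsolution `W`, at a
point `x₀` which is either interior or (Soner's condition) an endpoint up to which `W` satisfies
the equation. -/
theorem le_of_isMax_add {lam : ℝ} {a : ℝ → ℝ} {H : ℝ → ℝ → ℝ} {ℓ C A : ℝ} {U W : ℝ → ℝ}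
    (hreg : EdgeRegular a H ℓ C) (hlam : 0 < lam) (hA : ∀ t ∈ Icc 0 ℓ, a t ≤ A)
    {c d x₀ κ ρ δ : ℝ} (hcd : Icc c d ⊆ Icc 0 ℓ) (hx₀ : x₀ ∈ Ioc c d) (hκ : 0 < κ) (hρ : 0 < ρ)
    (hU : SubOn lam a H U (Ioo c d)) (hUusc : UpperSemicontinuousOn U (Icc c d))
    (hWusc : UpperSemicontinuousOn W (Icc c d))
    (hW : ∀ y ∈ Icc c d, |y - x₀| < ρ → ∀ q Y : ℝ,
      (∀ᶠ s in 𝓝[Icc c d] y, W s ≤ W y + q * (s - y) + Y / 2 * (s - y) ^ 2) →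
      lam * W y - a y * Y + -H y (-q) ≤ 0)
    (hmax : ∀ s ∈ Icc c d, U s + W s + κ * s ≤ U x₀ + W x₀ + κ * x₀)
    {xs β : ℕ → ℝ} (hxs : ∀ n, xs n ∈ Icc c d) (hxs₀ : Tendsto xs atTop (𝓝 x₀))
    (huxs : Tendsto (fun n => U (xs n)) atTop (𝓝 (U x₀)))
    (hβ : ∀ n, 0 < β n) (hβ0 : Tendsto β atTop (𝓝 0))
    (hτ : ∀ n, (x₀ - xs n) ^ 2 ≤ δ ^ 2 * β n)
    (hcase : x₀ < d ∨ 0 < δ ∧ ∀ n, 0 ≤ x₀ - xs n ∧ (x₀ - xs n) ^ 2 = δ ^ 2 * β n) :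
    lam * (U x₀ + W x₀) ≤ κ * (lam * ℓ + 2 * A + C * (1 + 2 * ℓ)) +
      (4 * C ^ 2 + C / 2) * δ ^ 2 := by
  have hC := hreg.nonneg
  have hx₀' : x₀ ∈ Icc c d := Ioc_subset_Icc_self hx₀
  have hx₀ℓ := hcd hx₀'
  -- The quadratic term makes the maximum strict, at a cost proportional to `κ`.
  set U₁ : ℝ → ℝ := fun s => U s + κ * s - κ * (s - x₀) ^ 2 with hU₁
  have hU₁usc : UpperSemicontinuousOn U₁ (Icc c d) := by
    have e : U₁ = fun s => U s + (κ * s - κ * (s - x₀) ^ 2) := by ext s; simp only [hU₁]; ring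
    rw [e]
    exact hUusc.add (Continuous.upperSemicontinuous (by fun_prop) |>.upperSemicontinuousOn _)
  have hstrict : ∀ s ∈ Icc c d, s ≠ x₀ → U₁ s + W s < U₁ x₀ + W x₀ := by
    intro s hs hne
    have h1 := hmax s hs
    have h2 : 0 < κ * (s - x₀) ^ 2 := by
      have : 0 < (s - x₀) ^ 2 := by
        have : s - x₀ ≠ 0 := sub_ne_zero.2 hne
        positivity
      positivity
    simp only [hU₁, sub_self]
    linarith
  have huxs₁ : Tendsto (fun n => U₁ (xs n)) atTop (𝓝 (U₁ x₀)) :=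
    (huxs.add (hxs₀.const_mul κ)).sub (((hxs₀.sub_const x₀).pow 2).const_mul κ)
  have key : ∀ᶠ r in 𝓝[>] (0 : ℝ), lam * (U x₀ + W x₀ - r - κ * ℓ) ≤
      8 * C ^ 2 * r + 4 * C ^ 2 * δ ^ 2 + κ * (2 * A + C * (1 + 2 * ℓ)) +
      (C * (3 * r + δ ^ 2 / 2) + C * (1 + κ * (1 + 2 * ℓ)) * (2 * r)) := by
    have hs1 : ∀ᶠ r in 𝓝[>] (0 : ℝ), r < ρ ∧ r < x₀ - c ∧ (x₀ < d → r < d - x₀) ∧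
        (0 < δ → 2 * r < δ ^ 2) := by
      refine (eventually_lt_nhdsGT_zero hρ).and
        ((eventually_lt_nhdsGT_zero (by linarith [hx₀.1])).and (Eventually.and ?_ ?_))
      · by_cases h : x₀ < d
        · filter_upwards [eventually_lt_nhdsGT_zero (sub_pos.2 h)] with r hr _ using hr
        · exact Eventually.of_forall fun r hr => absurd hr h
      · by_cases h : 0 < δ
        · filter_upwards [eventually_lt_nhdsGT_zero (show 0 < δ ^ 2 / 2 by positivity)] with r hr _
          linarith
        · exact Eventually.of_forall fun r hr => absurd hr h
    filter_upwards [hs1, eventually_mem_nhdsWithin] with r ⟨hr1, hr2, hr3, hr4⟩ hr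
    have hr : 0 < r := hr
    obtain ⟨n, x, hx, y, hy, hm, h1, h2, h3, h4⟩ := exists_doubling_max isCompact_Icc hx₀'
      hU₁usc hWusc hstrict hxs hxs₀ huxs₁ hβ hβ0 hr
    have hβn := hβ n
    set τ := x₀ - xs n with hτdef
    have h3' : (x - y + τ) ^ 2 < 2 * β n * r := by
      rw [div_lt_iff₀ (by positivity)] at h3; linarith
    have hτn : τ ^ 2 ≤ δ ^ 2 * β n := hτ n
    have hxo : x ∈ Ioo c d := by
      have hh := abs_lt.1 h1
      refine ⟨by linarith, ?_⟩
      rcases hcase with hlt | ⟨hδ, hcase⟩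
      · linarith [hr3 hlt]
      · obtain ⟨hτ0, hτ2⟩ := hcase n
        -- Soner's argument: the penalty forces `(x - y + τ)² < 2 β r < δ² β = τ²`, hence `x < y ≤
        -- d`. The point carrying `U` stays off the endpoint although `y` may reach it.
        have : |x - y + τ| < τ := by
          apply abs_lt_of_sq_lt_sq _ hτ0
          rw [hτ2]
          nlinarith [hr4 hδ]
        linarith [(abs_lt.1 this).2, hy.2]
    have hmain := doubling_inequality hreg hlam hA hcd hx₀' hκ.le hU hUusc hWusc hW hβn hxo hy
      (h2.trans hr1) hm
    have e1 : (C * |x - y|) ^ 2 = C ^ 2 * (x - y) ^ 2 := by rw [mul_pow, sq_abs]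
    have i1 : (x - y) ^ 2 ≤ (4 * r + 2 * δ ^ 2) * β n := by
      nlinarith [sq_nonneg (x - y + 2 * τ)]
    have i2 : 2 / β n * (C * |x - y|) ^ 2 ≤ 8 * C ^ 2 * r + 4 * C ^ 2 * δ ^ 2 := by
      rw [e1]
      calc 2 / β n * (C ^ 2 * (x - y) ^ 2)
          ≤ 2 / β n * (C ^ 2 * ((4 * r + 2 * δ ^ 2) * β n)) := by gcongr
        _ = _ := by field_simp; ring
    have i3 : |(x - y + τ) / β n| * |x - y| ≤ 3 * r + δ ^ 2 / 2 := by
      rw [abs_div, abs_of_pos hβn, div_mul_eq_mul_div, div_le_iff₀ hβn]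
      have j1 : |x - y| ≤ |x - y + τ| + |τ| := by
        calc |x - y| = |(x - y + τ) - τ| := by ring_nf
          _ ≤ _ := abs_sub _ _
      have j2 : |x - y + τ| * |x - y| ≤ |x - y + τ| * (|x - y + τ| + |τ|) := by gcongr
      have j3 := sq_abs (x - y + τ)
      have j4 := sq_abs τ
      nlinarith [sq_nonneg (|x - y + τ| - |τ|)]
    have i4 : |x - y| ≤ 2 * r := by
      calc |x - y| = |(x - x₀) - (y - x₀)| := by ring_nf
        _ ≤ |x - x₀| + |y - x₀| := abs_sub _ _
        _ ≤ 2 * r := by linarith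
    have hℓ0 : 0 ≤ ℓ := hx₀ℓ.1.trans hx₀ℓ.2
    have i5 : C * (1 + |(x - y + τ) / β n| + κ * (1 + 2 * ℓ)) * |x - y| ≤
        C * (3 * r + δ ^ 2 / 2) + C * (1 + κ * (1 + 2 * ℓ)) * (2 * r) := by
      calc _ = C * (|(x - y + τ) / β n| * |x - y|) + C * (1 + κ * (1 + 2 * ℓ)) * |x - y| := by ring
        _ ≤ _ := by gcongr
    have i6 : U x₀ + W x₀ - r - κ * ℓ ≤ U₁ x + W y - κ * ℓ := by
      have : 0 ≤ κ * x₀ := mul_nonneg hκ.le hx₀ℓ.1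
      simp only [hU₁, sub_self] at h4 ⊢
      linarith
    have i7 := mul_le_mul_of_nonneg_left i6 hlam.le
    simp only [hU₁] at i7
    linarith
  have hlim : ∀ F : ℝ → ℝ, Continuous F → Tendsto F (𝓝[>] 0) (𝓝 (F 0)) :=
    fun F hF => (hF.tendsto 0).mono_left nhdsWithin_le_nhds
  have := le_of_tendsto_of_tendsto (hlim _ (by fun_prop)) (hlim _ (by fun_prop)) key
  simp only [mul_zero, sub_zero, add_zero, zero_add] at this
  linarith

/-! ### Geometry of the junction and test functions -/

namespace Junction

variable {d N : ℕ} (J : Junction d N)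

theorem len_pos (i : Fin N) : 0 < J.len i := norm_pos_iff.2 (J.vert_ne_zero i)

@[simp] theorem param_zero (i : Fin N) : J.param i 0 = 0 := by simp [param]

@[simp] theorem param_len (i : Fin N) : J.param i (J.len i) = J.vert i := by
  simp [param, div_self (J.len_pos i).ne']

theorem norm_param_sub (i : Fin N) (s t : ℝ) : ‖J.param i s - J.param i t‖ = |s - t| := by
  have h := J.len_pos i
  rw [param, param, ← sub_smul, norm_smul, ← sub_div, Real.norm_eq_abs, abs_div, abs_of_pos h]
  exact div_mul_cancel₀ _ h.ne'

theorem norm_param (i : Fin N) {t : ℝ} (ht : 0 ≤ t) : ‖J.param i t‖ = t := by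
  have := J.norm_param_sub i t 0
  rwa [param_zero, sub_zero, sub_zero, abs_of_nonneg ht] at this

theorem continuous_param (i : Fin N) : Continuous (J.param i) := by
  unfold param; fun_prop

theorem closedEdge_eq_image (i : Fin N) : J.closedEdge i = J.param i '' Icc 0 (J.len i) := by
  have h := J.len_pos i
  rw [closedEdge, segment_eq_image]
  ext x
  constructor
  · rintro ⟨θ, hθ, rfl⟩
    refine ⟨θ * J.len i, ⟨mul_nonneg hθ.1 h.le, mul_le_of_le_one_left h.le hθ.2⟩, ?_⟩
    simp [param, h.ne']
  · rintro ⟨t, ht, rfl⟩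
    refine ⟨t / J.len i, ⟨div_nonneg ht.1 h.le, div_le_one_of_le₀ ht.2 h.le⟩, ?_⟩
    simp [param]

theorem edge_eq_image (i : Fin N) : J.edge i = J.param i '' Ioo 0 (J.len i) := by
  have h := J.len_pos i
  rw [edge, openSegment_eq_image]
  ext x
  constructor
  · rintro ⟨θ, hθ, rfl⟩
    refine ⟨θ * J.len i, ⟨mul_pos hθ.1 h, mul_lt_of_lt_one_left h hθ.2⟩, ?_⟩
    simp [param, h.ne']
  · rintro ⟨t, ht, rfl⟩
    refine ⟨t / J.len i, ⟨div_pos ht.1 h, (div_lt_one h).2 ht.2⟩, ?_⟩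
    simp [param]

variable {J}

theorem param_mem_closedEdge {i : Fin N} {t : ℝ} (ht : t ∈ Icc 0 (J.len i)) :
    J.param i t ∈ J.closedEdge i := by
  rw [closedEdge_eq_image]; exact mem_image_of_mem _ ht

theorem param_mem_carrier {i : Fin N} {t : ℝ} (ht : t ∈ Icc 0 (J.len i)) :
    J.param i t ∈ J.carrier :=
  mem_iUnion.2 ⟨i, param_mem_closedEdge ht⟩

theorem param_mem_edge {i : Fin N} {t : ℝ} (ht : t ∈ Ioo 0 (J.len i)) :
    J.param i t ∈ J.edge i := by
  rw [edge_eq_image]; exact mem_image_of_mem _ ht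

theorem vert_mem_closedEdge (i : Fin N) : J.vert i ∈ J.closedEdge i := by
  rw [← param_len]
  exact param_mem_closedEdge ⟨(J.len_pos i).le, le_rfl⟩

theorem zero_mem_closedEdge (i : Fin N) : 0 ∈ J.closedEdge i := by
  rw [← J.param_zero i]
  exact param_mem_closedEdge ⟨le_rfl, (J.len_pos i).le⟩

theorem norm_mem_of_mem_closedEdge {i : Fin N} {x : EuclideanSpace ℝ (Fin d)}
    (hx : x ∈ J.closedEdge i) : ‖x‖ ∈ Icc 0 (J.len i) ∧ J.param i ‖x‖ = x := by
  rw [closedEdge_eq_image] at hx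
  obtain ⟨t, ht, rfl⟩ := hx
  rw [J.norm_param i ht.1]
  exact ⟨ht, rfl⟩

theorem norm_mem_of_mem_edge {i : Fin N} {x : EuclideanSpace ℝ (Fin d)}
    (hx : x ∈ J.edge i) : ‖x‖ ∈ Ioo 0 (J.len i) ∧ J.param i ‖x‖ = x := by
  rw [edge_eq_image] at hx
  obtain ⟨t, ht, rfl⟩ := hx
  rw [J.norm_param i ht.1.le]
  exact ⟨ht, rfl⟩

theorem edge_subset_closedEdge (i : Fin N) : J.edge i ⊆ J.closedEdge i :=
  openSegment_subset_segment ℝ _ _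

theorem closedEdge_subset_carrier (i : Fin N) : J.closedEdge i ⊆ J.carrier :=
  subset_iUnion J.closedEdge i

theorem isCompact_closedEdge (i : Fin N) : IsCompact (J.closedEdge i) := by
  rw [closedEdge_eq_image]
  exact isCompact_Icc.image (J.continuous_param i)

variable (J) in
theorem isCompact_carrier : IsCompact J.carrier :=
  isCompact_iUnion isCompact_closedEdge

/-- A common nonzero point would give a linear relation between the two vertices. -/
theorem eq_of_mem_closedEdge {i j : Fin N} {x : EuclideanSpace ℝ (Fin d)} (hx : x ≠ 0)
    (hi : x ∈ J.closedEdge i) (hj : x ∈ J.closedEdge j) : i = j := by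
  by_contra hij
  have hx0 : 0 < ‖x‖ := norm_pos_iff.2 hx
  have h1 := (norm_mem_of_mem_closedEdge hi).2
  have h2 := (norm_mem_of_mem_closedEdge hj).2
  have h3 := LinearIndependent.pair_iff.1 (J.not_collinear i j hij) (‖x‖ / J.len i)
    (-(‖x‖ / J.len j)) (by
      rw [neg_smul, ← sub_eq_add_neg, sub_eq_zero]
      exact h1.trans h2.symm)
  have := J.len_pos i
  have h4 : ‖x‖ / J.len i ≠ 0 := by positivity
  exact h4 h3.1

/-- Points of the junction are `O`, in an open edge, or boundary vertices. -/
theorem carrier_cases {x : EuclideanSpace ℝ (Fin d)} (hx : x ∈ J.carrier) :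
    x = 0 ∨ (∃ i, x ∈ J.edge i) ∨ ∃ i, x = J.vert i := by
  obtain ⟨i, hi⟩ := mem_iUnion.1 hx
  obtain ⟨h1, h2⟩ := norm_mem_of_mem_closedEdge hi
  rcases h1.1.eq_or_lt with h | h
  · left; exact norm_eq_zero.1 h.symm
  · rcases h1.2.eq_or_lt with h' | h'
    · right; right
      exact ⟨i, by rw [← h2, h', param_len]⟩
    · right; left
      exact ⟨i, by rw [← h2]; exact param_mem_edge ⟨h, h'⟩⟩

theorem not_mem_boundary_of_mem_edge {i : Fin N} {x : EuclideanSpace ℝ (Fin d)}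
    (hx : x ∈ J.edge i) : x ∉ J.boundary := by
  rintro ⟨j, rfl⟩
  have h := norm_mem_of_mem_edge hx
  have := eq_of_mem_closedEdge (J.vert_ne_zero j) (edge_subset_closedEdge i hx)
    (vert_mem_closedEdge j)
  subst this
  exact absurd h.1.2 (lt_irrefl _)

theorem zero_not_mem_boundary : (0 : EuclideanSpace ℝ (Fin d)) ∉ J.boundary := by
  rintro ⟨j, hj⟩
  exact J.vert_ne_zero j hj

theorem tendsto_param {i : Fin N} {t : ℝ} :
    Tendsto (J.param i) (𝓝[Icc 0 (J.len i)] t) (𝓝[J.closedEdge i] (J.param i t)) :=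
  ((J.continuous_param i).continuousWithinAt).tendsto_nhdsWithin
    (fun _ hs => param_mem_closedEdge hs)

theorem tendsto_param_carrier {i : Fin N} {t : ℝ} :
    Tendsto (J.param i) (𝓝[Icc 0 (J.len i)] t) (𝓝[J.carrier] (J.param i t)) :=
  tendsto_param.mono_right (nhdsWithin_mono _ (closedEdge_subset_carrier i))

theorem eventually_nhdsWithin_closedEdge {i : Fin N} {x : EuclideanSpace ℝ (Fin d)}
    {Q : EuclideanSpace ℝ (Fin d) → Prop}
    (h : ∀ᶠ s in 𝓝[Icc 0 (J.len i)] ‖x‖, Q (J.param i s)) : ∀ᶠ y in 𝓝[J.closedEdge i] x, Q y := by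
  have hlim : Tendsto (fun y => ‖y‖) (𝓝[J.closedEdge i] x) (𝓝[Icc 0 (J.len i)] ‖x‖) :=
    (continuous_norm.continuousWithinAt).tendsto_nhdsWithin
      (fun y hy => (norm_mem_of_mem_closedEdge hy).1)
  filter_upwards [hlim.eventually h, self_mem_nhdsWithin] with y hy hyi
  rwa [(norm_mem_of_mem_closedEdge hyi).2] at hy

/-- Neighborhoods in the junction are described edge by edge. -/
theorem eventually_nhdsWithin_carrier {x : EuclideanSpace ℝ (Fin d)}
    {Q : EuclideanSpace ℝ (Fin d) → Prop}
    (h : ∀ i, x ∈ J.closedEdge i → ∀ᶠ y in 𝓝[J.closedEdge i] x, Q y) :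
    ∀ᶠ y in 𝓝[J.carrier] x, Q y := by
  rw [carrier, nhdsWithin_iUnion, eventually_iSup]
  intro i
  by_cases hx : x ∈ J.closedEdge i
  · exact h i hx
  · have : 𝓝[J.closedEdge i] x = ⊥ := by
      rw [← notMem_closure_iff_nhdsWithin_eq_bot, (isCompact_closedEdge i).isClosed.closure_eq]
      exact hx
    rw [this]
    exact eventually_bot

theorem eventually_nhdsWithin_carrier_of_ne_zero {i : Fin N} {x : EuclideanSpace ℝ (Fin d)}
    (hx : x ∈ J.closedEdge i) (hx0 : x ≠ 0) {Q : EuclideanSpace ℝ (Fin d) → Prop}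
    (h : ∀ᶠ s in 𝓝[Icc 0 (J.len i)] ‖x‖, Q (J.param i s)) : ∀ᶠ y in 𝓝[J.carrier] x, Q y := by
  refine eventually_nhdsWithin_carrier fun j hj => ?_
  obtain rfl := eq_of_mem_closedEdge hx0 hx hj
  exact eventually_nhdsWithin_closedEdge h

theorem eventually_nhdsWithin_carrier_zero {Q : EuclideanSpace ℝ (Fin d) → Prop}
    (h : ∀ i, ∀ᶠ s in 𝓝[Icc 0 (J.len i)] (0 : ℝ), Q (J.param i s)) :
    ∀ᶠ y in 𝓝[J.carrier] 0, Q y := by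
  refine eventually_nhdsWithin_carrier fun j _ => eventually_nhdsWithin_closedEdge ?_
  rw [norm_zero]
  exact h j

open Classical in
/-- The function on the junction equal to `ψ i ‖x‖` on the `i`-th edge. -/
noncomputable def testFun (J : Junction d N) (ψ : Fin N → ℝ → ℝ)
    (x : EuclideanSpace ℝ (Fin d)) : ℝ :=
  if h : ∃ i, x ∈ J.closedEdge i then ψ h.choose ‖x‖ else 0

section TestFun

variable {ψ : Fin N → ℝ → ℝ} {c : ℝ}

/-- The edge picked by choice is the right one except possibly at `O`, where the common value `c`
makes the choice immaterial. -/
theorem testFun_apply (hψ : ∀ i, ψ i 0 = c) {i : Fin N} {x : EuclideanSpace ℝ (Fin d)}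
    (hx : x ∈ J.closedEdge i) : J.testFun ψ x = ψ i ‖x‖ := by
  have h : ∃ i, x ∈ J.closedEdge i := ⟨i, hx⟩
  rw [testFun, dif_pos h]
  by_cases hx0 : x = 0
  · have hn : ‖x‖ = 0 := norm_eq_zero.2 hx0
    rw [hn, hψ, hψ]
  · rw [eq_of_mem_closedEdge hx0 h.choose_spec hx]

theorem testFun_param (hψ : ∀ i, ψ i 0 = c) {i : Fin N} {t : ℝ} (ht : t ∈ Icc 0 (J.len i)) :
    J.testFun ψ (J.param i t) = ψ i t := by
  rw [testFun_apply hψ (param_mem_closedEdge ht), J.norm_param i ht.1]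

theorem eqOn_onEdge_testFun (hψ : ∀ i, ψ i 0 = c) (i : Fin N) :
    EqOn (J.onEdge (J.testFun ψ) i) (ψ i) (Icc 0 (J.len i)) :=
  fun _ ht => testFun_param hψ ht

theorem isC2_testFun (hψ : ∀ i, ψ i 0 = c) (hC : ∀ i, ContDiff ℝ 2 (ψ i)) :
    J.IsC2 (J.testFun ψ) := by
  refine ⟨?_, fun i => (hC i).contDiffOn.congr (eqOn_onEdge_testFun hψ i)⟩
  intro x hx
  rw [ContinuousWithinAt, carrier, nhdsWithin_iUnion, tendsto_iSup]
  intro i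
  by_cases hxi : x ∈ J.closedEdge i
  · rw [testFun_apply hψ hxi]
    have h1 : Tendsto (fun y => ψ i ‖y‖) (𝓝[J.closedEdge i] x) (𝓝 (ψ i ‖x‖)) :=
      (((hC i).continuous.comp continuous_norm).tendsto x).mono_left nhdsWithin_le_nhds
    refine h1.congr' ?_
    filter_upwards [self_mem_nhdsWithin] with y hy
    exact (testFun_apply hψ hy).symm
  · have : 𝓝[J.closedEdge i] x = ⊥ := by
      rw [← notMem_closure_iff_nhdsWithin_eq_bot, (isCompact_closedEdge i).isClosed.closure_eq]
      exact hxi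
    rw [this]
    exact tendsto_bot

theorem dx_testFun (hψ : ∀ i, ψ i 0 = c) (hC : ∀ i, ContDiff ℝ 2 (ψ i)) {i : Fin N}
    {x : EuclideanSpace ℝ (Fin d)} (hx : x ∈ J.closedEdge i) :
    J.dx (J.testFun ψ) i x = deriv (ψ i) ‖x‖ := by
  have hm := (norm_mem_of_mem_closedEdge hx).1
  rw [dx, derivWithin_congr (eqOn_onEdge_testFun hψ i) (eqOn_onEdge_testFun hψ i hm)]
  exact ((hC i).differentiable (by norm_num)).differentiableAt.derivWithin
    (uniqueDiffOn_Icc (J.len_pos i) _ hm)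

theorem dxx_testFun (hψ : ∀ i, ψ i 0 = c) (hC : ∀ i, ContDiff ℝ 2 (ψ i)) {i : Fin N}
    {x : EuclideanSpace ℝ (Fin d)} (hx : x ∈ J.closedEdge i) :
    J.dxx (J.testFun ψ) i x = iteratedDeriv 2 (ψ i) ‖x‖ := by
  have hm := (norm_mem_of_mem_closedEdge hx).1
  rw [dxx, iteratedDerivWithin_congr (eqOn_onEdge_testFun hψ i) hm]
  exact iteratedDerivWithin_eq_iteratedDeriv (uniqueDiffOn_Icc (J.len_pos i))
    (hC i).contDiffAt hm

end TestFun

end Junction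

theorem deriv_quadratic (b X m c : ℝ) :
    deriv (fun s : ℝ => b * (s - m) + X / 2 * (s - m) ^ 2 + c) = fun s => b + X * (s - m) := by
  ext s
  have h0 : HasDerivAt (fun s : ℝ => s - m) 1 s := (hasDerivAt_id s).sub_const m
  have h := (((h0.const_mul b).add ((h0.pow 2).const_mul (X / 2))).add_const c).deriv
  rw [show (fun s : ℝ => b * (s - m) + X / 2 * (s - m) ^ 2 + c) =
    fun x => ((fun y => b * (y - m)) + fun y => X / 2 * ((fun s => s - m) ^ 2) y) x + c from rfl, h]
  push_cast
  ring

theorem iteratedDeriv_two_quadratic (b X m c : ℝ) :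
    iteratedDeriv 2 (fun s : ℝ => b * (s - m) + X / 2 * (s - m) ^ 2 + c) = fun _ => X := by
  rw [iteratedDeriv_succ', iteratedDeriv_one, deriv_quadratic]
  ext s
  have h0 : HasDerivAt (fun s : ℝ => s - m) 1 s := (hasDerivAt_id s).sub_const m
  exact ((h0.const_mul X).const_add b).deriv.trans (mul_one X)

/-! ### Edgewise formulation and slopes at the junction point -/

section Network

variable {d N : ℕ}

/-- Subsolutions on the junction, edge by edge in arc-length coordinates, tested with quadratic
polynomials. `r` is the value at `O`. -/
structure NetSub (P : KirchhoffProblem d N) (J : Junction d N) (U : Fin N → ℝ → ℝ) (r : ℝ) :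
    Prop where
  zero : ∀ i, U i 0 = r
  usc : ∀ i, UpperSemicontinuousOn (U i) (Icc 0 (J.len i))
  edge : ∀ i, SubOn P.lam (fun t => P.a i (J.param i t)) (fun t p => P.H i (J.param i t) p) (U i)
    (Ioo 0 (J.len i))
  junction : ∀ p X : Fin N → ℝ, (∀ i, ∀ᶠ s in 𝓝[>] (0 : ℝ), U i s ≤ r + p i * s + X i / 2 * s ^ 2) →
    (∃ i, P.lam * r - P.a i 0 * X i + P.H i 0 (p i) ≤ 0) ∨ P.F r p ≤ 0
  vertex : ∀ i, ∀ p X : ℝ, (∀ᶠ s in 𝓝[Icc 0 (J.len i)] (J.len i),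
      U i s ≤ U i (J.len i) + p * (s - J.len i) + X / 2 * (s - J.len i) ^ 2) →
    P.lam * U i (J.len i) - P.a i (J.vert i) * X + P.H i (J.vert i) p ≤ 0 ∨
      U i (J.len i) ≤ P.h i

theorem eventually_nhdsWithin_Icc_of_nhdsGT {ℓ : ℝ} {Q : ℝ → Prop} (h0 : Q 0)
    (h : ∀ᶠ s in 𝓝[>] (0 : ℝ), Q s) : ∀ᶠ s in 𝓝[Icc 0 ℓ] (0 : ℝ), Q s := by
  rw [eventually_nhdsWithin_iff] at h ⊢
  filter_upwards [h] with s hs hmem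
  rcases hmem.1.eq_or_lt with h' | h'
  · rwa [← h']
  · exact hs h'

-- Every quadratic jet comes from a test function on the whole junction. Away from `O` only one edge
-- is nearby, so all edges may carry the same polynomial in the arc length. At `O`, polynomials with
-- different coefficients glue because they all vanish there.
open Junction in
theorem KirchhoffProblem.IsSubsolution.netSub {P : KirchhoffProblem d N} {J : Junction d N}
    {u : EuclideanSpace ℝ (Fin d) → ℝ} (hu : P.IsSubsolution J u) :
    NetSub P J (J.onEdge u) (u 0) := by
  have hC : ∀ b X m c : ℝ, ContDiff ℝ 2 (fun s : ℝ => b * (s - m) + X / 2 * (s - m) ^ 2 + c) := by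
    intro b X m c; fun_prop
  have hsub : ∀ i : Fin N, ∀ t ∈ Icc 0 (J.len i), t ≠ 0 → ∀ p X : ℝ,
      (∀ᶠ s in 𝓝[Icc 0 (J.len i)] t, J.onEdge u i s ≤
        J.onEdge u i t + p * (s - t) + X / 2 * (s - t) ^ 2) →
      ∃ φ, J.IsC2 φ ∧ IsLocalMaxOn (fun y => u y - φ y) J.carrier (J.param i t) ∧
        J.dx φ i (J.param i t) = p ∧ J.dxx φ i (J.param i t) = X := by
    intro i t ht ht0 p X hev
    set ψ : Fin N → ℝ → ℝ := fun _ s => p * (s - t) + X / 2 * (s - t) ^ 2 + 0 with hψ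
    have hψ0 : ∀ j, ψ j 0 = p * (0 - t) + X / 2 * (0 - t) ^ 2 + 0 := fun _ => rfl
    have hψC : ∀ j, ContDiff ℝ 2 (ψ j) := fun _ => hC _ _ _ _
    have hmem := param_mem_closedEdge ht
    have hne : J.param i t ≠ 0 := by
      rw [← norm_pos_iff, J.norm_param i ht.1]
      exact lt_of_le_of_ne ht.1 ht0.symm
    refine ⟨J.testFun ψ, isC2_testFun hψ0 hψC, ?_, ?_, ?_⟩
    · refine eventually_nhdsWithin_carrier_of_ne_zero hmem hne ?_
      rw [J.norm_param i ht.1]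
      filter_upwards [hev, self_mem_nhdsWithin] with s hs hsm
      rw [testFun_param hψ0 hsm, testFun_param hψ0 ht]
      simp only [hψ, onEdge] at hs ⊢
      simp only [sub_self]
      linarith
    · rw [dx_testFun hψ0 hψC hmem, J.norm_param i ht.1, deriv_quadratic]
      simp
    · rw [dxx_testFun hψ0 hψC hmem, J.norm_param i ht.1, iteratedDeriv_two_quadratic]
  refine ⟨fun i => by simp [onEdge], fun i => ?_, fun i t ht p X hev => ?_, fun p X hev => ?_,
    fun i p X hev => ?_⟩
  · exact hu.usc.comp (g := J.param i) (J.continuous_param i).continuousOn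
      (fun s hs => param_mem_carrier hs)
  · obtain ⟨φ, hφ, hmax, h1, h2⟩ := hsub i t (Ioo_subset_Icc_self ht) ht.1.ne' p X
      (hev.filter_mono nhdsWithin_le_nhds)
    have := hu.on_edge φ hφ i _ (param_mem_edge ht) hmax
    rw [h1, h2] at this
    exact this
  · set ψ : Fin N → ℝ → ℝ := fun i s => p i * (s - 0) + X i / 2 * (s - 0) ^ 2 + 0 with hψ
    have hψ0 : ∀ j, ψ j 0 = 0 := fun j => by simp [hψ]
    have hψC : ∀ j, ContDiff ℝ 2 (ψ j) := fun _ => hC _ _ _ _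
    have h := hu.at_junction (J.testFun ψ) (isC2_testFun hψ0 hψC) (by
      refine eventually_nhdsWithin_carrier_zero fun i => ?_
      refine eventually_nhdsWithin_Icc_of_nhdsGT (by simp) ?_
      filter_upwards [hev i, self_mem_nhdsWithin, eventually_lt_nhdsGT_zero (J.len_pos i)]
        with s hs hs0 hsl
      have hs0 : 0 < s := hs0
      rw [testFun_param hψ0 ⟨hs0.le, hsl.le⟩, testFun_apply hψ0 (zero_mem_closedEdge i), norm_zero,
        hψ0]
      simp only [hψ, onEdge] at hs ⊢
      linarith)
    have h1 : ∀ i, J.dx (J.testFun ψ) i 0 = p i := fun i => by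
      rw [dx_testFun hψ0 hψC (zero_mem_closedEdge i), norm_zero, deriv_quadratic]
      simp
    have h2 : ∀ i, J.dxx (J.testFun ψ) i 0 = X i := fun i => by
      rw [dxx_testFun hψ0 hψC (zero_mem_closedEdge i), norm_zero, iteratedDeriv_two_quadratic]
    simp only [h1, h2] at h
    exact h
  · obtain ⟨φ, hφ, hmax, h1, h2⟩ := hsub i (J.len i) ⟨(J.len_pos i).le, le_rfl⟩
      (J.len_pos i).ne' p X
      hev
    rw [param_len] at hmax h1 h2
    have := hu.at_boundary φ hφ i hmax
    rw [h1, h2] at this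
    rw [onEdge, param_len]
    rcases this with h | h
    · left; exact h
    · right; linarith

/-- At a positive maximum of `U + W + κ s` located at the endpoint `0`, where `U` is a subsolution
and `W` a dual subsolution, the slopes of `U` and of `-W` are strictly separated by slopes
`r < r'` violating the equations if `0` is degenerate. -/
theorem exists_separating_slopes {lam : ℝ} {a : ℝ → ℝ} {H : ℝ → ℝ → ℝ} {ℓ C κ : ℝ} {U W : ℝ → ℝ}
    (hreg : EdgeRegular a H ℓ C) (hℓ : 0 < ℓ) (hlam : 0 < lam)
    (hU : SubOn lam a H U (Ioo 0 ℓ)) (hUusc : UpperSemicontinuousOn U (Icc 0 ℓ))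
    (hW : SubOn lam a (fun t p => -H t (-p)) W (Ioo 0 ℓ))
    (hWusc : UpperSemicontinuousOn W (Icc 0 ℓ))
    (hco : a 0 = 0 → ∃ c > 0, ∀ p, c⁻¹ * |p| - c ≤ H 0 p)
    (hup : ∃ M, ∀ᶠ s in 𝓝[>] (0 : ℝ), U s ≤ U 0 + M * s)
    (hlow : ∃ m, ¬ ∀ᶠ s in 𝓝[>] (0 : ℝ), U s ≤ U 0 + m * s) (hκ : 0 < κ)
    (hmax : ∀ᶠ s in 𝓝[>] (0 : ℝ), U s + W s + κ * s ≤ U 0 + W 0) (hpos : 0 < U 0 + W 0) :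
    ∃ r r' : ℝ, r < r' ∧ (∃ r₁ < r, ∀ᶠ s in 𝓝[>] (0 : ℝ), U s ≤ U 0 + r₁ * s) ∧
      (∃ r₂ > r', ∀ᶠ s in 𝓝[>] (0 : ℝ), W s ≤ W 0 - r₂ * s) ∧
      (a 0 = 0 → 0 < lam * U 0 + H 0 r ∧ 0 < lam * W 0 - H 0 r') := by
  have h0 : (0 : ℝ) ∈ Icc 0 ℓ := left_mem_Icc.2 hℓ.le
  set D := {c : ℝ | ∀ᶠ s in 𝓝[>] (0 : ℝ), U s ≤ U 0 + c * s} with hD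
  have hDup : ∀ c ∈ D, ∀ c', c ≤ c' → c' ∈ D := by
    intro c hc c' hcc'
    filter_upwards [hc, eventually_mem_nhdsWithin] with s hs hs0
    have hs0 : 0 < s := hs0
    nlinarith
  have hDne : D.Nonempty := hup
  have hDbd : BddBelow D := by
    obtain ⟨m, hm⟩ := hlow
    refine ⟨m, fun c hc => ?_⟩
    by_contra! hlt
    exact hm (hDup c hc m hlt.le)
  -- `P` is the upper limit of the difference quotients of `U` at `0`, finite by `hup` and `hlow`.
  set P := sInf D with hP
  have hPgt : ∀ c, P < c → c ∈ D := by
    intro c hc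
    obtain ⟨c', hc', hlt⟩ := exists_lt_of_csInf_lt hDne hc
    exact hDup c' hc' c hlt.le
  have hPlt : ∀ c < P, ∃ᶠ s in 𝓝[>] (0 : ℝ), U 0 + c * s < U s := by
    intro c hc
    have : c ∉ D := notMem_of_lt_csInf hc hDbd
    simpa [hD] using this
  rcases (hreg.a_nonneg h0).eq_or_lt with ha | ha
  · -- degenerate endpoint
    have ha : a 0 = 0 := ha.symm
    have hPle : lam * U 0 + H 0 P ≤ 0 := by
      refine hU.le_zero_of_limsup_slope hreg hℓ hlam hUusc ha (fun η hη => ?_) (fun η hη => ?_)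
      · exact (hPlt (P - η) (by linarith)).mono fun s hs => hs.le
      · exact hPgt (P + η) (by linarith)
    set g : ℝ → ℝ := fun x => lam * U 0 + H 0 x with hg
    have hHc : Continuous (fun x => H 0 x) := by
      have : LipschitzWith (Real.toNNReal C) (fun x => H 0 x) :=
        LipschitzWith.of_dist_le_mul fun p q => by
          rw [Real.coe_toNNReal _ hreg.nonneg]
          exact hreg.lip_p 0 h0 p q
      exact this.continuous
    have hgc : Continuous g := by fun_prop
    -- The inequality sought for `U` at a slope `x` is `0 < g x`, the one for `W` is `g x < 2m`.
    -- Level `m` meets both with room, and positivity of `U 0 + W 0` opens the gap.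
    set m := lam * (U 0 + W 0) / 2 with hm
    have hm0 : 0 < m := by positivity
    -- the first point above `P` where `g` reaches the level `m`
    set A := {x : ℝ | P ≤ x ∧ m ≤ g x} with hA
    have hAcl : IsClosed A :=
      (isClosed_Ici).inter (isClosed_le continuous_const hgc)
    have hAne : A.Nonempty := by
      obtain ⟨c, hc, hcH⟩ := hco ha
      refine ⟨max P (c * (c + |m| + |lam * U 0|)), le_max_left _ _, ?_⟩
      have h1 : c * (c + |m| + |lam * U 0|) ≤ |max P (c * (c + |m| + |lam * U 0|))| :=
        (le_max_right _ _).trans (le_abs_self _)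
      have h2 := hcH (max P (c * (c + |m| + |lam * U 0|)))
      have h3 : c⁻¹ * (c * (c + |m| + |lam * U 0|)) ≤
          c⁻¹ * |max P (c * (c + |m| + |lam * U 0|))| := by gcongr
      rw [inv_mul_cancel_left₀ hc.ne'] at h3
      have h4 := le_abs_self m
      have h5 := neg_abs_le (lam * U 0)
      simp only [hg]
      linarith
    have hAbd : BddBelow A := ⟨P, fun x hx => hx.1⟩
    set R := sInf A with hR
    have hRmem : R ∈ A := hAcl.csInf_mem hAne hAbd
    have hRlt : ∀ x, P ≤ x → x < R → g x < m := by
      intro x hx hxR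
      by_contra! h
      exact absurd (csInf_le hAbd (show x ∈ A from ⟨hx, h⟩)) (not_le.2 hxR)
    have hPR : P < R := by
      refine lt_of_le_of_ne hRmem.1 fun h => ?_
      have := hRmem.2
      rw [← h] at this
      simp only [hg] at this
      linarith
    have hgR : g R = m := by
      refine le_antisymm ?_ hRmem.2
      have h1 : Tendsto g (𝓝[<] R) (𝓝 (g R)) := (hgc.tendsto R).mono_left nhdsWithin_le_nhds
      refine le_of_tendsto h1 ?_
      filter_upwards [Ioo_mem_nhdsLT hPR] with x hx
      exact (hRlt x hx.1.le hx.2).le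
    obtain ⟨e, he, heg⟩ := Metric.continuousAt_iff.1 (hgc.continuousAt (x := R)) (m / 2)
      (half_pos hm0)
    have hlt : ∀ x, P ≤ x → x ≤ R + e / 2 → g x < 2 * m := by
      intro x hx hxe
      rcases lt_or_ge x R with h | h
      · linarith [hRlt x hx h]
      · have h1 : dist x R < e := by rw [Real.dist_eq, abs_of_nonneg (by linarith)]; linarith
        have h2 := heg h1
        rw [hgR, Real.dist_eq] at h2
        linarith [(abs_lt.1 h2).2]
    refine ⟨R, R + e / 4, by linarith, ⟨(P + R) / 2, by linarith, hPgt _ (by linarith)⟩,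
      ⟨R + e / 2, by linarith, ?_⟩, fun _ => ⟨?_, ?_⟩⟩
    -- If `W` did not decrease at rate `R + e/2`, the smallest failing rate `q ≥ P` would give a
    -- slope `-q` between the lower and upper limits of the quotients of `W`. The equation for `W`
    -- would hold there, giving `g q ≥ 2m` with `q` in the range where `g < 2m`.
    · by_contra hcon
      set B := {ρ : ℝ | P ≤ ρ ∧ ¬ ∀ᶠ s in 𝓝[>] (0 : ℝ), W s ≤ W 0 - ρ * s} with hB
      have hBmem : R + e / 2 ∈ B := ⟨by linarith, hcon⟩
      have hBbd : BddBelow B := ⟨P, fun x hx => hx.1⟩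
      set q := sInf B with hq
      have hqP : P ≤ q := le_csInf ⟨_, hBmem⟩ fun x hx => hx.1
      have hqR : q ≤ R + e / 2 := csInf_le hBbd hBmem
      have hWq : lam * W 0 + -H 0 (-(-q)) ≤ 0 := by
        refine hW.le_zero_of_slope hreg.dual hℓ hlam hWusc ha (c := -q)
          (fun η hη => ?_) (fun η hη => ?_)
        · obtain ⟨ρ, hρ, hρq⟩ := exists_lt_of_csInf_lt ⟨_, hBmem⟩ (show q < q + η by linarith)
          have h1 := hρ.2
          rw [not_eventually] at h1
          refine (h1.and_eventually eventually_mem_nhdsWithin).mono fun s hs => ?_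
          have hs0 : 0 < s := hs.2
          have := hs.1
          nlinarith
        · by_cases hqη : P ≤ q - η / 2
          · have h1 : q - η / 2 ∉ B := fun h => by
              have := csInf_le hBbd h
              linarith
            have h2 : ∀ᶠ s in 𝓝[>] (0 : ℝ), W s ≤ W 0 - (q - η / 2) * s := by
              by_contra h; exact h1 ⟨hqη, h⟩
            refine Eventually.frequently ?_
            filter_upwards [h2, eventually_mem_nhdsWithin] with s hs hs0
            have hs0 : 0 < s := hs0
            nlinarith
          -- When `q` is close to `P`, the missing upper bound on `W` comes from the maximum of `U +
          -- W + κ s`, because `U` exceeds `U 0 + (P - κ) s` for arbitrarily small `s`.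
          · push Not at hqη
            refine ((hPlt (P - κ) (by linarith)).and_eventually
              (hmax.and eventually_mem_nhdsWithin)).mono fun s hs => ?_
            obtain ⟨h1, h2, h3⟩ := hs
            have h3 : 0 < s := h3
            nlinarith
      rw [neg_neg] at hWq
      have := hlt q hqP hqR
      simp only [hg] at this
      linarith
    · change 0 < g R
      rw [hgR]; exact hm0
    · have := hlt (R + e / 4) (by linarith) (by linarith)
      simp only [hg] at this
      linarith
  · -- nondegenerate endpoint
    refine ⟨P + κ / 4, P + κ / 2, by linarith, ⟨P + κ / 8, by linarith, hPgt _ (by linarith)⟩,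
      ⟨P + 3 * κ / 4, by linarith, ?_⟩, fun h => absurd h ha.ne'⟩
    -- Oscillation below `P` would give the equation with arbitrarily negative second derivative,
    -- which positive diffusion forbids. So the lower limit of the quotients is not far below `P`,
    -- and `κ` does the separation.
    have hlo : ∀ᶠ s in 𝓝[>] (0 : ℝ), U 0 + (P - κ / 8) * s ≤ U s := by
      by_contra hcon
      rw [not_eventually] at hcon
      have h1 := hU.le_zero_of_oscillation hreg hℓ hlam hUusc (c₁ := P - κ / 8) (c₂ := P - κ / 16)
        (K := (|lam * U 0 + H 0 (P - κ / 8)| + 1) / a 0) (by linarith)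
        (hcon.mono fun s hs => not_le.1 hs) (hPlt _ (by linarith)) (by positivity)
      rw [mul_div_cancel₀ _ ha.ne'] at h1
      have := neg_abs_le (lam * U 0 + H 0 (P - κ / 8))
      linarith
    filter_upwards [hlo, hmax, eventually_mem_nhdsWithin] with s h1 h2 h3
    have h3 : 0 < s := h3
    nlinarith

namespace KirchhoffProblem

/-- The problem satisfied by `-u`. -/
def dual (P : KirchhoffProblem d N) : KirchhoffProblem d N where
  lam := P.lam
  a := P.a
  H := fun i x p => -P.H i x (-p)
  F := fun r p => -P.F (-r) (fun i => -p i)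
  h := fun i => -P.h i

theorem exists_edgeRegular {P : KirchhoffProblem d N} {J : Junction d N} {i : Fin N}
    (hH : P.HamiltonianRegular J i) (ha : P.DiffusionRegular J i) :
    ∃ C, EdgeRegular (fun t => P.a i (J.param i t)) (fun t p => P.H i (J.param i t) p)
      (J.len i) C := by
  obtain ⟨C₁, h1, h2⟩ := hH
  obtain ⟨σ, C₂, h3, h4⟩ := ha
  refine ⟨max (max C₁ C₂) 0, le_max_right _ _, fun s hs t ht p => ?_, fun t ht p q => ?_,
    fun t => σ (J.param i t), fun t ht => h3 _ (Junction.param_mem_closedEdge ht),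
    fun s hs t ht => ?_⟩
  · have := h1 _ (Junction.param_mem_closedEdge hs) _ (Junction.param_mem_closedEdge ht) p
    rw [J.norm_param_sub] at this
    refine this.trans ?_
    gcongr
    exact (le_max_left _ _).trans (le_max_left _ _)
  · refine (h2 _ (Junction.param_mem_closedEdge ht) p q).trans ?_
    gcongr
    exact (le_max_left _ _).trans (le_max_left _ _)
  · have := h4 _ (Junction.param_mem_closedEdge hs) _ (Junction.param_mem_closedEdge ht)
    rw [J.norm_param_sub] at this
    refine this.trans ?_
    gcongr
    exact (le_max_right _ _).trans (le_max_left _ _)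

end KirchhoffProblem

/-! ### Junction and Dirichlet conditions for one subsolution -/

namespace NetSub

variable {P : KirchhoffProblem d N} {J : Junction d N} {U : Fin N → ℝ → ℝ} {r : ℝ}

/-- Upper bound for the difference quotients at `O`. -/
theorem exists_slope_le (hU : NetSub P J U r) (hlam : 0 < P.lam) {i : Fin N}
    (hH : P.HamiltonianRegular J i) (ha : P.DiffusionRegular J i)
    (hco : P.a i 0 = 0 → P.Coercive J i) {B : ℝ} (hB : ∀ t ∈ Icc 0 (J.len i), |U i t| ≤ B) :
    ∃ M, ∀ᶠ s in 𝓝[>] (0 : ℝ), U i s ≤ r + M * s := by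
  obtain ⟨C, hreg⟩ := KirchhoffProblem.exists_edgeRegular hH ha
  have hℓ := J.len_pos i
  obtain ⟨M, K, s₀, hs₀, -, hK, hle, -⟩ := (hU.edge i).exists_barrier hreg hℓ hlam (hU.usc i) hB (by
    rcases (hreg.a_nonneg (left_mem_Icc.2 hℓ.le)).eq_or_lt with h | h
    · right
      obtain ⟨c, hc, h'⟩ := hco (by simpa using h.symm)
      refine ⟨c, hc, ?_⟩
      filter_upwards [self_mem_nhdsWithin] with s hs p
      exact h' _ (Junction.param_mem_closedEdge hs) p
    · exact Or.inl h)
  refine ⟨M, ?_⟩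
  filter_upwards [eventually_mem_nhdsWithin, eventually_lt_nhdsGT_zero hs₀] with s hs hs'
  have hs : 0 < s := hs
  have := hle s ⟨hs.le, hs'.le⟩
  rw [hU.zero] at this
  have : 0 ≤ K / 2 * s ^ 2 := by positivity
  linarith

/-- Testing the junction condition with slopes slightly larger than the difference quotients. -/
theorem kirchhoff_le (hU : NetSub P J U r) (ha : ∀ i, 0 ≤ P.a i 0) {p : Fin N → ℝ}
    (hp : ∀ i, ∃ p' < p i, ∀ᶠ s in 𝓝[>] (0 : ℝ), U i s ≤ r + p' * s)
    (hdeg : ∀ i, P.a i 0 = 0 → 0 < P.lam * r + P.H i 0 (p i)) : P.F r p ≤ 0 := by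
  -- Where `a_i(O) > 0`, a very negative second derivative makes the edge equation fail. On
  -- degenerate edges division by zero gives `X i = 0`; there `hdeg` excludes the equation. The gap
  -- between `p'` and `p i` absorbs the quadratic term near `0`.
  set X : Fin N → ℝ := fun i => -((|P.lam * r + P.H i 0 (p i)| + 1) / P.a i 0) with hX
  have h := hU.junction p X (fun i => by
    obtain ⟨p', hp', hev⟩ := hp i
    have hX0 : X i ≤ 0 := by
      have := ha i
      simp only [hX]
      have : 0 ≤ (|P.lam * r + P.H i 0 (p i)| + 1) / P.a i 0 := by positivity
      linarith
    filter_upwards [hev, eventually_mem_nhdsWithin,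
      eventually_lt_nhdsGT_zero (show 0 < (p i - p') / (-X i / 2 + 1) from
        div_pos (by linarith) (by linarith))] with s h1 h2 h3
    have h2 : 0 < s := h2
    rw [lt_div_iff₀ (by linarith)] at h3
    nlinarith)
  refine h.resolve_left ?_
  rintro ⟨i, hi⟩
  rcases (ha i).eq_or_lt with h0 | h0
  · have := hdeg i h0.symm
    rw [← h0, zero_mul, sub_zero] at hi
    linarith
  · have e : P.a i 0 * X i = -(|P.lam * r + P.H i 0 (p i)| + 1) := by
      simp only [hX]
      field_simp
    rw [e] at hi
    have := neg_abs_le (P.lam * r + P.H i 0 (p i))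
    linarith

/-- Lower bound for the upper limit of the difference quotients at `O`. -/
theorem exists_slope_not_le (hU : NetSub P J U r) (ha : ∀ i, 0 ≤ P.a i 0)
    (hco : ∀ i, P.a i 0 = 0 → P.Coercive J i) (hF : P.KirchhoffRegular)
    (hslope : ∀ i, ∃ M, ∀ᶠ s in 𝓝[>] (0 : ℝ), U i s ≤ r + M * s) (i : Fin N) :
    ∃ m, ¬ ∀ᶠ s in 𝓝[>] (0 : ℝ), U i s ≤ r + m * s := by
  by_contra! hcon
  -- far enough slopes make the coercive Hamiltonians positive
  have hbig : ∀ j, ∃ R : ℝ, P.a j 0 = 0 → ∀ p, R ≤ |p| → 0 < P.lam * r + P.H j 0 p := by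
    intro j
    by_cases h0 : P.a j 0 = 0
    · obtain ⟨c, hc, h⟩ := hco j h0
      refine ⟨c * (c + |P.lam * r| + 1), fun _ p hp => ?_⟩
      have h1 := h 0 (Junction.zero_mem_closedEdge j) p
      have h2 : c⁻¹ * (c * (c + |P.lam * r| + 1)) ≤ c⁻¹ * |p| := by gcongr
      rw [inv_mul_cancel_left₀ hc.ne'] at h2
      have := neg_abs_le (P.lam * r)
      linarith
    · exact ⟨0, fun h => absurd h h0⟩
  choose R hR using hbig
  choose M hM using hslope
  set p : Fin N → ℝ := fun j => max (M j + 1) (R j) with hp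
  -- If the quotients along edge `i` tended to `-∞`, every very negative slope could be tested there
  -- with the other slopes fixed, contradicting coercivity of `F`.
  have hev : ∀ᶠ t in atBot, P.F r (Function.update p i t) ≤ 0 := by
    filter_upwards [eventually_le_atBot (-|R i|)] with t ht
    refine hU.kirchhoff_le ha (fun j => ?_) (fun j hj => ?_)
    · by_cases hji : j = i
      · subst hji
        exact ⟨t - 1, by simp, hcon _⟩
      · rw [Function.update_of_ne hji]
        exact ⟨M j, lt_of_lt_of_le (by linarith) (le_max_left _ _), hM j⟩
    · by_cases hji : j = i
      · subst hji
        rw [Function.update_self]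
        refine hR j hj t ?_
        have h1 := le_abs_self (R j)
        have h2 := neg_abs_le t
        have h3 := neg_le_abs t
        linarith
      · rw [Function.update_of_ne hji]
        exact hR j hj _ ((le_max_right _ _).trans (le_abs_self _))
  obtain ⟨t, h1, h2⟩ := (hev.and ((hF.coercive i r p).eventually_gt_atTop 0)).exists
  linarith

/-- Dirichlet condition: a subsolution lies below the boundary value. -/
theorem vertex_le (hU : NetSub P J U r) (hlam : 0 < P.lam) {i : Fin N}
    (hH : P.HamiltonianRegular J i) (ha : P.DiffusionRegular J i)
    (hco : 0 < P.a i (J.vert i) ∨ P.CoerciveNearBoundary J i) {B : ℝ}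
    (hB : ∀ t ∈ Icc 0 (J.len i), |U i t| ≤ B) : U i (J.len i) ≤ P.h i := by
  obtain ⟨C, hreg⟩ := KirchhoffProblem.exists_edgeRegular hH ha
  have hℓ := J.len_pos i
  have hmem : ∀ t ∈ Icc 0 (J.len i), J.len i - t ∈ Icc 0 (J.len i) :=
    fun t ht => ⟨by linarith [ht.2], by linarith [ht.1]⟩
  have hlim : Tendsto (fun s => J.len i - s) (𝓝[Icc 0 (J.len i)] (J.len i))
      (𝓝[Icc 0 (J.len i)] 0) := by
    refine tendsto_nhdsWithin_iff.2 ⟨?_, ?_⟩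
    · have : Continuous (fun s : ℝ => J.len i - s) := by fun_prop
      have := this.tendsto (J.len i)
      rw [sub_self] at this
      exact this.mono_left nhdsWithin_le_nhds
    · filter_upwards [self_mem_nhdsWithin] with s hs using hmem s hs
  have husc : UpperSemicontinuousOn (fun t => U i (J.len i - t)) (Icc 0 (J.len i)) :=
    (hU.usc i).comp (g := fun t => J.len i - t) (by fun_prop) hmem
  obtain ⟨M, K, s₀, hs₀, hs₀ℓ, hK, hle, hG⟩ := (hU.edge i).reverse.exists_barrier hreg.reverse hℓ
    hlam husc (B := B) (fun t ht => hB _ (hmem t ht)) (by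
      simp only [sub_zero, Junction.param_len]
      refine hco.imp id ?_
      rintro ⟨c, hc, h⟩
      refine ⟨c, hc, ?_⟩
      have ht : Tendsto (fun s => J.param i (J.len i - s)) (𝓝[Icc 0 (J.len i)] 0)
          (𝓝[J.closedEdge i] (J.vert i)) := by
        have h1 : Tendsto (fun s => J.len i - s) (𝓝[Icc 0 (J.len i)] 0)
            (𝓝[Icc 0 (J.len i)] (J.len i)) := by
          refine tendsto_nhdsWithin_iff.2 ⟨?_, ?_⟩
          · have : Continuous (fun s : ℝ => J.len i - s) := by fun_prop
            have := this.tendsto 0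
            rw [sub_zero] at this
            exact this.mono_left nhdsWithin_le_nhds
          · filter_upwards [self_mem_nhdsWithin] with s hs using hmem s hs
        have h2 := (Junction.tendsto_param (J := J) (i := i) (t := J.len i)).comp h1
        rwa [Junction.param_len] at h2
      filter_upwards [ht.eventually h] with s hs p
      have := hs (-p)
      rwa [abs_neg] at this)
  simp only [sub_zero, Junction.param_len] at hle hG
  -- Back in the original orientation the barrier is a test function at the vertex at which the
  -- equation fails strictly, so only the Dirichlet alternative survives.
  have hv := hU.vertex i (-M) (-K) (by
    have h1 : ∀ᶠ s in 𝓝[Icc 0 (J.len i)] (0 : ℝ), U i (J.len i - s) ≤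
        U i (J.len i) + M * s - K / 2 * s ^ 2 := by
      filter_upwards [self_mem_nhdsWithin,
        (eventually_lt_nhds hs₀).filter_mono nhdsWithin_le_nhds] with s hs hs'
      exact hle s ⟨hs.1, hs'.le⟩
    filter_upwards [hlim.eventually h1] with s hs
    rw [sub_sub_cancel] at hs
    linarith)
  refine hv.resolve_left ?_
  intro h
  linarith

end NetSub

namespace KirchhoffProblem

theorem HamiltonianRegular.dual {P : KirchhoffProblem d N} {J : Junction d N} {i : Fin N}
    (h : P.HamiltonianRegular J i) : P.dual.HamiltonianRegular J i := by
  obtain ⟨C, h1, h2⟩ := h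
  refine ⟨C, fun x hx y hy p => ?_, fun x hx p q => ?_⟩
  · have := h1 x hx y hy (-p)
    rw [abs_neg] at this
    simp only [KirchhoffProblem.dual]
    rwa [neg_sub_neg, abs_sub_comm]
  · have := h2 x hx (-p) (-q)
    simp only [KirchhoffProblem.dual]
    rwa [neg_sub_neg, abs_sub_comm (P.H i x (-q)), abs_sub_comm p, ← neg_sub_neg p q]

theorem DiffusionRegular.dual {P : KirchhoffProblem d N} {J : Junction d N} {i : Fin N}
    (h : P.DiffusionRegular J i) : P.dual.DiffusionRegular J i := h

theorem DiffusionRegular.a_nonneg {P : KirchhoffProblem d N} {J : Junction d N} {i : Fin N}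
    (h : P.DiffusionRegular J i) {x : EuclideanSpace ℝ (Fin d)} (hx : x ∈ J.closedEdge i) :
    0 ≤ P.a i x := by
  obtain ⟨σ, -, hσ, -⟩ := h
  rw [hσ x hx]; positivity

end KirchhoffProblem

/-! ### The comparison principle -/

namespace NetSub

variable {P : KirchhoffProblem d N} {J : Junction d N} {U W : Fin N → ℝ → ℝ} {r w : ℝ}

/-- A subsolution and a dual subsolution cannot have `U + W + κ |x|` maximal at `O` with a positive
value. -/
theorem add_nonpos_of_isMax_zero (hN : 1 ≤ N) (hP : P.StandingAssumptions J)
    (hU : NetSub P J U r) (hW : NetSub P.dual J W w) {B : ℝ}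
    (hUB : ∀ i, ∀ t ∈ Icc 0 (J.len i), |U i t| ≤ B) {κ : ℝ} (hκ : 0 < κ)
    (hmax : ∀ i, ∀ s ∈ Icc 0 (J.len i), U i s + W i s + κ * s ≤ r + w) : r + w ≤ 0 := by
  by_contra! hpos
  have ha : ∀ i, 0 ≤ P.a i 0 := fun i => (hP.diffusion i).a_nonneg (Junction.zero_mem_closedEdge i)
  have hslope : ∀ i, ∃ M, ∀ᶠ s in 𝓝[>] (0 : ℝ), U i s ≤ r + M * s := fun i =>
    hU.exists_slope_le hP.lam_pos (hP.hamiltonian i) (hP.diffusion i) (hP.coercive i) (hUB i)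
  have hsep : ∀ i, ∃ ρ ρ' : ℝ, ρ < ρ' ∧ (∃ r₁ < ρ, ∀ᶠ s in 𝓝[>] (0 : ℝ), U i s ≤ r + r₁ * s) ∧
      (∃ r₂ > ρ', ∀ᶠ s in 𝓝[>] (0 : ℝ), W i s ≤ w - r₂ * s) ∧
      (P.a i 0 = 0 → 0 < P.lam * r + P.H i 0 ρ ∧ 0 < P.lam * w - P.H i 0 ρ') := by
    intro i
    obtain ⟨C, hreg⟩ := KirchhoffProblem.exists_edgeRegular (hP.hamiltonian i) (hP.diffusion i)
    have h := exists_separating_slopes (κ := κ) hreg (J.len_pos i) hP.lam_pos (hU.edge i) (hU.usc i)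
      (hW.edge i) (hW.usc i)
    rw [hU.zero, hW.zero] at h
    simp only [Junction.param_zero] at h
    refine h (fun h0 => ?_) (hslope i)
      (hU.exists_slope_not_le ha hP.coercive hP.kirchhoff hslope i) hκ ?_ hpos
    · obtain ⟨c, hc, hco⟩ := hP.coercive i h0
      exact ⟨c, hc, hco 0 (Junction.zero_mem_closedEdge i)⟩
    · filter_upwards [eventually_mem_nhdsWithin, eventually_lt_nhdsGT_zero (J.len_pos i)]
        with s hs hs'
      exact hmax i s ⟨le_of_lt hs, hs'.le⟩
  choose ρ ρ' hlt h1 h2 h3 using hsep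
  have hF1 : P.F r ρ ≤ 0 := hU.kirchhoff_le ha h1 fun i hi => (h3 i hi).1
  have hF2 : P.dual.F w (fun i => -ρ' i) ≤ 0 := by
    refine hW.kirchhoff_le ha (fun i => ?_) fun i hi => ?_
    · obtain ⟨r₂, hr₂, hev⟩ := h2 i
      refine ⟨-r₂, by linarith, hev.mono fun s hs => by linarith⟩
    · have := (h3 i hi).2
      simp only [KirchhoffProblem.dual, neg_neg]
      linarith
  simp only [KirchhoffProblem.dual, neg_neg] at hF2
  -- The two tests give `F(r, ρ) ≤ 0 ≤ F(-w, ρ')`, whereas `r > -w` and `ρ < ρ'` force `F(-w, ρ') <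
  -- F(r, ρ)`.
  have := hP.kirchhoff.strict_monotone r (-w) ρ ρ' (by linarith) (fun i => (hlt i).le)
    ⟨⟨0, hN⟩, hlt _⟩
  linarith

/-- The estimate at an interior maximum point. -/
theorem le_of_isMax_interior (hlam : 0 < P.lam) (hU : NetSub P J U r) (hW : NetSub P.dual J W w)
    {i : Fin N} {C A κ t : ℝ}
    (hreg : EdgeRegular (fun t => P.a i (J.param i t)) (fun t p => P.H i (J.param i t) p)
      (J.len i) C) (hA : ∀ t ∈ Icc 0 (J.len i), P.a i (J.param i t) ≤ A) (hκ : 0 < κ)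
    (ht : t ∈ Ioo 0 (J.len i))
    (hmax : ∀ s ∈ Icc 0 (J.len i), U i s + W i s + κ * s ≤ U i t + W i t + κ * t) :
    P.lam * (U i t + W i t) ≤ κ * (P.lam * J.len i + 2 * A + C * (1 + 2 * J.len i)) := by
  have hcd : Icc (t / 2) ((t + J.len i) / 2) ⊆ Icc 0 (J.len i) :=
    Icc_subset_Icc (by linarith [ht.1]) (by linarith [ht.2])
  have hoo : Ioo (t / 2) ((t + J.len i) / 2) ⊆ Ioo 0 (J.len i) :=
    Ioo_subset_Ioo (by linarith [ht.1]) (by linarith [ht.2])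
  -- At an interior point no shift is needed: the sequence is constant and `δ = 0`.
  have h := le_of_isMax_add (δ := 0) (ρ := min (t / 2) ((J.len i - t) / 2)) hreg hlam hA hcd
    (x₀ := t) ⟨by linarith [ht.1], by linarith [ht.2]⟩ hκ
    (lt_min (by linarith [ht.1]) (by linarith [ht.2])) (fun s hs => hU.edge i s (hoo hs))
    ((hU.usc i).mono hcd) ((hW.usc i).mono hcd) (fun y hy hyt q Y hev => by
      have h1 := abs_lt.1 (hyt.trans_le (min_le_left _ _))
      have h2 := abs_lt.1 (hyt.trans_le (min_le_right _ _))
      have hyo : y ∈ Ioo (t / 2) ((t + J.len i) / 2) := ⟨by linarith, by linarith⟩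
      rw [nhdsWithin_eq_nhds.2 (Icc_mem_nhds hyo.1 hyo.2)] at hev
      exact hW.edge i y (hoo hyo) q Y hev)
    (fun s hs => hmax s (hcd hs)) (xs := fun _ => t) (β := fun n => 1 / ((n : ℝ) + 1))
    (fun _ => ⟨by linarith [ht.1], by linarith [ht.2]⟩) tendsto_const_nhds tendsto_const_nhds
    (fun n => by positivity) tendsto_one_div_add_atTop_nhds_zero_nat (fun n => by simp)
    (Or.inl (by linarith [ht.2]))
  simpa using h

/-- The estimate at a maximum point located at a vertex where the dual subsolution satisfies the
equation in the viscosity sense. -/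
theorem le_of_isMax_vertex (hlam : 0 < P.lam) (hU : NetSub P J U r) (hW : NetSub P.dual J W w)
    {i : Fin N} {C A κ : ℝ}
    (hreg : EdgeRegular (fun t => P.a i (J.param i t)) (fun t p => P.H i (J.param i t) p)
      (J.len i) C) (hA : ∀ t ∈ Icc 0 (J.len i), P.a i (J.param i t) ≤ A) (hκ : 0 < κ)
    (hfreq : ∀ c < U i (J.len i), ∃ᶠ s in 𝓝[<] (J.len i), c < U i s)
    (hWv : P.dual.h i < W i (J.len i))
    (hmax : ∀ s ∈ Icc 0 (J.len i),
      U i s + W i s + κ * s ≤ U i (J.len i) + W i (J.len i) + κ * J.len i) :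
    P.lam * (U i (J.len i) + W i (J.len i)) ≤
      κ * (P.lam * J.len i + 2 * A + C * (1 + 2 * J.len i)) := by
  set ℓ := J.len i with hℓdef
  have hℓ : 0 < ℓ := J.len_pos i
  have hcd : Icc (ℓ / 2) ℓ ⊆ Icc 0 ℓ := Icc_subset_Icc_left (by linarith)
  -- Interior points along which `U` tends to its vertex value; their distances to the vertex are
  -- the shifts of the penalization.
  have hseq : ∀ n : ℕ, ∃ s ∈ Ico (ℓ / 2) ℓ, ℓ - 1 / ((n : ℝ) + 1) < s ∧
      U i ℓ - 1 / ((n : ℝ) + 1) < U i s := by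
    intro n
    have hn : 0 < 1 / ((n : ℝ) + 1) := by positivity
    have hI : ∀ᶠ s in 𝓝[<] ℓ, s ∈ Ico (ℓ / 2) ℓ := Ico_mem_nhdsLT (by linarith)
    obtain ⟨s, h1, h2, h3⟩ := ((hfreq (U i ℓ - 1 / ((n : ℝ) + 1)) (by linarith)).and_eventually
      (hI.and
      ((eventually_gt_nhds (show ℓ - 1 / ((n : ℝ) + 1) < ℓ by linarith)).filter_mono
        nhdsWithin_le_nhds))).exists
    exact ⟨s, h2, h3, h1⟩
  choose xs hxs hxs1 hxs2 using hseq
  have hone := tendsto_one_div_add_atTop_nhds_zero_nat (𝕜 := ℝ)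
  have hxs₀ : Tendsto xs atTop (𝓝 ℓ) := by
    refine tendsto_of_tendsto_of_tendsto_of_le_of_le (g := fun n : ℕ => ℓ - 1 / ((n : ℝ) + 1))
      (h := fun _ => ℓ) ?_ tendsto_const_nhds (fun n => (hxs1 n).le) (fun n => (hxs n).2.le)
    simpa using hone.const_sub ℓ
  have hxsU : Tendsto (fun n => U i (xs n)) atTop (𝓝 (U i ℓ)) := by
    refine tendsto_order.2 ⟨fun c hc => ?_, fun c hc => ?_⟩
    · have : Tendsto (fun n : ℕ => U i ℓ - 1 / ((n : ℝ) + 1)) atTop (𝓝 (U i ℓ)) := by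
        simpa using hone.const_sub (U i ℓ)
      filter_upwards [this.eventually_const_lt hc] with n hn
      exact hn.trans (hxs2 n)
    · have h1 := hU.usc i ℓ ⟨hℓ.le, le_rfl⟩ c hc
      have h2 : Tendsto xs atTop (𝓝[Icc 0 ℓ] ℓ) := tendsto_nhdsWithin_iff.2
        ⟨hxs₀, Eventually.of_forall fun n => hcd ⟨(hxs n).1, (hxs n).2.le⟩⟩
      exact h2.eventually h1
  have key : ∀ᶠ δ in 𝓝[>] (0 : ℝ), P.lam * (U i ℓ + W i ℓ) ≤
      κ * (P.lam * ℓ + 2 * A + C * (1 + 2 * ℓ)) + (4 * C ^ 2 + C / 2) * δ ^ 2 := by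
    filter_upwards [eventually_mem_nhdsWithin] with δ hδ
    have hδ : 0 < δ := hδ
    -- Taking `β = τ²/δ²` for the shift `τ = ℓ - xs n` makes the shift strong enough to keep `x` off
    -- the vertex, while its cost is `O(δ²)` uniformly in `n`. Finally `δ → 0`.
    have e : ∀ n, (ℓ - xs n) ^ 2 = δ ^ 2 * ((ℓ - xs n) ^ 2 / δ ^ 2) := fun n => by field_simp
    refine le_of_isMax_add (ρ := ℓ / 2) (δ := δ) hreg hlam hA hcd
      (x₀ := ℓ) ⟨by linarith, le_rfl⟩ hκ (by linarith)
      (fun s hs => hU.edge i s ⟨by linarith [hs.1], hs.2⟩)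
      ((hU.usc i).mono hcd) ((hW.usc i).mono hcd) (fun y hy hyt q Y hev => ?_)
      (fun s hs => hmax s (hcd hs)) (xs := xs) (β := fun n => (ℓ - xs n) ^ 2 / δ ^ 2)
      (fun n => ⟨(hxs n).1, (hxs n).2.le⟩) hxs₀ hxsU
      (fun n => ?_) ?_ (fun n => (e n).le) (Or.inr ⟨hδ, fun n => ⟨?_, e n⟩⟩)
    · have h1 := abs_lt.1 hyt
      rcases hy.2.eq_or_lt with h | h
      · rw [h, nhdsWithin_Icc_eq_nhdsLE (show ℓ / 2 < ℓ by linarith),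
          ← nhdsWithin_Icc_eq_nhdsLE hℓ] at hev
        have h3 := (hW.vertex i q Y hev).resolve_right (not_le.2 hWv)
        rw [← Junction.param_len, ← hℓdef] at h3
        rw [h]
        exact h3
      · rw [nhdsWithin_eq_nhds.2 (Icc_mem_nhds (by linarith) h)] at hev
        exact hW.edge i y ⟨by linarith, h⟩ q Y hev
    · have : 0 < ℓ - xs n := by linarith [(hxs n).2]
      positivity
    · have := ((hxs₀.const_sub ℓ).pow 2).div_const (δ ^ 2)
      simpa using this
    · linarith [(hxs n).2]
  have hlim : Tendsto (fun δ : ℝ => κ * (P.lam * ℓ + 2 * A + C * (1 + 2 * ℓ)) +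
      (4 * C ^ 2 + C / 2) * δ ^ 2) (𝓝[>] 0) (𝓝 (κ * (P.lam * ℓ + 2 * A + C * (1 + 2 * ℓ)) +
      (4 * C ^ 2 + C / 2) * 0 ^ 2)) :=
    (Continuous.tendsto (by fun_prop) 0).mono_left nhdsWithin_le_nhds
  have := ge_of_tendsto hlim key
  simpa using this

/-- Replacement of the boundary values of a subsolution by its upper limits along the edges. -/
theorem update_vertex (hU : NetSub P J U r) (hv : ∀ i, U i (J.len i) ≤ P.h i) {B : ℝ}
    (hUB : ∀ i, ∀ t ∈ Icc 0 (J.len i), |U i t| ≤ B) :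
    ∃ V : Fin N → ℝ → ℝ, NetSub P J V r ∧ (∀ i, ∀ t ≠ J.len i, V i t = U i t) ∧
      (∀ i, ∀ t ∈ Icc 0 (J.len i), |V i t| ≤ B) ∧
      (∀ i, V i (J.len i) ≤ U i (J.len i)) ∧
      ∀ i, ∀ c < V i (J.len i), ∃ᶠ s in 𝓝[<] (J.len i), c < V i s := by
  have hmem : ∀ i, ∀ᶠ s in 𝓝[<] (J.len i), s ∈ Icc 0 (J.len i) := fun i => by
    filter_upwards [Ioo_mem_nhdsLT (J.len_pos i)] with s hs using Ioo_subset_Icc_self hs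
  have hne : ∀ i, ∀ᶠ s in 𝓝[<] (J.len i), s ≠ J.len i := fun i => by
    filter_upwards [eventually_mem_nhdsWithin] with s hs using (ne_of_lt hs)
  have hbd : ∀ i, ∀ᶠ s in 𝓝[<] (J.len i), |U i s| ≤ B := fun i =>
    (hmem i).mono fun s hs => hUB i s hs
  have hb1 : ∀ i, IsBoundedUnder (· ≤ ·) (𝓝[<] (J.len i)) (U i) := fun i =>
    ⟨B, (eventually_map.2 ((hbd i).mono fun s hs => (abs_le.1 hs).2))⟩
  have hb2 : ∀ i, IsBoundedUnder (· ≥ ·) (𝓝[<] (J.len i)) (U i) := fun i =>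
    ⟨-B, (eventually_map.2 ((hbd i).mono fun s hs => (abs_le.1 hs).1))⟩
  -- Lowering the vertex values to these limits preserves upper semicontinuity, and the Dirichlet
  -- alternative remains true since `L i ≤ U i (J.len i) ≤ P.h i`.
  set L : Fin N → ℝ := fun i => limsup (U i) (𝓝[<] (J.len i)) with hL
  have hLU : ∀ i, L i ≤ U i (J.len i) := by
    intro i
    refine le_of_forall_gt_imp_ge_of_dense fun c hc => ?_
    refine limsup_le_of_le (hb2 i).isCoboundedUnder_le ?_
    have h1 := hU.usc i (J.len i) ⟨(J.len_pos i).le, le_rfl⟩ c hc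
    rw [nhdsWithin_Icc_eq_nhdsLE (J.len_pos i)] at h1
    exact (h1.filter_mono (nhdsWithin_mono _ Iio_subset_Iic_self)).mono fun s hs => hs.le
  set V : Fin N → ℝ → ℝ := fun i => Function.update (U i) (J.len i) (L i) with hV
  have hVne : ∀ i, ∀ t ≠ J.len i, V i t = U i t := fun i t ht => Function.update_of_ne ht _ _
  have hVl : ∀ i, V i (J.len i) = L i := fun i => Function.update_self _ _ _
  have hVev : ∀ i, ∀ t < J.len i, ∀ᶠ s in 𝓝 t, V i s = U i s := fun i t ht =>
    (eventually_lt_nhds ht).mono fun s hs => hVne i s hs.ne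
  refine ⟨V, ⟨fun i => ?_, fun i t ht => ?_, fun i t ht p X hev => ?_, fun p X hev => ?_,
    fun i p X hev => Or.inr ?_⟩, hVne, fun i t ht => ?_, fun i => (hVl i).trans_le (hLU i),
    fun i c hc => ?_⟩
  · rw [hVne i 0 (J.len_pos i).ne, hU.zero]
  · rcases ht.2.eq_or_lt with h | h
    · intro c hc
      rw [h, hVl] at hc
      rw [h, nhdsWithin_Icc_eq_nhdsLE (J.len_pos i), ← Iio_insert, nhdsWithin_insert,
        eventually_sup]
      refine ⟨eventually_pure.2 ?_, ?_⟩
      · change V i (J.len i) < c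
        rw [hVl]; exact hc
      filter_upwards [eventually_lt_of_limsup_lt hc (hb1 i), hne i] with s hs hs'
      rwa [hVne i s hs']
    · intro c hc
      rw [hVne i t h.ne] at hc
      filter_upwards [hU.usc i t ht c hc, (hVev i t h).filter_mono nhdsWithin_le_nhds] with s h1 h2
      rwa [h2]
  · rw [hVne i t ht.2.ne] at hev ⊢
    refine hU.edge i t ht p X ?_
    filter_upwards [hev, hVev i t ht.2] with s h1 h2
    rwa [h2] at h1
  · refine hU.junction p X fun i => ?_
    filter_upwards [hev i, (hVev i 0 (J.len_pos i)).filter_mono nhdsWithin_le_nhds] with s h1 h2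
    rwa [h2] at h1
  · rw [hVl]; exact (hLU i).trans (hv i)
  · by_cases h : t = J.len i
    · rw [h, hVl, abs_le]
      constructor
      · exact le_limsup_of_frequently_le
          ((hbd i).mono fun s hs => (abs_le.1 hs).1).frequently (hb1 i)
      · exact limsup_le_of_le (hb2 i).isCoboundedUnder_le
          ((hbd i).mono fun s hs => (abs_le.1 hs).2)
    · rw [hVne i t h]; exact hUB i t ht
  · rw [hVl] at hc
    refine ((frequently_lt_of_lt_limsup (hb2 i).isCoboundedUnder_le hc).and_eventually
      (hne i)).mono fun s hs => ?_
    rw [hVne i s hs.2]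
    exact hs.1

/-- Comparison principle: a subsolution and a dual subsolution have nonpositive sum away from the
boundary vertices. -/
theorem add_nonpos (hN : 1 ≤ N) (hP : P.StandingAssumptions J) (hD : P.DirichletAssumption J)
    (hU : NetSub P J U r) (hW : NetSub P.dual J W w) {B : ℝ}
    (hUB : ∀ i, ∀ t ∈ Icc 0 (J.len i), |U i t| ≤ B)
    (hWB : ∀ i, ∀ t ∈ Icc 0 (J.len i), |W i t| ≤ B) :
    ∀ i, ∀ t ∈ Ico 0 (J.len i), U i t + W i t ≤ 0 := by
  have hv : ∀ i, U i (J.len i) ≤ P.h i := fun i =>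
    hU.vertex_le hP.lam_pos (hP.hamiltonian i) (hP.diffusion i) (hD i) (hUB i)
  obtain ⟨V, hV, hVU, hVB, hVle, hfreq⟩ := hU.update_vertex hv hUB
  choose C hreg using fun i =>
    KirchhoffProblem.exists_edgeRegular (hP.hamiltonian i) (hP.diffusion i)
  choose A hA0 hA using fun i => (hreg i).exists_a_le
  have hlam := hP.lam_pos
  -- Constants of the interior and vertex estimates divided by `λ`; the extra length accounts for
  -- the term `κ t`.
  set Q : Fin N → ℝ := fun i =>
    (P.lam * J.len i + 2 * A i + C i * (1 + 2 * J.len i)) / P.lam + J.len i with hQ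
  have hQ0 : ∀ i, 0 ≤ Q i := fun i => by
    have := (J.len_pos i).le
    have := hA0 i
    have := (hreg i).nonneg
    positivity
  have hQlen : ∀ i, J.len i ≤ Q i := fun i => by
    have := (J.len_pos i).le
    have := hA0 i
    have := (hreg i).nonneg
    have : 0 ≤ (P.lam * J.len i + 2 * A i + C i * (1 + 2 * J.len i)) / P.lam := by positivity
    simp only [hQ]; linarith
  have hmain : ∀ κ > 0, ∀ i, ∀ t ∈ Icc 0 (J.len i), V i t + W i t ≤ κ * ∑ j, Q j := by
    intro κ hκ
    have hmaxi : ∀ i, ∃ t ∈ Icc 0 (J.len i), ∀ s ∈ Icc 0 (J.len i),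
        V i s + W i s + κ * s ≤ V i t + W i t + κ * t := by
      intro i
      have husc : UpperSemicontinuousOn (fun s => V i s + W i s + κ * s) (Icc 0 (J.len i)) :=
        ((hV.usc i).add (hW.usc i)).add
          (Continuous.upperSemicontinuous (by fun_prop) |>.upperSemicontinuousOn _)
      obtain ⟨t, ht, h⟩ := husc.exists_isMaxOn (nonempty_Icc.2 (J.len_pos i).le) isCompact_Icc
      exact ⟨t, ht, fun s hs => h hs⟩
    choose T hT hTmax using hmaxi
    have : Nonempty (Fin N) := ⟨⟨0, hN⟩⟩
    obtain ⟨i, -, hi⟩ := Finset.exists_max_image Finset.univ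
      (fun i => V i (T i) + W i (T i) + κ * T i) Finset.univ_nonempty
    have hglob : ∀ j, ∀ s ∈ Icc 0 (J.len j),
        V j s + W j s + κ * s ≤ V i (T i) + W i (T i) + κ * T i := fun j s hs =>
      (hTmax j s hs).trans (hi j (Finset.mem_univ j))
    have hQi : Q i ≤ ∑ j, Q j := Finset.single_le_sum (fun j _ => hQ0 j) (Finset.mem_univ i)
    have hest : ∀ t, t ∈ Icc 0 (J.len i) → P.lam * (V i t + W i t) ≤
        κ * (P.lam * J.len i + 2 * A i + C i * (1 + 2 * J.len i)) →
        V i t + W i t + κ * t ≤ κ * Q i := by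
      intro t ht h
      have h1 : V i t + W i t ≤
          κ * (P.lam * J.len i + 2 * A i + C i * (1 + 2 * J.len i)) / P.lam := by
        rw [le_div_iff₀ hlam]; linarith
      have h2 : κ * t ≤ κ * J.len i := by gcongr; exact ht.2
      simp only [hQ]
      rw [mul_add, ← mul_div_assoc]
      linarith
    have hval : V i (T i) + W i (T i) + κ * T i ≤ κ * Q i := by
      rcases (hT i).1.eq_or_lt with h0 | h0
      · rw [← h0, hV.zero, hW.zero, mul_zero, add_zero]
        have := add_nonpos_of_isMax_zero hN hP hV hW hVB hκ (fun j s hs => by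
          have := hglob j s hs
          rwa [← h0, hV.zero, hW.zero, mul_zero, add_zero] at this)
        have := mul_nonneg hκ.le (hQ0 i)
        linarith
      · rcases (hT i).2.eq_or_lt with hl | hl
        · have hVh : V i (J.len i) ≤ P.h i := (hVle i).trans (hv i)
          -- Either both Dirichlet conditions hold and the sum is at most `h_i - h_i = 0`, or `W`
          -- satisfies the equation up to the vertex.
          by_cases hWh : W i (J.len i) ≤ P.dual.h i
          · rw [hl]
            have h1 : P.dual.h i = -P.h i := rfl
            have h2 : κ * J.len i ≤ κ * Q i := by gcongr; exact hQlen i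
            linarith
          · have ha : ¬ 0 < P.a i (J.vert i) := fun ha => hWh
              (hW.vertex_le hP.lam_pos (hP.hamiltonian i).dual (hP.diffusion i).dual (Or.inl ha)
                (hWB i))
            refine hest _ (hT i) ?_
            have hm := hTmax i
            rw [hl] at hm ⊢
            exact le_of_isMax_vertex hlam hV hW (hreg i) (hA i) hκ (hfreq i) (not_le.1 hWh) hm
        · exact hest _ (hT i) (le_of_isMax_interior hlam hV hW (hreg i) (hA i) hκ ⟨h0, hl⟩
            (hTmax i))
    intro j t ht
    have h1 := hglob j t ht
    have h2 : 0 ≤ κ * t := mul_nonneg hκ.le ht.1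
    have h3 : κ * Q i ≤ κ * ∑ j, Q j := by gcongr
    linarith
  intro i t ht
  rw [← hVU i t ht.2.ne]
  have hS : 0 ≤ ∑ j, Q j := Finset.sum_nonneg fun j _ => hQ0 j
  refine le_of_forall_pos_le_add fun e he => ?_
  have := hmain (e / (∑ j, Q j + 1)) (by positivity) i t ⟨ht.1, ht.2.le⟩
  refine this.trans ?_
  rw [zero_add, div_mul_eq_mul_div, div_le_iff₀ (by positivity)]
  nlinarith

end NetSub

/-! ### Duality and semicontinuous envelopes -/

variable {J : Junction d N}

namespace Junction

theorem IsC2.neg {φ : EuclideanSpace ℝ (Fin d) → ℝ} (h : J.IsC2 φ) : J.IsC2 (fun x => -φ x) :=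
  ⟨h.1.neg, fun i => (h.2 i).neg⟩

theorem dx_neg (φ : EuclideanSpace ℝ (Fin d) → ℝ) (i : Fin N) (x : EuclideanSpace ℝ (Fin d)) :
    J.dx (fun y => -φ y) i x = -J.dx φ i x :=
  derivWithin.fun_neg

theorem dxx_neg (φ : EuclideanSpace ℝ (Fin d) → ℝ) (i : Fin N) (x : EuclideanSpace ℝ (Fin d)) :
    J.dxx (fun y => -φ y) i x = -J.dxx φ i x :=
  iteratedDerivWithin_fun_neg _

theorem IsC2.continuousOn_dx {φ : EuclideanSpace ℝ (Fin d) → ℝ} (h : J.IsC2 φ) (i : Fin N) :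
    ContinuousOn (J.dx φ i) (J.closedEdge i) :=
  ((h.2 i).continuousOn_derivWithin (uniqueDiffOn_Icc (J.len_pos i)) (by norm_num)).comp
    continuous_norm.continuousOn fun _ hx => (norm_mem_of_mem_closedEdge hx).1

theorem IsC2.continuousOn_dxx {φ : EuclideanSpace ℝ (Fin d) → ℝ} (h : J.IsC2 φ) (i : Fin N) :
    ContinuousOn (J.dxx φ i) (J.closedEdge i) :=
  ((h.2 i).continuousOn_iteratedDerivWithin (m := 2) (by norm_num)
    (uniqueDiffOn_Icc (J.len_pos i))).comp
    continuous_norm.continuousOn fun _ hx => (norm_mem_of_mem_closedEdge hx).1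

theorem lscEnvelope_eq_neg (u : EuclideanSpace ℝ (Fin d) → ℝ) (x : EuclideanSpace ℝ (Fin d)) :
    J.lscEnvelope u x = -J.uscEnvelope (fun y => -u y) x := by
  rw [lscEnvelope, uscEnvelope, limsup_eq, liminf_eq, eq_comm, neg_eq_iff_eq_neg, ← Real.sInf_neg]
  congr 1
  ext a
  simp only [mem_ofPred_eq, Set.mem_neg]
  exact eventually_congr (Eventually.of_forall fun y => neg_le)

theorem IsLocallyBdd.exists_bound {u : EuclideanSpace ℝ (Fin d) → ℝ} (h : J.IsLocallyBdd u) :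
    ∃ B, ∀ x ∈ J.carrier, |u x| ≤ B := by
  refine J.isCompact_carrier.induction_on (p := fun s => ∃ B, ∀ x ∈ s, |u x| ≤ B) ⟨0, by simp⟩
    (fun s t hst ⟨B, hB⟩ => ⟨B, fun x hx => hB x (hst hx)⟩) ?_ ?_
  · rintro s t ⟨B, hB⟩ ⟨B', hB'⟩
    refine ⟨max B B', fun x hx => hx.elim (fun hx => (hB x hx).trans (le_max_left _ _))
      (fun hx => (hB' x hx).trans (le_max_right _ _))⟩
  · intro x hx
    obtain ⟨C, hC⟩ := h x hx
    exact ⟨_, hC, C, fun y hy => hy⟩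

theorem IsLocallyBdd.neg {u : EuclideanSpace ℝ (Fin d) → ℝ} (h : J.IsLocallyBdd u) :
    J.IsLocallyBdd (fun x => -u x) := by
  intro x hx
  obtain ⟨C, hC⟩ := h x hx
  exact ⟨C, by simpa only [abs_neg] using hC⟩

end Junction

section Limsup

variable {α : Type*} {l : Filter α} {f : α → ℝ} {B : ℝ}

theorem eventually_lt_of_limsup_lt_of_abs_le (hB : ∀ᶠ x in l, |f x| ≤ B) {c : ℝ}
    (hc : limsup f l < c) : ∀ᶠ x in l, f x < c :=
  eventually_lt_of_limsup_lt hc ⟨B, eventually_map.2 (hB.mono fun _ h => (abs_le.1 h).2)⟩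

theorem frequently_lt_of_lt_limsup_of_abs_le [l.NeBot] (hB : ∀ᶠ x in l, |f x| ≤ B) {c : ℝ}
    (hc : c < limsup f l) : ∃ᶠ x in l, c < f x := by
  have hb : IsBoundedUnder (· ≥ ·) l f := ⟨-B, eventually_map.2 (hB.mono fun _ h => (abs_le.1 h).1)⟩
  exact frequently_lt_of_lt_limsup hb.isCoboundedUnder_le hc

theorem abs_limsup_le_of_abs_le [l.NeBot] (hB : ∀ᶠ x in l, |f x| ≤ B) : |limsup f l| ≤ B := by
  rw [abs_le]
  constructor
  · by_contra! h
    obtain ⟨x, h1, h2⟩ := ((eventually_lt_of_limsup_lt_of_abs_le hB h).and hB).exists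
    linarith [(abs_le.1 h2).1]
  · by_contra! h
    obtain ⟨x, h1, h2⟩ := ((frequently_lt_of_lt_limsup_of_abs_le hB h).and_eventually hB).exists
    linarith [(abs_le.1 h2).2]

end Limsup

namespace Junction

theorem zero_mem_carrier (hN : 1 ≤ N) : 0 ∈ J.carrier :=
  closedEdge_subset_carrier ⟨0, hN⟩ (zero_mem_closedEdge _)

theorem eventually_mem_closedEdge {i : Fin N} {x : EuclideanSpace ℝ (Fin d)}
    (hx : x ∈ J.closedEdge i) (hx0 : x ≠ 0) : ∀ᶠ y in 𝓝[J.carrier] x, y ∈ J.closedEdge i :=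
  eventually_nhdsWithin_carrier_of_ne_zero hx hx0
    (eventually_mem_nhdsWithin.mono fun _ hs => param_mem_closedEdge hs)

theorem eventually_mem_edge {i : Fin N} {x : EuclideanSpace ℝ (Fin d)} (hx : x ∈ J.edge i) :
    ∀ᶠ y in 𝓝[J.carrier] x, y ∈ J.edge i := by
  have h := (norm_mem_of_mem_edge hx).1
  refine eventually_nhdsWithin_carrier_of_ne_zero (edge_subset_closedEdge i hx)
    (norm_pos_iff.1 h.1) ?_
  filter_upwards [mem_nhdsWithin_of_mem_nhds (Ioo_mem_nhds h.1 h.2)] with s hs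
  exact param_mem_edge hs

theorem neBot_nhdsWithin_carrier {x : EuclideanSpace ℝ (Fin d)} (hx : x ∈ J.carrier) :
    (𝓝[J.carrier] x).NeBot :=
  mem_closure_iff_nhdsWithin_neBot.1 (subset_closure hx)

section Envelope

variable {u : EuclideanSpace ℝ (Fin d) → ℝ} {B : ℝ}

theorem abs_uscEnvelope_le (hB : ∀ x ∈ J.carrier, |u x| ≤ B) {x : EuclideanSpace ℝ (Fin d)}
    (hx : x ∈ J.carrier) : |J.uscEnvelope u x| ≤ B := by
  have := neBot_nhdsWithin_carrier hx
  exact abs_limsup_le_of_abs_le (eventually_mem_nhdsWithin.mono hB)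

theorem le_uscEnvelope (hB : ∀ x ∈ J.carrier, |u x| ≤ B) {x : EuclideanSpace ℝ (Fin d)}
    (hx : x ∈ J.carrier) : u x ≤ J.uscEnvelope u x := by
  by_contra! h
  have := eventually_lt_of_limsup_lt_of_abs_le (eventually_mem_nhdsWithin.mono hB) h
  exact lt_irrefl _ (this.self_of_nhdsWithin hx)

theorem uscEnvelope_eq_of_continuousOn (hu : ContinuousOn u J.carrier)
    {x : EuclideanSpace ℝ (Fin d)} (hx : x ∈ J.carrier) : J.uscEnvelope u x = u x := by
  have := neBot_nhdsWithin_carrier hx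
  exact (hu x hx).limsup_eq

end Envelope

end Junction

namespace KirchhoffProblem

variable {P : KirchhoffProblem d N} {u v : EuclideanSpace ℝ (Fin d) → ℝ}

/-- Negation exchanges upper and lower tests and reverses every inequality, so all results on
subsolutions apply to supersolutions. -/
theorem isSubsolution_dual_iff :
    P.dual.IsSubsolution J (fun x => -v x) ↔ P.IsSupersolution J v := by
  have hG : ∀ i r p X x, P.dual.G i (-r) (-p) (-X) x = -P.G i r p X x := by
    intro i r p X x
    simp only [G, KirchhoffProblem.dual, neg_neg]
    ring
  have hext : ∀ {φ : EuclideanSpace ℝ (Fin d) → ℝ} {x},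
      IsLocalMaxOn (fun y => -v y - -φ y) J.carrier x ↔
        IsLocalMinOn (fun y => v y - φ y) J.carrier x := by
    intro φ x
    constructor <;> intro h <;> filter_upwards [h] with y hy <;> linarith
  have hF : ∀ r (p : Fin N → ℝ), P.dual.F (-r) (fun i => -p i) = -P.F r p := by
    intro r p
    simp only [KirchhoffProblem.dual, neg_neg]
  have hh : ∀ i, P.dual.h i = -P.h i := fun i => rfl
  constructor
  · intro h
    refine ⟨fun x hx c hc => ?_, fun φ hφ i x hx hm => ?_, fun φ hφ hm => ?_,
      fun φ hφ i hm => ?_⟩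
    · filter_upwards [h.usc x hx (-c) (neg_lt_neg hc)] with y hy using neg_lt_neg_iff.1 hy
    · have := h.on_edge _ hφ.neg i x hx (hext.2 hm)
      rw [Junction.dx_neg, Junction.dxx_neg, hG] at this
      linarith
    · have := h.at_junction _ hφ.neg (hext.2 hm)
      simp only [Junction.dx_neg, Junction.dxx_neg, hG, hF] at this
      exact this.imp (fun ⟨i, hi⟩ => ⟨i, by linarith⟩) (fun h => by linarith)
    · have := h.at_boundary _ hφ.neg i (hext.2 hm)
      rw [Junction.dx_neg, Junction.dxx_neg, hG, hh] at this
      exact this.imp (fun h => by linarith) (fun h => by linarith)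
  · intro h
    have hφ' : ∀ φ : EuclideanSpace ℝ (Fin d) → ℝ, φ = fun y => - -φ y := fun φ => by simp
    refine ⟨fun x hx c hc => ?_, fun φ hφ i x hx hm => ?_, fun φ hφ hm => ?_,
      fun φ hφ i hm => ?_⟩
    · filter_upwards [h.lsc x hx (-c) (neg_lt.1 hc)] with y hy using neg_lt.1 hy
    · rw [hφ' φ] at hm
      have := h.on_edge _ hφ.neg i x hx (hext.1 hm)
      rw [hφ' φ, Junction.dx_neg, Junction.dxx_neg, hG]
      linarith
    · have e1 : ∀ i, J.dx φ i 0 = -J.dx (fun y => -φ y) i 0 := fun i => by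
        rw [Junction.dx_neg, neg_neg]
      have e2 : ∀ i, J.dxx φ i 0 = -J.dxx (fun y => -φ y) i 0 := fun i => by
        rw [Junction.dxx_neg, neg_neg]
      rw [hφ' φ] at hm
      have := h.at_junction _ hφ.neg (hext.1 hm)
      simp only [e1, e2, hG, hF]
      exact this.imp (fun ⟨i, hi⟩ => ⟨i, by linarith⟩) (fun h => by linarith)
    · rw [hφ' φ] at hm
      have := h.at_boundary _ hφ.neg i (hext.1 hm)
      rw [hφ' φ, Junction.dx_neg, Junction.dxx_neg, hG, hh]
      exact this.imp (fun h => by linarith) (fun h => by linarith)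

theorem IsSolution.dual_sub (hu : P.IsSolution J u) :
    P.dual.IsSubsolution J (J.uscEnvelope fun x => -u x) := by
  have h := isSubsolution_dual_iff.2 hu.super
  simpa only [Junction.lscEnvelope_eq_neg, neg_neg] using h

theorem IsSubsolution.congr (hN : 1 ≤ N) (hu : P.IsSubsolution J u) (h : EqOn v u J.carrier) :
    P.IsSubsolution J v := by
  have hm : ∀ {φ : EuclideanSpace ℝ (Fin d) → ℝ} {x}, x ∈ J.carrier →
      IsLocalMaxOn (fun y => v y - φ y) J.carrier x →
        IsLocalMaxOn (fun y => u y - φ y) J.carrier x := by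
    intro φ x hx hm
    filter_upwards [hm, self_mem_nhdsWithin] with y hy hyc
    rwa [h hyc, h hx] at hy
  refine ⟨fun x hx c hc => ?_, fun φ hφ i x hx hmax => ?_, fun φ hφ hmax => ?_,
    fun φ hφ i hmax => ?_⟩
  · have hc : v x < c := hc
    rw [h hx] at hc
    filter_upwards [hu.usc x hx c hc, self_mem_nhdsWithin] with y hy hyc
    exact (h hyc).trans_lt hy
  · have hxc := Junction.closedEdge_subset_carrier i (Junction.edge_subset_closedEdge i hx)
    rw [h hxc]
    exact hu.on_edge φ hφ i x hx (hm hxc hmax)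
  · have hxc := Junction.zero_mem_carrier (J := J) hN
    rw [h hxc]
    exact hu.at_junction φ hφ (hm hxc hmax)
  · have hxc := Junction.closedEdge_subset_carrier (J := J) i (Junction.vert_mem_closedEdge i)
    rw [h hxc]
    exact hu.at_boundary φ hφ i (hm hxc hmax)

end KirchhoffProblem

/-! ### Half-relaxed limits -/

namespace Junction

/-- The upper half-relaxed limit as `ε → 0⁺`. -/
noncomputable def relaxedLimsup (J : Junction d N) (V : ℝ → EuclideanSpace ℝ (Fin d) → ℝ)
    (x : EuclideanSpace ℝ (Fin d)) : ℝ :=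
  limsup (fun z : ℝ × EuclideanSpace ℝ (Fin d) => V z.1 z.2) (𝓝[>] 0 ×ˢ 𝓝[J.carrier] x)

section Relaxed

variable {V : ℝ → EuclideanSpace ℝ (Fin d) → ℝ} {x : EuclideanSpace ℝ (Fin d)} {ε₀ B : ℝ}

theorem eventually_mem_prod (hε₀ : 0 < ε₀) (x : EuclideanSpace ℝ (Fin d)) :
    ∀ᶠ z : ℝ × EuclideanSpace ℝ (Fin d) in 𝓝[>] 0 ×ˢ 𝓝[J.carrier] x,
      z.1 ∈ Ioo 0 ε₀ ∧ z.2 ∈ J.carrier :=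
  (show ∀ᶠ ε in 𝓝[>] (0 : ℝ), ε ∈ Ioo 0 ε₀ from Ioo_mem_nhdsGT hε₀).prod_mk
    eventually_mem_nhdsWithin

theorem eventually_abs_le (hε₀ : 0 < ε₀) (hB : ∀ ε ∈ Ioo 0 ε₀, ∀ y ∈ J.carrier, |V ε y| ≤ B)
    (x : EuclideanSpace ℝ (Fin d)) :
    ∀ᶠ z : ℝ × EuclideanSpace ℝ (Fin d) in 𝓝[>] 0 ×ˢ 𝓝[J.carrier] x, |V z.1 z.2| ≤ B :=
  (eventually_mem_prod hε₀ x).mono fun z hz => hB z.1 hz.1 z.2 hz.2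

theorem abs_relaxedLimsup_le (hε₀ : 0 < ε₀)
    (hB : ∀ ε ∈ Ioo 0 ε₀, ∀ y ∈ J.carrier, |V ε y| ≤ B) (hx : x ∈ J.carrier) :
    |J.relaxedLimsup V x| ≤ B := by
  have := neBot_nhdsWithin_carrier hx
  exact abs_limsup_le_of_abs_le (eventually_abs_le hε₀ hB x)

theorem upperSemicontinuousOn_relaxedLimsup (hε₀ : 0 < ε₀)
    (hB : ∀ ε ∈ Ioo 0 ε₀, ∀ y ∈ J.carrier, |V ε y| ≤ B) :
    UpperSemicontinuousOn (J.relaxedLimsup V) J.carrier := by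
  intro x hx c hc
  obtain ⟨c', h1, h2⟩ := exists_between (show J.relaxedLimsup V x < c from hc)
  have h := eventually_lt_of_limsup_lt_of_abs_le (eventually_abs_le hε₀ hB x) h1
  obtain ⟨p, hp, q, hq, hpq⟩ := eventually_prod_iff.1 h
  filter_upwards [eventually_eventually_nhdsWithin.2 hq, eventually_mem_nhdsWithin] with y hy hyc
  refine lt_of_le_of_lt ?_ h2
  have := neBot_nhdsWithin_carrier hyc
  by_contra! hcon
  obtain ⟨z, hz1, hz2, hz3⟩ := ((frequently_lt_of_lt_limsup_of_abs_le (eventually_abs_le hε₀ hB y)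
    hcon).and_eventually (hp.prod_mk hy)).exists
  exact lt_asymm hz1 (hpq hz2 hz3)

end Relaxed

/-- Uniformity of an eventual property over a compact part of the junction. -/
theorem eventually_forall_of_isCompact {l : Filter ℝ} {A : Set (EuclideanSpace ℝ (Fin d))}
    (hA : IsCompact A) (hAc : A ⊆ J.carrier) {Q : ℝ → EuclideanSpace ℝ (Fin d) → Prop}
    (h : ∀ x ∈ A, ∀ᶠ z : ℝ × EuclideanSpace ℝ (Fin d) in l ×ˢ 𝓝[J.carrier] x, Q z.1 z.2) :
    ∀ᶠ ε in l, ∀ x ∈ A, Q ε x := by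
  refine hA.induction_on (p := fun s => ∀ᶠ ε in l, ∀ x ∈ s, Q ε x) (by simp)
    (fun s t hst ht => ht.mono fun ε hε x hx => hε x (hst hx))
    (fun s t hs ht => ?_) fun x hx => ?_
  · filter_upwards [hs, ht] with ε h1 h2 x hx
    exact hx.elim (h1 x) (h2 x)
  · obtain ⟨p, hp, q, hq, hpq⟩ := eventually_prod_iff.1 (h x hx)
    exact ⟨_, nhdsWithin_mono _ hAc hq, hp.mono fun ε hε y hy => hpq hε hy⟩

/-- Near a local maximum point of `V₀ - φ` with `V₀` the relaxed limit, there are local maximum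
points of `V ε - φ - |· - x₀|⁴`, along which the values converge. -/
theorem exists_seq_isLocalMaxOn {V : ℝ → EuclideanSpace ℝ (Fin d) → ℝ}
    {φ : EuclideanSpace ℝ (Fin d) → ℝ} {x₀ : EuclideanSpace ℝ (Fin d)} {ε₀ B : ℝ} (hε₀ : 0 < ε₀)
    (hB : ∀ ε ∈ Ioo 0 ε₀, ∀ y ∈ J.carrier, |V ε y| ≤ B)
    (husc : ∀ ε ∈ Ioo 0 ε₀, UpperSemicontinuousOn (V ε) J.carrier)
    (hφ : ContinuousOn φ J.carrier) (hx₀ : x₀ ∈ J.carrier)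
    (hmax : IsLocalMaxOn (fun y => J.relaxedLimsup V y - φ y) J.carrier x₀) :
    ∃ (e : ℕ → ℝ) (x : ℕ → EuclideanSpace ℝ (Fin d)), (∀ n, e n ∈ Ioo 0 ε₀) ∧
      (∀ n, x n ∈ J.carrier) ∧
      (∀ n, IsLocalMaxOn (fun y => V (e n) y - (φ y + ‖y - x₀‖ ^ 4)) J.carrier (x n)) ∧
      Tendsto e atTop (𝓝 0) ∧ Tendsto x atTop (𝓝 x₀) ∧
      Tendsto (fun n => V (e n) (x n)) atTop (𝓝 (J.relaxedLimsup V x₀)) := by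
  set M := J.relaxedLimsup V x₀ with hM
  -- The fourth power makes the maximum strict and leaves the first two derivatives at `x₀`
  -- unchanged.
  set ψ : EuclideanSpace ℝ (Fin d) → ℝ := fun y => φ y + ‖y - x₀‖ ^ 4 with hψ
  have hψc : ContinuousOn ψ J.carrier := hφ.add (by fun_prop)
  have hψ0 : ψ x₀ = φ x₀ := by simp [hψ]
  have hNB := neBot_nhdsWithin_carrier hx₀
  have key : ∀ δ > 0, ∃ ε ∈ Ioo 0 ε₀, ∃ x ∈ J.carrier, ε < δ ∧ ‖x - x₀‖ < δ ∧ |V ε x - M| < δ ∧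
      IsLocalMaxOn (fun y => V ε y - ψ y) J.carrier x := by
    intro δ hδ
    obtain ⟨ρ₁, hρ₁, hmaxρ⟩ := Metric.mem_nhdsWithin_iff.1 hmax
    obtain ⟨ρ₂, hρ₂, hψρ⟩ := Metric.mem_nhdsWithin_iff.1
      ((Metric.tendsto_nhds.1 (hψc x₀ hx₀)) (δ / 2) (by linarith))
    obtain ⟨ρ, hρ, hρlt⟩ := exists_between (show 0 < min (min ρ₁ ρ₂) δ by positivity)
    have hρ1 : ρ < ρ₁ := hρlt.trans_le ((min_le_left _ _).trans (min_le_left _ _))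
    have hρ2 : ρ < ρ₂ := hρlt.trans_le ((min_le_left _ _).trans (min_le_right _ _))
    have hρ3 : ρ < δ := hρlt.trans_le (min_le_right _ _)
    set S := J.carrier ∩ Metric.closedBall x₀ ρ with hS
    have hScomp : IsCompact S := J.isCompact_carrier.inter_right Metric.isClosed_closedBall
    set A := S ∩ {y | ρ ≤ ‖y - x₀‖} with hA
    have hAcomp : IsCompact A := hScomp.inter_right
      (isClosed_le continuous_const (by fun_prop))
    set η := min (ρ ^ 4 / 2) (δ / 4) with hη
    have hη0 : 0 < η := by positivity
    have hη1 : 2 * η ≤ ρ ^ 4 := by linarith [min_le_left (ρ ^ 4 / 2) (δ / 4)]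
    have hη2 : η ≤ δ / 4 := min_le_right _ _
    have hSval : ∀ y ∈ S, J.relaxedLimsup V y - φ y ≤ M - φ x₀ := fun y hy =>
      hmaxρ ⟨lt_of_le_of_lt (Metric.mem_closedBall.1 hy.2) hρ1, hy.1⟩
    have hgen : ∀ y ∈ J.carrier, ∀ c, J.relaxedLimsup V y - ψ y < c →
        ∀ᶠ z : ℝ × EuclideanSpace ℝ (Fin d) in 𝓝[>] 0 ×ˢ 𝓝[J.carrier] y, V z.1 z.2 - ψ z.2 < c := by
      intro y hy c hc
      set τ := (c - (J.relaxedLimsup V y - ψ y)) / 2 with hτ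
      have hτ0 : 0 < τ := by simp only [hτ]; linarith
      have h1 := eventually_lt_of_limsup_lt_of_abs_le (eventually_abs_le hε₀ hB y)
        (show J.relaxedLimsup V y < J.relaxedLimsup V y + τ by linarith)
      have h2 : ∀ᶠ z in 𝓝[J.carrier] y, ψ y - τ < ψ z :=
        (hψc y hy).eventually_const_lt (by linarith)
      filter_upwards [h1, h2.prod_inr (𝓝[>] (0 : ℝ))] with z hz1 hz2
      simp only [hτ] at hz1 hz2
      linarith
    -- On the sphere of radius `ρ` the limit loses `ρ⁴ ≥ 2η`. Half of this gap survives uniformly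
    -- for small `ε`, so maxima over the ball are attained strictly inside it.
    have hAev : ∀ᶠ ε in 𝓝[>] (0 : ℝ), ∀ y ∈ A, V ε y - ψ y < M - φ x₀ - η := by
      refine eventually_forall_of_isCompact (J := J)
        (Q := fun ε y => V ε y - ψ y < M - φ x₀ - η) hAcomp (fun y hy => hy.1.1)
        fun y hy => hgen y hy.1.1 _ ?_
      have h1 := hSval y hy.1
      have h2 : ρ ^ 4 ≤ ‖y - x₀‖ ^ 4 := by
        have : ρ ≤ ‖y - x₀‖ := hy.2
        gcongr
      simp only [hψ]
      linarith
    have hSev : ∀ᶠ ε in 𝓝[>] (0 : ℝ), ∀ y ∈ S, V ε y - ψ y < M - φ x₀ + η := by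
      refine eventually_forall_of_isCompact (J := J)
        (Q := fun ε y => V ε y - ψ y < M - φ x₀ + η) hScomp (fun y hy => hy.1)
        fun y hy => hgen y hy.1 _ ?_
      have h1 := hSval y hy
      have h2 : 0 ≤ ‖y - x₀‖ ^ 4 := by positivity
      simp only [hψ]
      linarith
    have hfreq := frequently_lt_of_lt_limsup_of_abs_le (eventually_abs_le hε₀ hB x₀)
      (show M - η / 2 < J.relaxedLimsup V x₀ by linarith)
    have hψlt : ∀ᶠ z in 𝓝[J.carrier] x₀, ψ z < φ x₀ + η / 2 :=
      (hψc x₀ hx₀).eventually_lt_const (by linarith)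
    have hball : ∀ᶠ z in 𝓝[J.carrier] x₀, z ∈ Metric.closedBall x₀ ρ :=
      mem_nhdsWithin_of_mem_nhds (Metric.closedBall_mem_nhds _ hρ)
    have hδev : ∀ᶠ ε in 𝓝[>] (0 : ℝ), ε < δ := eventually_lt_nhdsGT_zero hδ
    obtain ⟨⟨ε, z⟩, h1, ⟨hε, hz⟩, ⟨hA', hS', hεδ⟩, hz1, hz2⟩ := (hfreq.and_eventually
      ((eventually_mem_prod (J := J) hε₀ x₀).and
      ((hAev.and (hSev.and hδev)).prod_mk (hψlt.and hball)))).exists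
    simp only at h1 hε hz hA' hS' hεδ hz1 hz2
    have husc' : UpperSemicontinuousOn (fun y => V ε y - ψ y) S := by
      have h1 := (husc ε hε).mono (inter_subset_left : S ⊆ J.carrier)
      have h2 := (hψc.mono (inter_subset_left : S ⊆ J.carrier)).neg.upperSemicontinuousOn
      simp only [sub_eq_add_neg]
      exact h1.add h2
    obtain ⟨x, hxS, hx⟩ := husc'.exists_isMaxOn (show S.Nonempty from ⟨z, hz, hz2⟩) hScomp
    have hxz : V ε z - ψ z ≤ V ε x - ψ x := hx ⟨hz, hz2⟩
    have hlow : M - φ x₀ - η < V ε x - ψ x := by linarith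
    have hxρ : ‖x - x₀‖ < ρ := by
      by_contra! h
      have := hA' x ⟨hxS, h⟩
      linarith
    refine ⟨ε, hε, x, hxS.1, hεδ, hxρ.trans hρ3, ?_, ?_⟩
    · have h3 : dist (ψ x) (ψ x₀) < δ / 2 := hψρ
        ⟨by rw [Metric.mem_ball, dist_eq_norm]; exact hxρ.trans hρ2, hxS.1⟩
      rw [Real.dist_eq, abs_lt, hψ0] at h3
      have h4 := hS' x hxS
      rw [abs_lt]
      constructor <;> linarith
    · have : ∀ᶠ y in 𝓝[J.carrier] x, ‖y - x₀‖ < ρ :=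
        (Continuous.tendsto (by fun_prop : Continuous fun y => ‖y - x₀‖) x).eventually_lt_const hxρ
          |>.filter_mono nhdsWithin_le_nhds
      filter_upwards [this, eventually_mem_nhdsWithin] with y hy hyc
      exact hx ⟨hyc, by rw [Metric.mem_closedBall, dist_eq_norm]; exact hy.le⟩
  choose! e he x hx h1 h2 h3 h4 using fun n : ℕ => key (1 / ((n : ℝ) + 1)) (by positivity)
  have hone := tendsto_one_div_add_atTop_nhds_zero_nat (𝕜 := ℝ)
  refine ⟨e, x, he, hx, h4, ?_, ?_, ?_⟩
  · exact squeeze_zero (fun n => (he n).1.le) (fun n => (h1 n).le) hone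
  · rw [tendsto_iff_norm_sub_tendsto_zero]
    exact squeeze_zero (fun n => norm_nonneg _) (fun n => (h2 n).le) hone
  · rw [tendsto_iff_norm_sub_tendsto_zero]
    exact squeeze_zero (fun n => norm_nonneg _) (fun n => (h3 n).le) hone

section Quartic

theorem onEdge_norm_sub_pow {i : Fin N} {x₀ : EuclideanSpace ℝ (Fin d)}
    (hx₀ : x₀ ∈ J.closedEdge i) :
    J.onEdge (fun y => ‖y - x₀‖ ^ 4) i = fun t => (t - ‖x₀‖) ^ 4 := by
  ext t
  have h := (norm_mem_of_mem_closedEdge hx₀).2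
  rw [onEdge]
  nth_rewrite 1 [← h]
  rw [J.norm_param_sub]
  exact Even.pow_abs (by decide) _

theorem IsC2.add_norm_sub_pow {φ : EuclideanSpace ℝ (Fin d) → ℝ} (hφ : J.IsC2 φ)
    (x₀ : EuclideanSpace ℝ (Fin d)) : J.IsC2 (fun y => φ y + ‖y - x₀‖ ^ 4) := by
  refine ⟨hφ.1.add (by fun_prop), fun i => (hφ.2 i).add (ContDiff.contDiffOn ?_)⟩
  have h1 : ContDiff ℝ 2 (fun t => (‖J.param i t - x₀‖ ^ 2) ^ 2) := by
    unfold param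
    exact ((ContDiff.norm_sq ℝ (by fun_prop))).pow 2
  simpa only [← pow_mul] using h1

theorem dx_add_norm_sub_pow {φ : EuclideanSpace ℝ (Fin d) → ℝ} (hφ : J.IsC2 φ) {i : Fin N}
    {x₀ : EuclideanSpace ℝ (Fin d)} (hx₀ : x₀ ∈ J.closedEdge i) :
    J.dx (fun y => φ y + ‖y - x₀‖ ^ 4) i x₀ = J.dx φ i x₀ := by
  have hm := (norm_mem_of_mem_closedEdge hx₀).1
  have hu := uniqueDiffOn_Icc (J.len_pos i) _ hm
  have h0 : HasDerivAt (fun t : ℝ => (t - ‖x₀‖) ^ 4) 0 ‖x₀‖ := by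
    have := ((hasDerivAt_id ‖x₀‖).sub_const ‖x₀‖).fun_pow 4
    simpa using this
  rw [dx, show J.onEdge (fun y => φ y + ‖y - x₀‖ ^ 4) i =
    fun t => J.onEdge φ i t + J.onEdge (fun y => ‖y - x₀‖ ^ 4) i t from rfl,
    onEdge_norm_sub_pow hx₀, derivWithin_fun_add
      ((hφ.2 i).differentiableOn (by norm_num) _ hm) h0.differentiableAt.differentiableWithinAt,
    h0.hasDerivWithinAt.derivWithin hu, add_zero, dx]

theorem dxx_add_norm_sub_pow {φ : EuclideanSpace ℝ (Fin d) → ℝ} (hφ : J.IsC2 φ) {i : Fin N}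
    {x₀ : EuclideanSpace ℝ (Fin d)} (hx₀ : x₀ ∈ J.closedEdge i) :
    J.dxx (fun y => φ y + ‖y - x₀‖ ^ 4) i x₀ = J.dxx φ i x₀ := by
  have hm := (norm_mem_of_mem_closedEdge hx₀).1
  have hu := uniqueDiffOn_Icc (J.len_pos i)
  have hC : ContDiff ℝ 2 (fun t : ℝ => (t - ‖x₀‖) ^ 4) := by fun_prop
  have h0 : iteratedDeriv 2 (fun t : ℝ => (t - ‖x₀‖) ^ 4) ‖x₀‖ = 0 := by
    have h1 : deriv (fun t : ℝ => (t - ‖x₀‖) ^ 4) = fun t => 4 * (t - ‖x₀‖) ^ 3 := by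
      ext t
      simp
    rw [iteratedDeriv_succ', iteratedDeriv_one, h1]
    simp
  rw [dxx, show J.onEdge (fun y => φ y + ‖y - x₀‖ ^ 4) i =
    fun t => J.onEdge φ i t + J.onEdge (fun y => ‖y - x₀‖ ^ 4) i t from rfl,
    onEdge_norm_sub_pow hx₀, iteratedDerivWithin_fun_add hm hu (hφ.2 i _ hm)
      hC.contDiffAt.contDiffWithinAt,
    iteratedDerivWithin_eq_iteratedDeriv hu hC.contDiffAt hm, h0, add_zero, dxx]

end Quartic

end Junction

namespace KirchhoffProblem

variable {P : KirchhoffProblem d N}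

theorem DiffusionRegular.continuousOn {i : Fin N} (h : P.DiffusionRegular J i) :
    ContinuousOn (P.a i) (J.closedEdge i) := by
  obtain ⟨σ, C, h1, h2⟩ := h
  have : LipschitzOnWith (Real.toNNReal C) σ (J.closedEdge i) :=
    LipschitzOnWith.of_dist_le_mul fun x hx y hy => by
      rw [Real.dist_eq, dist_eq_norm]
      exact (h2 x hx y hy).trans (by gcongr; exact Real.le_coe_toNNReal C)
  exact (this.continuousOn.pow 2).congr h1

theorem HamiltonianRegular.tendsto {i : Fin N} (h : P.HamiltonianRegular J i) {α : Type*}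
    {l : Filter α} {x : α → EuclideanSpace ℝ (Fin d)} {p : α → ℝ}
    {x₀ : EuclideanSpace ℝ (Fin d)} {p₀ : ℝ} (hx₀ : x₀ ∈ J.closedEdge i)
    (hxm : ∀ᶠ n in l, x n ∈ J.closedEdge i) (hx : Tendsto x l (𝓝 x₀)) (hp : Tendsto p l (𝓝 p₀)) :
    Tendsto (fun n => P.H i (x n) (p n)) l (𝓝 (P.H i x₀ p₀)) := by
  obtain ⟨C, h1, h2⟩ := h
  rw [tendsto_iff_norm_sub_tendsto_zero]
  have hlim : Tendsto (fun n => C * |p n - p₀| + C * (1 + |p₀|) * ‖x n - x₀‖) l (𝓝 0) := by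
    have e1 := ((tendsto_iff_norm_sub_tendsto_zero.1 hp).const_mul C)
    have e2 := ((tendsto_iff_norm_sub_tendsto_zero.1 hx).const_mul (C * (1 + |p₀|)))
    simpa using e1.add e2
  refine squeeze_zero' (Eventually.of_forall fun n => norm_nonneg _) ?_ hlim
  filter_upwards [hxm] with n hn
  calc |P.H i (x n) (p n) - P.H i x₀ p₀|
      = |(P.H i (x n) (p n) - P.H i (x n) p₀) + (P.H i (x n) p₀ - P.H i x₀ p₀)| := by ring_nf
    _ ≤ |P.H i (x n) (p n) - P.H i (x n) p₀| + |P.H i (x n) p₀ - P.H i x₀ p₀| := abs_add_le _ _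
    _ ≤ _ := add_le_add (h2 _ hn _ _) (h1 _ hn _ hx₀ _)

theorem tendsto_G_addViscosity {i : Fin N} (hH : P.HamiltonianRegular J i)
    (ha : P.DiffusionRegular J i) {φ : EuclideanSpace ℝ (Fin d) → ℝ} (hφ : J.IsC2 φ) {α : Type*}
    {l : Filter α} {e r : α → ℝ} {x : α → EuclideanSpace ℝ (Fin d)}
    {x₀ : EuclideanSpace ℝ (Fin d)} {r₀ : ℝ} (hx₀ : x₀ ∈ J.closedEdge i)
    (hxm : ∀ᶠ n in l, x n ∈ J.closedEdge i) (hx : Tendsto x l (𝓝 x₀)) (he : Tendsto e l (𝓝 0))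
    (hr : Tendsto r l (𝓝 r₀)) :
    Tendsto (fun n => (P.addViscosity (e n)).G i (r n) (J.dx φ i (x n)) (J.dxx φ i (x n)) (x n)) l
      (𝓝 (P.G i r₀ (J.dx φ i x₀) (J.dxx φ i x₀) x₀)) := by
  have hx' : Tendsto x l (𝓝[J.closedEdge i] x₀) := tendsto_nhdsWithin_iff.2 ⟨hx, hxm⟩
  have h1 := (hφ.continuousOn_dx i x₀ hx₀).tendsto.comp hx'
  have h2 := (hφ.continuousOn_dxx i x₀ hx₀).tendsto.comp hx'
  have h3 := (ha.continuousOn x₀ hx₀).tendsto.comp hx'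
  have h4 := hH.tendsto hx₀ hxm hx h1
  have h5 := ((hr.const_mul P.lam).sub ((he.add h3).mul h2)).add h4
  rw [zero_add] at h5
  exact h5

/-- Stability: the upper half-relaxed limit of subsolutions of the regularized problems is a
subsolution. -/
theorem isSubsolution_relaxedLimsup (hN : 1 ≤ N) (hH : ∀ i, P.HamiltonianRegular J i)
    (ha : ∀ i, P.DiffusionRegular J i) (hF : Continuous fun z : ℝ × (Fin N → ℝ) => P.F z.1 z.2)
    {V : ℝ → EuclideanSpace ℝ (Fin d) → ℝ} {ε₀ B : ℝ} (hε₀ : 0 < ε₀)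
    (hB : ∀ ε ∈ Ioo 0 ε₀, ∀ y ∈ J.carrier, |V ε y| ≤ B)
    (hV : ∀ ε ∈ Ioo 0 ε₀, (P.addViscosity ε).IsSubsolution J (V ε)) :
    P.IsSubsolution J (J.relaxedLimsup V) := by
  have husc := fun ε hε => (hV ε hε).usc
  refine ⟨Junction.upperSemicontinuousOn_relaxedLimsup hε₀ hB, fun φ hφ i x₀ hx₀ hmax => ?_,
    fun φ hφ hmax => ?_, fun φ hφ i hmax => ?_⟩
  · have hx₀c := Junction.edge_subset_closedEdge i hx₀
    obtain ⟨e, x, he, hx, hm, he0, hx0, hV0⟩ := Junction.exists_seq_isLocalMaxOn hε₀ hB husc hφ.1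
      (Junction.closedEdge_subset_carrier i hx₀c) hmax
    have hxe : ∀ᶠ n in atTop, x n ∈ J.edge i :=
      (tendsto_nhdsWithin_iff.2 ⟨hx0, Eventually.of_forall hx⟩).eventually
        (Junction.eventually_mem_edge hx₀)
    have hlim := tendsto_G_addViscosity (hH i) (ha i) (hφ.add_norm_sub_pow x₀) hx₀c
      (hxe.mono fun n hn => Junction.edge_subset_closedEdge i hn) hx0 he0 hV0
    rw [Junction.dx_add_norm_sub_pow hφ hx₀c, Junction.dxx_add_norm_sub_pow hφ hx₀c] at hlim
    refine le_of_tendsto hlim (hxe.mono fun n hn => ?_)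
    exact (hV _ (he n)).on_edge _ (hφ.add_norm_sub_pow x₀) i _ hn (hm n)
  · by_contra! hcon
    obtain ⟨hG, hF0⟩ := hcon
    obtain ⟨e, x, he, hx, hm, he0, hx0, hV0⟩ := Junction.exists_seq_isLocalMaxOn hε₀ hB husc hφ.1
      (Junction.zero_mem_carrier hN) hmax
    set ψ : EuclideanSpace ℝ (Fin d) → ℝ := fun y => φ y + ‖y - 0‖ ^ 4 with hψ
    have hψC : J.IsC2 ψ := hφ.add_norm_sub_pow 0
    have hGev : ∀ i, ∀ᶠ n in atTop, x n ∈ J.closedEdge i →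
        0 < (P.addViscosity (e n)).G i (V (e n) (x n)) (J.dx ψ i (x n)) (J.dxx ψ i (x n))
          (x n) := by
      intro i
      have h0 := Junction.zero_mem_closedEdge (J := J) i
      -- The points may jump between edges as `n` varies. Restricting to the indices for which `x n`
      -- lies on edge `i` gives a meaningful limit of `G_i`, even if there are few such indices.
      have hle : atTop ⊓ 𝓟 {n | x n ∈ J.closedEdge i} ≤ atTop := inf_le_left
      have hlim := tendsto_G_addViscosity (l := atTop ⊓ 𝓟 {n | x n ∈ J.closedEdge i}) (hH i) (ha i)
        hψC h0 (mem_inf_of_right (mem_principal_self _)) (hx0.mono_left hle) (he0.mono_left hle)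
        (hV0.mono_left hle)
      rw [Junction.dx_add_norm_sub_pow hφ h0, Junction.dxx_add_norm_sub_pow hφ h0] at hlim
      exact eventually_inf_principal.1 (hlim.eventually_const_lt (hG i))
    have hFev : ∀ᶠ n in atTop, 0 < P.F (V (e n) (x n)) fun i => J.dx ψ i 0 := by
      have h1 : (fun i => J.dx ψ i 0) = fun i => J.dx φ i 0 := funext fun i =>
        Junction.dx_add_norm_sub_pow hφ (Junction.zero_mem_closedEdge i)
      rw [h1]
      exact ((hF.tendsto (_, _)).comp (hV0.prodMk_nhds tendsto_const_nhds)).eventually_const_lt hF0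
    have hvert : ∀ᶠ n in atTop, ∀ i, x n ≠ J.vert i := by
      rw [eventually_all]
      exact fun i => hx0.eventually_ne (J.vert_ne_zero i).symm
    obtain ⟨n, h1, h2, h3⟩ := ((eventually_all.2 hGev).and (hFev.and hvert)).exists
    rcases Junction.carrier_cases (hx n) with h | ⟨i, hi⟩ | ⟨i, hi⟩
    · have hm' := hm n
      rw [h] at hm' h1 h2
      rcases (hV _ (he n)).at_junction ψ hψC hm' with ⟨i, hi⟩ | h'
      · exact absurd hi (not_le.2 (h1 i (Junction.zero_mem_closedEdge i)))
      · exact absurd h' (not_le.2 h2)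
    · exact absurd ((hV _ (he n)).on_edge ψ hψC i _ hi (hm n))
        (not_le.2 (h1 i (Junction.edge_subset_closedEdge i hi)))
    · exact h3 i hi
  · by_contra! hcon
    obtain ⟨hG, hh⟩ := hcon
    have hv := Junction.vert_mem_closedEdge (J := J) i
    obtain ⟨e, x, he, hx, hm, he0, hx0, hV0⟩ := Junction.exists_seq_isLocalMaxOn hε₀ hB husc hφ.1
      (Junction.closedEdge_subset_carrier i hv) hmax
    have hψC := hφ.add_norm_sub_pow (J.vert i)
    have hxe : ∀ᶠ n in atTop, x n ∈ J.closedEdge i :=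
      (tendsto_nhdsWithin_iff.2 ⟨hx0, Eventually.of_forall hx⟩).eventually
        (Junction.eventually_mem_closedEdge hv (J.vert_ne_zero i))
    have hlim := tendsto_G_addViscosity (hH i) (ha i) hψC hv hxe hx0 he0 hV0
    rw [Junction.dx_add_norm_sub_pow hφ hv, Junction.dxx_add_norm_sub_pow hφ hv] at hlim
    obtain ⟨n, h1, h2, h3, h4⟩ := ((hlim.eventually_const_lt hG).and (hxe.and
      ((hV0.eventually_const_lt (show P.h i < _ by linarith)).and
        (hx0.eventually_ne (J.vert_ne_zero i))))).exists
    obtain ⟨hb, hp⟩ := Junction.norm_mem_of_mem_closedEdge h2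
    rcases hb.2.eq_or_lt with h | h
    · have hxv : x n = J.vert i := by rw [← hp, h, Junction.param_len]
      have hm' := hm n
      rw [hxv] at hm' h1 h3
      rcases (hV _ (he n)).at_boundary _ hψC i hm' with h' | h'
      · exact absurd h' (not_le.2 h1)
      · have h5 : (P.addViscosity (e n)).h i = P.h i := rfl
        linarith
    · have hxi : x n ∈ J.edge i := by
        rw [← hp]
        exact Junction.param_mem_edge ⟨norm_pos_iff.2 h4, h⟩
      exact absurd ((hV _ (he n)).on_edge _ hψC i _ hxi (hm n)) (not_le.2 h1)

end KirchhoffProblem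

/-! ### Uniform bounds -/

/-- The square root is the norm of `(√ε, s)`, so this is Cauchy–Schwarz. The regularized diffusions
`ε + σ²` thus have square roots with the same Lipschitz constant as `σ`. -/
theorem abs_sqrt_add_sq_sub_le {ε : ℝ} (hε : 0 ≤ ε) (s t : ℝ) :
    |√(ε + s ^ 2) - √(ε + t ^ 2)| ≤ |s - t| := by
  have hA : 0 ≤ ε + s ^ 2 := by positivity
  have hB : 0 ≤ ε + t ^ 2 := by positivity
  have hA2 := Real.sq_sqrt hA
  have hB2 := Real.sq_sqrt hB
  have h1 : ε + s * t ≤ √(ε + s ^ 2) * √(ε + t ^ 2) := by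
    rw [← Real.sqrt_mul hA]
    refine Real.le_sqrt_of_sq_le ?_
    nlinarith [mul_nonneg hε (sq_nonneg (s - t))]
  refine sq_le_sq.1 ?_
  nlinarith

namespace KirchhoffProblem

variable {P : KirchhoffProblem d N}

theorem DiffusionRegular.addViscosity {i : Fin N} (h : P.DiffusionRegular J i) {ε : ℝ}
    (hε : 0 ≤ ε) : (P.addViscosity ε).DiffusionRegular J i := by
  obtain ⟨σ, C, h1, h2⟩ := h
  refine ⟨fun x => √(ε + σ x ^ 2), C, fun x hx => ?_, fun x hx y hy => ?_⟩
  · rw [Real.sq_sqrt (by positivity)]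
    simp only [KirchhoffProblem.addViscosity]
    rw [h1 x hx]
  · exact (abs_sqrt_add_sq_sub_le hε _ _).trans (h2 x hx y hy)

theorem HamiltonianRegular.continuousOn {i : Fin N} (h : P.HamiltonianRegular J i) (p : ℝ) :
    ContinuousOn (fun x => P.H i x p) (J.closedEdge i) := fun _ hx =>
  h.tendsto hx eventually_mem_nhdsWithin (tendsto_id.mono_left nhdsWithin_le_nhds)
    tendsto_const_nhds

/-- A bound from above for the subsolutions of the regularized problems, uniform in the viscosity,
obtained with a test function of constant slope. -/
theorem exists_forall_isSubsolution_le (hN : 1 ≤ N) (hlam : 0 < P.lam)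
    (hH : ∀ i, P.HamiltonianRegular J i)
    (hF : ∀ (r s : ℝ) (p q : Fin N → ℝ), s ≤ r → (∀ i, p i ≤ q i) → P.F s q ≤ P.F r p)
    {R β : ℝ} (hR : 0 < P.F R fun _ => β) :
    ∃ K, ∀ ε u, (P.addViscosity ε).IsSubsolution J u → ∀ x ∈ J.carrier, u x ≤ K := by
  choose m hm using fun i => (Junction.isCompact_closedEdge (J := J) i).exists_bound_of_continuousOn
    ((hH i).continuousOn β)
  set K₀ := |R| + ∑ i, |m i| / P.lam + ∑ i, |P.h i| with hK₀
  have hs1 : 0 ≤ ∑ i, |m i| / P.lam := by positivity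
  have hs2 : 0 ≤ ∑ i, |P.h i| := by positivity
  have hnorm : ∀ x ∈ J.carrier, ‖x‖ ≤ ∑ i, J.len i := by
    intro x hx
    obtain ⟨i, hi⟩ := mem_iUnion.1 hx
    exact (Junction.norm_mem_of_mem_closedEdge hi).1.2.trans
      (Finset.single_le_sum (fun j _ => (J.len_pos j).le) (Finset.mem_univ i))
  refine ⟨K₀ + 2 * (|β| * ∑ i, J.len i), fun ε u hu => ?_⟩
  -- The second derivative vanishes, so `ε` drops out of the equation. At `O` the Kirchhoff
  -- alternative is excluded for values at least `R` because `F(R, β, …, β) > 0`.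
  set ψ : Fin N → ℝ → ℝ := fun _ s => β * s with hψ
  have hψ0 : ∀ j, ψ j 0 = 0 := fun j => by simp [hψ]
  have hψC : ∀ j, ContDiff ℝ 2 (ψ j) := fun j => by simp only [hψ]; fun_prop
  have hC2 := Junction.isC2_testFun (J := J) hψ0 hψC
  have hval : ∀ x ∈ J.carrier, J.testFun ψ x = β * ‖x‖ := by
    intro x hx
    obtain ⟨i, hi⟩ := mem_iUnion.1 hx
    rw [Junction.testFun_apply hψ0 hi]
  have hd1 : ∀ i x, x ∈ J.closedEdge i → J.dx (J.testFun ψ) i x = β := fun i x hx => by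
    rw [Junction.dx_testFun hψ0 hψC hx]
    simp [hψ]
  have hd2 : ∀ i x, x ∈ J.closedEdge i → J.dxx (J.testFun ψ) i x = 0 := fun i x hx => by
    have h1 : deriv (fun s : ℝ => β * s) = fun _ => β := by ext; simp
    rw [Junction.dxx_testFun hψ0 hψC hx, iteratedDeriv_succ', iteratedDeriv_one]
    simp [hψ, h1]
  have husc : UpperSemicontinuousOn (fun y => u y - J.testFun ψ y) J.carrier := by
    simp only [sub_eq_add_neg]
    exact hu.usc.add hC2.1.neg.upperSemicontinuousOn
  obtain ⟨x₀, hx₀, hmax⟩ := husc.exists_isMaxOn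
    (show J.carrier.Nonempty from ⟨0, Junction.zero_mem_carrier hN⟩) J.isCompact_carrier
  have hloc : IsLocalMaxOn (fun y => u y - J.testFun ψ y) J.carrier x₀ := hmax.localize
  have hGle : ∀ i, x₀ ∈ J.closedEdge i → (P.addViscosity ε).G i (u x₀) (J.dx (J.testFun ψ) i x₀)
      (J.dxx (J.testFun ψ) i x₀) x₀ ≤ 0 → u x₀ ≤ K₀ := by
    intro i hi hG
    rw [hd1 i x₀ hi, hd2 i x₀ hi] at hG
    simp only [G, KirchhoffProblem.addViscosity, mul_zero, sub_zero] at hG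
    have h1 := (abs_le.1 ((hm i x₀ hi).trans (le_abs_self _))).1
    have h2 : u x₀ ≤ |m i| / P.lam := by
      rw [le_div_iff₀ hlam]
      linarith
    have h3 : |m i| / P.lam ≤ ∑ i, |m i| / P.lam :=
      Finset.single_le_sum (f := fun i => |m i| / P.lam) (fun j _ => by positivity)
        (Finset.mem_univ i)
    have := abs_nonneg R
    linarith
  have hx₀K : u x₀ ≤ K₀ := by
    rcases Junction.carrier_cases hx₀ with h | ⟨i, hi⟩ | ⟨i, hi⟩
    · rw [h] at hloc
      rcases hu.at_junction _ hC2 hloc with ⟨i, hi⟩ | h'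
      · refine hGle i (by rw [h]; exact Junction.zero_mem_closedEdge i) ?_
        rw [h]; exact hi
      · have e : (fun i => J.dx (J.testFun ψ) i 0) = fun _ => β := funext fun i =>
          hd1 i 0 (Junction.zero_mem_closedEdge i)
        rw [e] at h'
        rw [h]
        by_contra! hcon
        have h1 : R ≤ u 0 := by linarith [le_abs_self R]
        have h2 := hF (u 0) R (fun _ => β) (fun _ => β) h1 fun _ => le_rfl
        have h3 : P.F (u 0) (fun _ => β) ≤ 0 := h'
        linarith
    · exact hGle i (Junction.edge_subset_closedEdge i hi) (hu.on_edge _ hC2 i x₀ hi hloc)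
    · rw [hi] at hloc
      rcases hu.at_boundary _ hC2 i hloc with h' | h'
      · refine hGle i (by rw [hi]; exact Junction.vert_mem_closedEdge i) ?_
        rw [hi]; exact h'
      · have h1 : u (J.vert i) - P.h i ≤ 0 := h'
        have h2 : |P.h i| ≤ ∑ i, |P.h i| :=
          Finset.single_le_sum (f := fun i => |P.h i|) (fun j _ => by positivity)
            (Finset.mem_univ i)
        have := abs_nonneg R
        have := le_abs_self (P.h i)
        rw [hi]
        linarith
  intro x hx
  have h1 : u x - J.testFun ψ x ≤ u x₀ - J.testFun ψ x₀ := hmax hx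
  rw [hval x hx, hval x₀ hx₀] at h1
  have hb : ∀ y ∈ J.carrier, |β * ‖y‖| ≤ |β| * ∑ i, J.len i := fun y hy => by
    rw [abs_mul, abs_norm]
    gcongr
    exact hnorm y hy
  have h2 := abs_le.1 (hb x hx)
  have h3 := abs_le.1 (hb x₀ hx₀)
  linarith

theorem KirchhoffRegular.exists_pos (hN : 1 ≤ N) (hF : P.KirchhoffRegular) :
    ∃ β, 0 < P.F 0 fun _ => β := by
  -- Lowering the remaining slopes from `0` to `t ≤ 0` can only increase `F`.
  obtain ⟨t, h1, h2⟩ := (((hF.coercive ⟨0, hN⟩ 0 0).eventually_gt_atTop 0).and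
    (eventually_le_atBot 0)).exists
  refine ⟨t, h1.trans_le (hF.monotone _ _ _ _ le_rfl fun i => ?_)⟩
  by_cases hi : i = ⟨0, hN⟩
  · rw [hi, Function.update_self]
  · rw [Function.update_of_ne hi]
    exact h2

/-- If some regularized problem has a subsolution, then the junction function takes negative
values. -/
theorem exists_dual_pos (hN : 1 ≤ N) (hP : P.StandingAssumptions J) {ε : ℝ} (hε : 0 < ε)
    {u : EuclideanSpace ℝ (Fin d) → ℝ} (hu : (P.addViscosity ε).IsSubsolution J u) {B : ℝ}
    (hB : ∀ x ∈ J.carrier, |u x| ≤ B) : ∃ R β, 0 < P.dual.F R fun _ => β := by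
  have hU := hu.netSub
  have ha : ∀ i, 0 < (P.addViscosity ε).a i 0 := fun i =>
    add_pos_of_pos_of_nonneg hε ((hP.diffusion i).a_nonneg (Junction.zero_mem_closedEdge i))
  choose M hM using fun i => hU.exists_slope_le hP.lam_pos (i := i) (hP.hamiltonian i)
    ((hP.diffusion i).addViscosity hε.le) (fun h => absurd h (ha i).ne')
    (fun t ht => hB _ (Junction.param_mem_carrier ht))
  -- With `ε > 0` no edge is degenerate at `O`, so slopes above the barrier bounds can be tested
  -- with very negative second derivatives, leaving only the Kirchhoff inequality. Raising the
  -- slopes further makes it strict.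
  have h1 : P.F (u 0) (fun i => M i + 1) ≤ 0 := hU.kirchhoff_le (fun i => (ha i).le)
    (fun i => ⟨M i, by simp, hM i⟩) (fun i h => absurd h (ha i).ne')
  refine ⟨-u 0, -(∑ i, |M i| + 2), ?_⟩
  simp only [KirchhoffProblem.dual, neg_neg]
  have hlt : ∀ i, M i + 1 < ∑ i, |M i| + 2 := fun i => by
    have h2 : |M i| ≤ ∑ i, |M i| :=
      Finset.single_le_sum (f := fun i => |M i|) (fun j _ => by positivity) (Finset.mem_univ i)
    have := le_abs_self (M i)
    linarith
  have := hP.kirchhoff.strict_monotone (u 0) (u 0) _ _ le_rfl (fun i => (hlt i).le)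
    ⟨⟨0, hN⟩, hlt _⟩
  linarith

end KirchhoffProblem

/-! ### Construction of the continuous solution and convergence -/

namespace Junction

variable (J) in
theorem vert_injective : Function.Injective J.vert := by
  intro i j hij
  exact eq_of_mem_closedEdge (J.vert_ne_zero i) (vert_mem_closedEdge i)
    (by rw [hij]; exact vert_mem_closedEdge j)

theorem exists_param_eq {x : EuclideanSpace ℝ (Fin d)} (hx : x ∈ J.carrier \ J.boundary) :
    ∃ i, ∃ t ∈ Ico 0 (J.len i), J.param i t = x := by
  obtain ⟨i, hi⟩ := mem_iUnion.1 hx.1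
  obtain ⟨h1, h2⟩ := norm_mem_of_mem_closedEdge hi
  refine ⟨i, ‖x‖, ⟨h1.1, h1.2.lt_of_ne fun h => hx.2 ⟨i, ?_⟩⟩, h2⟩
  rw [← h2, h, param_len]

theorem isClosed_boundary : IsClosed J.boundary := (Set.finite_range J.vert).isClosed

theorem eventually_not_mem_boundary {x : EuclideanSpace ℝ (Fin d)} (hx : x ∉ J.boundary) :
    ∀ᶠ y in 𝓝[J.carrier] x, y ∉ J.boundary :=
  mem_nhdsWithin_of_mem_nhds (isClosed_boundary.isOpen_compl.mem_nhds hx)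

/-- Neighborhoods of a boundary vertex. -/
theorem eventually_nhdsWithin_vert {i : Fin N} {Q : EuclideanSpace ℝ (Fin d) → Prop}
    (h0 : Q (J.vert i)) (h : ∀ᶠ s in 𝓝[<] (J.len i), Q (J.param i s)) :
    ∀ᶠ y in 𝓝[J.carrier] (J.vert i), Q y := by
  refine eventually_nhdsWithin_carrier_of_ne_zero (vert_mem_closedEdge i) (J.vert_ne_zero i) ?_
  rw [show ‖J.vert i‖ = J.len i from rfl, nhdsWithin_Icc_eq_nhdsLE (J.len_pos i), ← Iio_insert,
    nhdsWithin_insert, eventually_sup]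
  refine ⟨eventually_pure.2 ?_, h⟩
  rwa [param_len]

theorem tendsto_param_vert (i : Fin N) :
    Tendsto (J.param i) (𝓝[<] (J.len i)) (𝓝[J.carrier] (J.vert i)) := by
  have h : 𝓝[<] (J.len i) ≤ 𝓝[Icc 0 (J.len i)] (J.len i) := by
    rw [nhdsWithin_Icc_eq_nhdsLE (J.len_pos i)]
    exact nhdsWithin_mono _ Iio_subset_Iic_self
  have := (tendsto_param_carrier (J := J) (i := i) (t := J.len i)).mono_left h
  rwa [param_len] at this

end Junction

namespace KirchhoffProblem

variable {P : KirchhoffProblem d N}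

/-- Comparison principle on the junction. -/
theorem IsSubsolution.add_nonpos (hN : 1 ≤ N) (hP : P.StandingAssumptions J)
    (hD : P.DirichletAssumption J) {u w : EuclideanSpace ℝ (Fin d) → ℝ} (hu : P.IsSubsolution J u)
    (hw : P.dual.IsSubsolution J w) {B : ℝ} (hB : ∀ x ∈ J.carrier, |u x| ≤ B)
    (hB' : ∀ x ∈ J.carrier, |w x| ≤ B) {x : EuclideanSpace ℝ (Fin d)}
    (hx : x ∈ J.carrier \ J.boundary) : u x + w x ≤ 0 := by
  obtain ⟨i, t, ht, rfl⟩ := Junction.exists_param_eq hx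
  exact hu.netSub.add_nonpos hN hP hD hw.netSub
    (fun i t ht => hB _ (Junction.param_mem_carrier ht))
    (fun i t ht => hB' _ (Junction.param_mem_carrier ht)) i t ht

theorem IsSubsolution.vert_le (hP : P.StandingAssumptions J) {i : Fin N}
    {u : EuclideanSpace ℝ (Fin d) → ℝ} (hu : P.IsSubsolution J u) {B : ℝ}
    (hB : ∀ x ∈ J.carrier, |u x| ≤ B) (hi : 0 < P.a i (J.vert i) ∨ P.CoerciveNearBoundary J i) :
    u (J.vert i) ≤ P.h i := by
  have := hu.netSub.vertex_le hP.lam_pos (hP.hamiltonian i) (hP.diffusion i) hi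
    (fun t ht => hB _ (Junction.param_mem_carrier ht))
  rwa [Junction.onEdge, Junction.param_len] at this

theorem dual_vert_le (hP : P.StandingAssumptions J) {i : Fin N}
    {w : EuclideanSpace ℝ (Fin d) → ℝ} (hw : P.dual.IsSubsolution J w) {B : ℝ}
    (hB : ∀ x ∈ J.carrier, |w x| ≤ B) (hi : 0 < P.a i (J.vert i)) :
    w (J.vert i) ≤ -P.h i := by
  have := hw.netSub.vertex_le (P := P.dual) hP.lam_pos (hP.hamiltonian i).dual
    (hP.diffusion i).dual (Or.inl hi) (fun t ht => hB _ (Junction.param_mem_carrier ht))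
  rwa [Junction.onEdge, Junction.param_len] at this

/-- A bounded subsolution has a limit along an edge at a boundary vertex near which the
Hamiltonian is coercive. -/
theorem IsSubsolution.exists_tendsto_vert (hP : P.StandingAssumptions J) {i : Fin N}
    {u : EuclideanSpace ℝ (Fin d) → ℝ} (hu : P.IsSubsolution J u) {B : ℝ}
    (hB : ∀ x ∈ J.carrier, |u x| ≤ B) (hi : P.CoerciveNearBoundary J i) :
    ∃ L, Tendsto (J.onEdge u i) (𝓝[<] (J.len i)) (𝓝 L) := by
  have hU := hu.netSub
  have hℓ := J.len_pos i
  have hmem : ∀ t ∈ Icc 0 (J.len i), J.len i - t ∈ Icc 0 (J.len i) :=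
    fun t ht => ⟨by linarith [ht.2], by linarith [ht.1]⟩
  have hcont : Continuous (fun s : ℝ => J.len i - s) := by fun_prop
  obtain ⟨L, hL⟩ := (hU.edge i).reverse.exists_tendsto hℓ hP.lam_pos
    ((hU.usc i).comp (g := fun t => J.len i - t) hcont.continuousOn hmem) (B := B)
    (fun t ht => hB _ (Junction.param_mem_carrier (hmem t ht))) (by
      obtain ⟨c, hc, h⟩ := hi
      refine ⟨c, hc, ?_⟩
      have h1 : Tendsto (fun s => J.len i - s) (𝓝[Icc 0 (J.len i)] 0)
          (𝓝[Icc 0 (J.len i)] (J.len i)) := by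
        refine tendsto_nhdsWithin_iff.2 ⟨?_, eventually_mem_nhdsWithin.mono hmem⟩
        have := hcont.tendsto 0
        rw [sub_zero] at this
        exact this.mono_left nhdsWithin_le_nhds
      have h2 := (Junction.tendsto_param (J := J) (i := i) (t := J.len i)).comp h1
      rw [Junction.param_len] at h2
      filter_upwards [h2.eventually h] with s hs p
      have := hs (-p)
      rwa [abs_neg] at this)
  refine ⟨L, ?_⟩
  have h1 : Tendsto (fun s => J.len i - s) (𝓝[<] (J.len i)) (𝓝[>] 0) := by
    refine tendsto_nhdsWithin_iff.2 ⟨?_, eventually_mem_nhdsWithin.mono fun s hs =>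
      show (0 : ℝ) < J.len i - s from sub_pos.2 hs⟩
    have := hcont.tendsto (J.len i)
    rw [sub_self] at this
    exact this.mono_left nhdsWithin_le_nhds
  have := hL.comp h1
  simpa [Function.comp_def] using this

/-- If a subsolution and a dual subsolution have a nonnegative sum, then they determine a continuous
function which is a solution. -/
theorem exists_isSolution (hN : 1 ≤ N) (hP : P.StandingAssumptions J)
    (hD : P.DirichletAssumption J) {U W : EuclideanSpace ℝ (Fin d) → ℝ}
    (hU : P.IsSubsolution J U) (hW : P.dual.IsSubsolution J W) {B : ℝ}
    (hUB : ∀ x ∈ J.carrier, |U x| ≤ B) (hWB : ∀ x ∈ J.carrier, |W x| ≤ B)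
    (hUW : ∀ x ∈ J.carrier, 0 ≤ U x + W x) :
    ∃ u : EuclideanSpace ℝ (Fin d) → ℝ, ContinuousOn u J.carrier ∧ P.IsSubsolution J u ∧
      P.dual.IsSubsolution J (fun x => -u x) ∧
      ∀ x ∈ J.carrier \ J.boundary, U x = u x ∧ W x = -u x := by
  have hWU : ∀ x ∈ J.carrier \ J.boundary, W x = -U x := fun x hx => by
    have h1 := hU.add_nonpos hN hP hD hW hUB hWB hx
    have h2 := hUW x hx.1
    linarith
  have hvc : ∀ i, J.vert i ∈ J.carrier := fun i =>
    Junction.closedEdge_subset_carrier i (Junction.vert_mem_closedEdge i)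
  have hUh : ∀ i, U (J.vert i) ≤ P.h i := fun i => hU.vert_le hP hUB (hD i)
  -- near a vertex, the open edge consists of points where the two functions are opposite
  have hoff : ∀ i, ∀ᶠ s in 𝓝[<] (J.len i), J.param i s ∈ J.carrier \ J.boundary := fun i => by
    filter_upwards [Ioo_mem_nhdsLT (J.len_pos i)] with s hs
    exact ⟨Junction.param_mem_carrier (Ioo_subset_Icc_self hs),
      Junction.not_mem_boundary_of_mem_edge (Junction.param_mem_edge hs)⟩
  have hUlt : ∀ i c, U (J.vert i) < c → ∀ᶠ s in 𝓝[<] (J.len i), U (J.param i s) < c :=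
    fun i c hc => (Junction.tendsto_param_vert i).eventually (hU.usc _ (hvc i) c hc)
  have hWlt : ∀ i c, W (J.vert i) < c → ∀ᶠ s in 𝓝[<] (J.len i), W (J.param i s) < c :=
    fun i c hc => (Junction.tendsto_param_vert i).eventually (hW.usc _ (hvc i) c hc)
  have hlim : ∀ i, ∃ L, Tendsto (J.onEdge U i) (𝓝[<] (J.len i)) (𝓝 L) := by
    intro i
    rcases hD i with h | h
    -- Where the diffusion is positive, `U ≤ h_i`, `W ≤ -h_i` and `U + W ≥ 0` at the vertex force `U
    -- = h_i = -W`. Upper semicontinuity of both functions then gives convergence.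
    · have h1 := dual_vert_le hP hW hWB h
      have h2 := hUW _ (hvc i)
      refine ⟨U (J.vert i), tendsto_order.2 ⟨fun c hc => ?_, fun c hc => hUlt i c hc⟩⟩
      filter_upwards [hWlt i (-c) (by linarith [hUh i]), hoff i] with s hs hs'
      rw [hWU _ hs'] at hs
      exact neg_lt_neg_iff.1 hs
    · exact hU.exists_tendsto_vert hP hUB h
  choose L hL using hlim
  have hLU : ∀ i, L i ≤ U (J.vert i) := fun i => le_of_forall_gt_imp_ge_of_dense fun c hc =>
    le_of_tendsto (hL i) ((hUlt i c hc).mono fun s hs => le_of_lt hs)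
  have hLW : ∀ i, -L i ≤ W (J.vert i) := fun i => le_of_forall_gt_imp_ge_of_dense fun c hc => by
    refine le_of_tendsto (hL i).neg ?_
    filter_upwards [hWlt i c hc, hoff i] with s hs hs'
    rw [hWU _ hs'] at hs
    exact hs.le
  -- Values at the boundary vertices are replaced by limits along the edges, since the relaxed
  -- limits may jump there.
  set u : EuclideanSpace ℝ (Fin d) → ℝ := Function.extend J.vert L U with hu
  have huv : ∀ i, u (J.vert i) = L i := fun i => J.vert_injective.extend_apply L U i
  have huU : ∀ x ∉ J.boundary, u x = U x := fun x hx => Function.extend_apply' L U x hx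
  have huEv : ∀ x ∉ J.boundary, ∀ᶠ y in 𝓝[J.carrier] x, u y = U y := fun x hx =>
    (Junction.eventually_not_mem_boundary hx).mono huU
  have huEvW : ∀ x ∉ J.boundary, ∀ᶠ y in 𝓝[J.carrier] x, -u y = W y := fun x hx => by
    filter_upwards [Junction.eventually_not_mem_boundary hx, eventually_mem_nhdsWithin]
      with y hy hyc
    rw [huU y hy, hWU y ⟨hyc, hy⟩]
  have hcont : ContinuousOn u J.carrier := by
    intro x hx
    by_cases hb : x ∈ J.boundary
    · obtain ⟨i, rfl⟩ := hb
      refine tendsto_order.2 ⟨fun c hc => ?_, fun c hc => ?_⟩ <;> rw [huv] at hc <;>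
        refine Junction.eventually_nhdsWithin_vert (by rw [huv]; exact hc) ?_
      · filter_upwards [(hL i).eventually_const_lt hc, hoff i] with s hs hs'
        rwa [huU _ hs'.2]
      · filter_upwards [(hL i).eventually_lt_const hc, hoff i] with s hs hs'
        rwa [huU _ hs'.2]
    · refine tendsto_order.2 ⟨fun c hc => ?_, fun c hc => ?_⟩ <;> rw [huU x hb] at hc
      · have hWc : W x < -c := by
          rw [hWU x ⟨hx, hb⟩]
          exact neg_lt_neg hc
        filter_upwards [hW.usc x hx (-c) hWc, huEvW x hb]
          with y hy hy'
        rw [← hy'] at hy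
        exact neg_lt_neg_iff.1 hy
      · filter_upwards [hU.usc x hx c hc, huEv x hb] with y hy hy'
        rwa [hy']
  have hlocU : ∀ {φ : EuclideanSpace ℝ (Fin d) → ℝ} {x}, x ∉ J.boundary →
      IsLocalMaxOn (fun y => u y - φ y) J.carrier x →
        IsLocalMaxOn (fun y => U y - φ y) J.carrier x := by
    intro φ x hx hm
    filter_upwards [hm, huEv x hx] with y hy hy'
    rwa [hy', huU x hx] at hy
  have hlocW : ∀ {φ : EuclideanSpace ℝ (Fin d) → ℝ} {x}, x ∈ J.carrier \ J.boundary →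
      IsLocalMaxOn (fun y => -u y - φ y) J.carrier x →
        IsLocalMaxOn (fun y => W y - φ y) J.carrier x := by
    intro φ x hx hm
    filter_upwards [hm, huEvW x hx.2] with y hy hy'
    rwa [hy', (huEvW x hx.2).self_of_nhdsWithin hx.1] at hy
  have hmem : ∀ i, ∀ x ∈ J.edge i, x ∈ J.carrier \ J.boundary := fun i x hx =>
    ⟨Junction.closedEdge_subset_carrier i (Junction.edge_subset_closedEdge i hx),
      Junction.not_mem_boundary_of_mem_edge hx⟩
  have hmem0 : (0 : EuclideanSpace ℝ (Fin d)) ∈ J.carrier \ J.boundary :=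
    ⟨Junction.zero_mem_carrier hN, Junction.zero_not_mem_boundary⟩
  have hnegW : ∀ x ∈ J.carrier \ J.boundary, -u x = W x := fun x hx => by
    rw [huU x hx.2, hWU x hx]
  refine ⟨u, hcont, ⟨hcont.upperSemicontinuousOn, fun φ hφ i x hx hm => ?_, fun φ hφ hm => ?_,
    fun φ hφ i hm => Or.inr ?_⟩, ⟨hcont.neg.upperSemicontinuousOn, fun φ hφ i x hx hm => ?_,
      fun φ hφ hm => ?_, fun φ hφ i hm => ?_⟩, fun x hx => ⟨(huU x hx.2).symm, (hnegW x hx).symm⟩⟩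
  · rw [huU x (hmem i x hx).2]
    exact hU.on_edge φ hφ i x hx (hlocU (hmem i x hx).2 hm)
  · rw [huU 0 hmem0.2]
    exact hU.at_junction φ hφ (hlocU hmem0.2 hm)
  · rw [huv]
    linarith [hLU i, hUh i]
  · rw [hnegW x (hmem i x hx)]
    exact hW.on_edge φ hφ i x hx (hlocW (hmem i x hx) hm)
  · rw [hnegW 0 hmem0]
    exact hW.at_junction φ hφ (hlocW hmem0 hm)
  · rcases (hLW i).eq_or_lt with hEq | hlt
    · have hv : -u (J.vert i) = W (J.vert i) := by rw [huv, hEq]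
      have hm' : IsLocalMaxOn (fun y => W y - φ y) J.carrier (J.vert i) := by
        have hev : ∀ᶠ y in 𝓝[J.carrier] (J.vert i), -u y = W y :=
          Junction.eventually_nhdsWithin_vert hv ((hoff i).mono fun s hs => hnegW _ hs)
        filter_upwards [hm, hev] with y hy hy'
        rwa [hy', hv] at hy
      rw [hv]
      exact hW.at_boundary φ hφ i hm'
    · by_cases hLh : -L i ≤ -P.h i
      · right
        rw [huv]
        change -L i - -P.h i ≤ 0
        linarith
      left
      have hWh : ¬ W (J.vert i) ≤ -P.h i := by linarith
      have ha : P.a i (J.vert i) = 0 := by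
        refine le_antisymm ?_ ((hP.diffusion i).a_nonneg (Junction.vert_mem_closedEdge i))
        by_contra! h
        exact hWh (dual_vert_le hP hW hWB h)
      -- Since `W` jumps up at the vertex, every slope can be tested there. The diffusion vanishes,
      -- so the second derivative plays no role, and the inequality for `W` passes to the smaller
      -- value `-L i` because `λ > 0`.
      have htest := hW.netSub.vertex i (J.dx φ i (J.vert i)) 0 (by
        rw [nhdsWithin_Icc_eq_nhdsLE (J.len_pos i), ← Iio_insert, nhdsWithin_insert, eventually_sup]
        refine ⟨eventually_pure.2 (by simp), ?_⟩
        have h1 : Tendsto (fun s => J.onEdge W i (J.len i) +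
            J.dx φ i (J.vert i) * (s - J.len i) + 0 / 2 * (s - J.len i) ^ 2) (𝓝[<] (J.len i))
            (𝓝 (W (J.vert i))) := by
          have : Continuous (fun s : ℝ => J.onEdge W i (J.len i) +
            J.dx φ i (J.vert i) * (s - J.len i) + 0 / 2 * (s - J.len i) ^ 2) := by fun_prop
          have := this.tendsto (J.len i)
          simp only [sub_self, mul_zero, add_zero, zero_div, zero_mul] at this
          rw [Junction.onEdge, Junction.param_len] at this
          simpa [Junction.onEdge] using this.mono_left nhdsWithin_le_nhds
        filter_upwards [((hL i).neg).eventually_lt h1 hlt, hoff i] with s hs hs'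
        rw [Junction.onEdge, hWU _ hs']
        exact hs.le)
      have htest := htest.resolve_right (by
        rw [Junction.onEdge, Junction.param_len]
        exact hWh)
      rw [Junction.onEdge, Junction.param_len] at htest
      have ha' : P.dual.a i (J.vert i) = 0 := ha
      simp only [G]
      rw [ha', zero_mul, sub_zero] at htest ⊢
      rw [huv]
      have hl : P.dual.lam * -L i ≤ P.dual.lam * W (J.vert i) :=
        mul_le_mul_of_nonneg_left hlt.le hP.lam_pos.le
      linarith

theorem isSolution_of_continuousOn (hN : 1 ≤ N) {u : EuclideanSpace ℝ (Fin d) → ℝ}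
    (hc : ContinuousOn u J.carrier) (hu : P.IsSubsolution J u)
    (hu' : P.dual.IsSubsolution J fun x => -u x) : P.IsSolution J u := by
  refine ⟨fun x hx => ⟨|u x| + 1, ?_⟩, hu.congr hN fun x hx =>
    Junction.uscEnvelope_eq_of_continuousOn hc hx, isSubsolution_dual_iff.1 ?_⟩
  · exact ((hc x hx).abs.eventually_lt_const (lt_add_one _)).mono fun y hy => le_of_lt hy
  · refine hu'.congr hN fun x hx => ?_
    have h := Junction.uscEnvelope_eq_of_continuousOn hc.fun_neg hx
    rw [Junction.lscEnvelope_eq_neg, h, neg_neg]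

/-- A solution coincides with a continuous solution away from the boundary vertices. -/
theorem IsSolution.eq_of_sub_of_dual_sub (hN : 1 ≤ N) (hP : P.StandingAssumptions J)
    (hD : P.DirichletAssumption J) {u w : EuclideanSpace ℝ (Fin d) → ℝ}
    (hc : ContinuousOn u J.carrier) (hu : P.IsSubsolution J u)
    (hu' : P.dual.IsSubsolution J fun x => -u x) (hw : P.IsSolution J w) :
    EqOn w u (J.carrier \ J.boundary) := by
  obtain ⟨B, hB⟩ := hw.locallyBdd.exists_bound
  have hBn : ∀ x ∈ J.carrier, |(fun x => -w x) x| ≤ B := by simpa only [abs_neg] using hB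
  obtain ⟨B', hB'⟩ := J.isCompact_carrier.exists_bound_of_continuousOn hc
  have h1 : ∀ x ∈ J.carrier, |u x| ≤ max B B' := fun x hx => (hB' x hx).trans (le_max_right _ _)
  have h2 : ∀ x ∈ J.carrier, |-u x| ≤ max B B' := by simpa only [abs_neg] using h1
  have h3 : ∀ x ∈ J.carrier, |J.uscEnvelope w x| ≤ max B B' := fun x hx =>
    (Junction.abs_uscEnvelope_le hB hx).trans (le_max_left _ _)
  have h4 : ∀ x ∈ J.carrier, |J.uscEnvelope (fun x => -w x) x| ≤ max B B' := fun x hx =>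
    (Junction.abs_uscEnvelope_le hBn hx).trans (le_max_left _ _)
  intro x hx
  -- Comparison is used twice, for the upper envelope of `w` with `-u` and for `u` with the upper
  -- envelope of `-w`; continuity of `u` closes the chain of inequalities.
  have h5 := hw.sub.add_nonpos hN hP hD hu' h3 h2 hx
  have h6 := hu.add_nonpos hN hP hD hw.dual_sub h1 h4 hx
  have h7 := Junction.le_uscEnvelope hB hx.1
  have h8 := Junction.le_uscEnvelope hBn hx.1
  exact le_antisymm (by linarith) (by linarith)

end KirchhoffProblem

theorem Junction.eqOn_carrier_of_continuousOn {u w : EuclideanSpace ℝ (Fin d) → ℝ}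
    (hu : ContinuousOn u J.carrier) (hw : ContinuousOn w J.carrier)
    (h : EqOn w u (J.carrier \ J.boundary)) : EqOn w u J.carrier := by
  intro x hx
  by_cases hb : x ∈ J.boundary
  · obtain ⟨i, rfl⟩ := hb
    have h1 := (hu _ hx).tendsto.comp (Junction.tendsto_param_vert i)
    have h2 := (hw _ hx).tendsto.comp (Junction.tendsto_param_vert i)
    refine tendsto_nhds_unique (h2.congr' ?_) h1
    filter_upwards [Ioo_mem_nhdsLT (J.len_pos i)] with s hs
    exact h ⟨Junction.param_mem_carrier (Ioo_subset_Icc_self hs),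
      Junction.not_mem_boundary_of_mem_edge (Junction.param_mem_edge hs)⟩
  · exact h ⟨hx, hb⟩

/-- Functions squeezed between two families with opposite relaxed limits converge uniformly. -/
theorem Junction.tendstoUniformlyOn_of_relaxedLimsup {V W v : ℝ → EuclideanSpace ℝ (Fin d) → ℝ}
    {u : EuclideanSpace ℝ (Fin d) → ℝ} {ε₀ B : ℝ} (hε₀ : 0 < ε₀)
    (hV : ∀ ε ∈ Ioo 0 ε₀, ∀ y ∈ J.carrier, |V ε y| ≤ B)
    (hW : ∀ ε ∈ Ioo 0 ε₀, ∀ y ∈ J.carrier, |W ε y| ≤ B)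
    (hvV : ∀ ε ∈ Ioo 0 ε₀, ∀ y ∈ J.carrier, v ε y ≤ V ε y)
    (hvW : ∀ ε ∈ Ioo 0 ε₀, ∀ y ∈ J.carrier, -v ε y ≤ W ε y) (hu : ContinuousOn u J.carrier)
    {K : Set (EuclideanSpace ℝ (Fin d))} (hK : IsCompact K) (hKJ : K ⊆ J.carrier)
    (hKV : ∀ x ∈ K, J.relaxedLimsup V x = u x) (hKW : ∀ x ∈ K, J.relaxedLimsup W x = -u x) :
    TendstoUniformlyOn v u (𝓝[>] 0) K := by
  rw [Metric.tendstoUniformlyOn_iff]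
  intro η hη
  have hgen : ∀ (V : ℝ → EuclideanSpace ℝ (Fin d) → ℝ) (u : EuclideanSpace ℝ (Fin d) → ℝ),
      (∀ ε ∈ Ioo 0 ε₀, ∀ y ∈ J.carrier, |V ε y| ≤ B) → ContinuousOn u J.carrier →
      (∀ x ∈ K, J.relaxedLimsup V x = u x) → ∀ᶠ ε in 𝓝[>] (0 : ℝ), ∀ y ∈ K, V ε y < u y + η := by
    intro V u hV hu hKV
    refine eventually_forall_of_isCompact (J := J) (Q := fun ε y => V ε y < u y + η) hK hKJ
      fun x hx => ?_
    have h1 := eventually_lt_of_limsup_lt_of_abs_le (eventually_abs_le hε₀ hV x)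
      (show J.relaxedLimsup V x < u x + η / 2 by rw [hKV x hx]; linarith)
    have h2 : ∀ᶠ y in 𝓝[J.carrier] x, u x - η / 2 < u y :=
      (hu x (hKJ hx)).eventually_const_lt (by linarith)
    filter_upwards [h1, h2.prod_inr (𝓝[>] (0 : ℝ))] with z hz1 hz2
    linarith
  have hI : ∀ᶠ ε in 𝓝[>] (0 : ℝ), ε ∈ Ioo 0 ε₀ := Ioo_mem_nhdsGT hε₀
  filter_upwards [hgen V u hV hu hKV, hgen W (fun x => -u x) hW hu.neg hKW, hI] with ε h1 h2 hε y hy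
  have h3 := h1 y hy
  have h4 := h2 y hy
  have h5 := hvV ε hε y (hKJ hy)
  have h6 := hvW ε hε y (hKJ hy)
  rw [Real.dist_eq, abs_lt]
  constructor <;> linarith

/-- A nonnegative sum passes to the relaxed limits. -/
theorem Junction.relaxedLimsup_add_nonneg {V W : ℝ → EuclideanSpace ℝ (Fin d) → ℝ} {ε₀ B : ℝ}
    (hε₀ : 0 < ε₀) (hV : ∀ ε ∈ Ioo 0 ε₀, ∀ y ∈ J.carrier, |V ε y| ≤ B)
    (hW : ∀ ε ∈ Ioo 0 ε₀, ∀ y ∈ J.carrier, |W ε y| ≤ B)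
    (hVW : ∀ ε ∈ Ioo 0 ε₀, ∀ y ∈ J.carrier, 0 ≤ V ε y + W ε y) {x : EuclideanSpace ℝ (Fin d)}
    (hx : x ∈ J.carrier) : 0 ≤ J.relaxedLimsup V x + J.relaxedLimsup W x := by
  have := neBot_nhdsWithin_carrier hx
  by_contra! h
  obtain ⟨c, h1, h2⟩ := exists_between (show J.relaxedLimsup V x < -J.relaxedLimsup W x by linarith)
  obtain ⟨z, hz1, hz2, hz3⟩ := ((eventually_lt_of_limsup_lt_of_abs_le (eventually_abs_le hε₀ hV x)
    h1).and ((eventually_lt_of_limsup_lt_of_abs_le (eventually_abs_le hε₀ hW x)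
    (show J.relaxedLimsup W x < -c by linarith)).and (eventually_mem_prod (J := J) hε₀ x))).exists
  have := hVW _ hz3.1 _ hz3.2
  linarith

end Network

/-! ### Conclusion: vanishing viscosity -/

theorem proposition5p3 {d N : ℕ} (hN : 1 ≤ N) (J : Junction d N) (P : KirchhoffProblem d N)
    (hP : P.StandingAssumptions J) (hD : P.DirichletAssumption J)
    (ε₀ : ℝ) (hε₀ : 0 < ε₀) (uε : ℝ → EuclideanSpace ℝ (Fin d) → ℝ)
    (huε : ∀ ε ∈ Set.Ioo 0 ε₀, (P.addViscosity ε).IsSolution J (uε ε)) :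
    ∃ u : EuclideanSpace ℝ (Fin d) → ℝ,
      ContinuousOn u J.carrier ∧ P.IsSolution J u ∧
      (∀ w, P.IsSolution J w → ContinuousOn w J.carrier → Set.EqOn w u J.carrier) ∧
      (∀ w, P.IsSolution J w → Set.EqOn w u (J.carrier \ J.boundary)) ∧
      ∀ K : Set (EuclideanSpace ℝ (Fin d)), K ⊆ J.carrier \ J.boundary → IsCompact K →
        TendstoUniformlyOn uε u (𝓝[>] (0 : ℝ)) K := by
  set V : ℝ → EuclideanSpace ℝ (Fin d) → ℝ := fun ε => J.uscEnvelope (uε ε) with hVdef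
  set W : ℝ → EuclideanSpace ℝ (Fin d) → ℝ := fun ε => J.uscEnvelope fun x => -uε ε x with hWdef
  have hV : ∀ ε ∈ Ioo 0 ε₀, (P.addViscosity ε).IsSubsolution J (V ε) := fun ε hε => (huε ε hε).sub
  have hW : ∀ ε ∈ Ioo 0 ε₀, (P.dual.addViscosity ε).IsSubsolution J (W ε) := fun ε hε =>
    (huε ε hε).dual_sub
  have hle : ∀ ε ∈ Ioo 0 ε₀, ∀ y ∈ J.carrier, uε ε y ≤ V ε y := fun ε hε y hy => by
    obtain ⟨B, hB⟩ := (huε ε hε).locallyBdd.exists_bound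
    exact Junction.le_uscEnvelope hB hy
  have hle' : ∀ ε ∈ Ioo 0 ε₀, ∀ y ∈ J.carrier, -uε ε y ≤ W ε y := fun ε hε y hy => by
    obtain ⟨B, hB⟩ := (huε ε hε).locallyBdd.neg.exists_bound
    exact Junction.le_uscEnvelope (u := fun x => -uε ε x) hB hy
  obtain ⟨β, hβ⟩ := hP.kirchhoff.exists_pos hN
  obtain ⟨K₁, hK₁⟩ := KirchhoffProblem.exists_forall_isSubsolution_le (J := J) hN hP.lam_pos
    hP.hamiltonian hP.kirchhoff.monotone hβ
  -- One value of `ε` suffices to find where `F` is negative; the resulting lower bound holds for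
  -- every `ε`.
  have hhalf : ε₀ / 2 ∈ Ioo 0 ε₀ := ⟨by linarith, by linarith⟩
  obtain ⟨B, hB⟩ := (huε _ hhalf).locallyBdd.exists_bound
  obtain ⟨R, β', hβ'⟩ := KirchhoffProblem.exists_dual_pos hN hP hhalf.1 (hV _ hhalf)
    fun x hx => Junction.abs_uscEnvelope_le hB hx
  obtain ⟨K₂, hK₂⟩ := KirchhoffProblem.exists_forall_isSubsolution_le (J := J) (P := P.dual) hN
    hP.lam_pos (fun i => (hP.hamiltonian i).dual) (fun r s p q hrs hpq => by
      simp only [KirchhoffProblem.dual]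
      exact neg_le_neg (hP.kirchhoff.monotone _ _ _ _ (neg_le_neg hrs) fun i => neg_le_neg (hpq i)))
    hβ'
  -- The lower bound on each envelope comes from the upper bound on the other, through `-W ≤ u^ε ≤
  -- V`.
  have hVK : ∀ ε ∈ Ioo 0 ε₀, ∀ y ∈ J.carrier, |V ε y| ≤ max K₁ K₂ := fun ε hε y hy => by
    have h1 := hK₁ ε _ (hV ε hε) y hy
    have h2 := hK₂ ε _ (hW ε hε) y hy
    have h3 := hle ε hε y hy
    have h4 := hle' ε hε y hy
    exact abs_le.2 ⟨by linarith [le_max_right K₁ K₂], h1.trans (le_max_left _ _)⟩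
  have hWK : ∀ ε ∈ Ioo 0 ε₀, ∀ y ∈ J.carrier, |W ε y| ≤ max K₁ K₂ := fun ε hε y hy => by
    have h1 := hK₁ ε _ (hV ε hε) y hy
    have h2 := hK₂ ε _ (hW ε hε) y hy
    have h3 := hle ε hε y hy
    have h4 := hle' ε hε y hy
    exact abs_le.2 ⟨by linarith [le_max_left K₁ K₂], h2.trans (le_max_right _ _)⟩
  have hFd : Continuous fun z : ℝ × (Fin N → ℝ) => P.dual.F z.1 z.2 := by
    have : Continuous fun z : ℝ × (Fin N → ℝ) => ((-z.1, fun i => -z.2 i) : ℝ × (Fin N → ℝ)) := by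
      fun_prop
    exact (hP.kirchhoff.continuous.comp this).neg
  have hsub := KirchhoffProblem.isSubsolution_relaxedLimsup hN hP.hamiltonian hP.diffusion
    hP.kirchhoff.continuous hε₀ hVK hV
  have hsub' := KirchhoffProblem.isSubsolution_relaxedLimsup (P := P.dual) hN
    (fun i => (hP.hamiltonian i).dual) (fun i => (hP.diffusion i).dual) hFd hε₀ hWK hW
  obtain ⟨u, hc, hu, hu', huVW⟩ := KirchhoffProblem.exists_isSolution hN hP hD hsub hsub'
    (fun x hx => Junction.abs_relaxedLimsup_le hε₀ hVK hx)
    (fun x hx => Junction.abs_relaxedLimsup_le hε₀ hWK hx)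
    (fun x hx => Junction.relaxedLimsup_add_nonneg hε₀ hVK hWK
      (fun ε hε y hy => by linarith [hle ε hε y hy, hle' ε hε y hy]) hx)
  have huniq : ∀ w, P.IsSolution J w → Set.EqOn w u (J.carrier \ J.boundary) := fun w hw =>
    hw.eq_of_sub_of_dual_sub hN hP hD hc hu hu'
  refine ⟨u, hc, KirchhoffProblem.isSolution_of_continuousOn hN hc hu hu', fun w hw hwc =>
    Junction.eqOn_carrier_of_continuousOn hc hwc (huniq w hw), huniq, fun K hK hKc => ?_⟩
  exact Junction.tendstoUniformlyOn_of_relaxedLimsup hε₀ hVK hWK hle hle' hc hKc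
    (fun x hx => (hK hx).1) (fun x hx => (huVW x (hK hx)).1) (fun x hx => (huVW x (hK hx)).2)
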